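/- Monoids are commutative and cancellative with identity; $\mathsf q(H)$ denotes the quotient group of a monoid $H$, $H^\times$ its group of units, $\widehat H=\{x\in\mathsf q(H)\mid \exists\, c\in H\ \forall n\in\mathbb N:\ cx^n\in H\}$ its complete integral closure, $H_{\rm red}=H/H^\times$, and $\mathfrak X(H)$ the set of minimal non-empty prime $s$-ideals of $H$. The $v$-class group $\mathcal C_v(H)$ is the group of fractional $v$-invertible $v$-ideals (under $v$-multiplication) modulo the fractional principal ideals. $H$ is weakly Krull if $H=\bigcap_{\mathfrak p\in\mathfrak X(H)}H_{\mathfrak p}$ and every $a\in H$ lies in only finitely many $\mathfrak p\in\mathfrak X(H)$; it is seminormal if every $x\in\mathsf q(H)$ with $x^n\in H$ for all large $n$ lies in $H$; it is $v$-noetherian if it satisfies the ascending chain condition on divisorial ideals. A monoid $D$ is finitely primary of rank $s\ge 1$ if it is a submonoid of a factorial monoid $F=F^\times\times[q_1,\dots,q_s]$ with $s$ pairwise non-associated primes $q_1,\dots,q_s$ such that $D\setminus D^\times\subset q_1\cdots q_sF$ and $(q_1\cdots q_s)^\alpha F\subset D$ for some $\alpha\ge 1$ (then $F=\widehat D$).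 For $a\in H$, $\mathsf L(a)$ is the set of lengths of factorizations of $a$ into atoms; $\Delta(H)$ is the set of all $d\in\mathbb N$ such that $d=l-k$ for two consecutive elements $k<l$ of some $\mathsf L(a)$; $\mathsf c(H)$ is the catenary degree of $H$. By convention $\max\emptyset=0$ and $\emptyset$ counts as an interval. **Theorem 3.3.** Let $H$ be a seminormal $v$-noetherian weakly Krull monoid whose conductor $\mathfrak f=(H:\widehat H)=\{x\in \mathsf q(H)\mid x\widehat H\subset H\}$ satisfies $\emptyset\ne\mathfrak f\subsetneq H$. Let $\mathcal P^*=\{\mathfrak p_1,\dots,\mathfrak p_n\}=\{\mathfrak p\in\mathfrak X(H)\mid \mathfrak p\supset\mathfrak f\}$ and $\mathcal P=\mathfrak X(H)\setminus\mathcal P^*$. Suppose that $H_{\mathfrak p_\nu}$ is finitely primary of rank $s_\nu$ for all $\nu\in[1,n]$, that the $v$-class group $G=\mathcal C_v(H)=\{0,e\}$ has exactly two elements, and that each class contains some $\mathfrak p\in\mathcal P$. Then $\Delta(H)$ is a (finite) interval with $2+\max\Delta(H)=\mathsf c(H)$, and either $\Delta(H)=\emptyset$ or $\min\Delta(H)=1$.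 Moreover, put $D_\nu=(H_{\mathfrak p_\nu})_{\rm red}$ and write $\widehat{D_\nu}=\widehat{D_\nu}^\times\times[q_{\nu,1},\dots,q_{\nu,s_\nu}]$ with pairwise non-associated primes $q_{\nu,i}$. For $x\in\mathsf q(D_\nu)=\mathsf q(H)/H_{\mathfrak p_\nu}^\times$ let $[x]\in G$ be the class of the fractional $v$-invertible $v$-ideal $xH_{\mathfrak p_\nu}\cap\bigcap_{\mathfrak p\in\mathfrak X(H),\,\mathfrak p\ne\mathfrak p_\nu}H_{\mathfrak p}$ of $H$. Let $G_\nu=\{[\epsilon]\mid\epsilon\in\widehat{D_\nu}^\times\}$ and $t_\nu=|\{i\in[1,s_\nu]\mid[q_{\nu,i}]=e\}|$. Then $$\max\Delta(H)=\max\big(\{d_\nu+d_{\nu'}\mid \nu,\nu'\in[1,n],\ \nu\ne\nu'\}\cup\{|d_\nu|\mid\nu\in[1,n]\}\big),$$ where $$d_\nu=\begin{cases}2,&\text{if }G_\nu=\{0\}\text{ and }s_\nu=t_\nu=2,\\ 0,&\text{if }G_\nu=\{0\}\text{ and }s_\nu=1,\\ -1,&\text{if }G_\nu=\{0\},\ s_\nu\ge2\text{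 and }t_\nu=0,\\ 1,&\text{if }G_\nu\ne\{0\},\text{ or }(s_\nu\ge2\text{ and }t_\nu=1),\text{ or }(s_\nu\ge3\text{ and }t_\nu\ge2).\end{cases}$$ -/

import Mathlib

namespace WeaklyKrull

open scoped Pointwise

/-! ## Arithmetic of a commutative monoid: factorizations, lengths, distances, catenary degree -/

section Arithmetic

variable {M : Type*} [CommMonoid M]

/-- `Z(a)`: the factorizations of `a`, i.e. the multisets of atoms of the reduced monoid
`M_red = M / M^×` whose product is the class of `a`. -/
def factorizations (a : M) : Set (Multiset (Associates M)) :=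
  {z | (∀ u ∈ z, Irreducible u) ∧ z.prod = Associates.mk a}

/-- `L(a)`: the set of lengths of `a`. -/
def lengths (a : M) : Set ℕ := Multiset.card '' factorizations a

/-- `Δ(L)` for a set `L` of natural numbers: the positive differences `l - k` of elements
`k < l` of `L` with no element of `L` strictly in between. -/
def distancesOf (L : Set ℕ) : Set ℕ :=
  {d | 0 < d ∧ ∃ k ∈ L, k + d ∈ L ∧ ∀ m ∈ L, ¬ (k < m ∧ m < k + d)}

variable (M) in
/-- `Δ(M)`: the set of distances of the monoid `M`. -/
def setOfDistances : Set ℕ := ⋃ a : M, distancesOf (lengths a)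

open Classical in
/-- The distance `d(z, z')` of two factorizations: remove the greatest common divisor and take
the larger of the two remaining lengths. -/
noncomputable def factDist (z z' : Multiset (Associates M)) : ℕ :=
  max (Multiset.card (z - z')) (Multiset.card (z' - z))

/-- One step of an `N`-chain of factorizations of `a`. -/
def ChainStep (a : M) (N : ℕ∞) (z z' : Multiset (Associates M)) : Prop :=
  z ∈ factorizations a ∧ z' ∈ factorizations a ∧ (factDist z z' : ℕ∞) ≤ N

/-- `c(a)`: the smallest `N ∈ ℕ ∪ {∞}` such that any two factorizations of `a` can be
concatenated by an `N`-chain of factorizations of `a`. -/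
noncomputable def catenaryDegreeOf (a : M) : ℕ∞ :=
  sInf {N | ∀ z ∈ factorizations a, ∀ z' ∈ factorizations a,
    Relation.ReflTransGen (ChainStep a N) z z'}

variable (M) in
/-- `c(M)`: the catenary degree of the monoid `M`. -/
noncomputable def catenaryDegree : ℕ∞ := ⨆ a : M, catenaryDegreeOf a

end Arithmetic

/-! ## Ideal theory of a cancellative monoid

A commutative cancellative monoid is given as a submonoid `H` of its quotient group `Q = q(H)`. -/

section IdealTheory

variable {Q : Type*} [CommGroup Q]

/-- `Q` is the quotient group of its submonoid `H`. -/
def IsQuotientGroup (H : Submonoid Q) : Prop := ∀ x : Q, ∃ a ∈ H, ∃ b ∈ H, x = a * b⁻¹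

/-- `u ∈ D^×`, the group of invertible elements of `D`. -/
def IsUnitOf (D : Submonoid Q) (u : Q) : Prop := u ∈ D ∧ u⁻¹ ∈ D

/-- `(A : B) = {x ∈ Q | x B ⊆ A}`. -/
def colon (A B : Set Q) : Set Q := {x | ∀ b ∈ B, x * b ∈ A}

/-- `A_v = (A⁻¹)⁻¹`, where `A⁻¹ = (H : A)`. -/
def vClosure (H : Submonoid Q) (A : Set Q) : Set Q := colon H (colon H A)

/-- `H` is `v`-noetherian: the ascending chain condition holds for the divisorial ideals
(`v`-ideals) contained in `H`. -/
def IsVNoetherian (H : Submonoid Q) : Prop :=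
  WellFoundedGT {A : Set Q // A ⊆ (H : Set Q) ∧ vClosure H A = A}

/-- `H` equals its seminormal closure
`H' = {x ∈ Q | there is N such that x ^ n ∈ H for all n ≥ N}`. -/
def IsSeminormal (H : Submonoid Q) : Prop :=
  ∀ x : Q, (∃ N : ℕ, ∀ n ≥ N, x ^ n ∈ H) → x ∈ H

/-- The complete integral closure of `H` in its quotient group `Q`. -/
def completeIntegralClosure (H : Submonoid Q) : Submonoid Q where
  carrier := {x | ∃ c ∈ H, ∀ n : ℕ, c * x ^ n ∈ H}
  one_mem' := ⟨1, H.one_mem, fun n => by simp⟩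
  mul_mem' := by
    rintro x y ⟨c, hc, hx⟩ ⟨d, hd, hy⟩
    refine ⟨c * d, H.mul_mem hc hd, fun n => ?_⟩
    rw [mul_pow, mul_mul_mul_comm]
    exact H.mul_mem (hx n) (hy n)

/-- The conductor `(H : Ĥ)`. -/
def conductor (H : Submonoid Q) : Set Q := colon H (completeIntegralClosure H)

/-- `p` is a prime `s`-ideal of `H`. -/
structure IsPrimeSIdeal (H : Submonoid Q) (p : Set Q) : Prop where
  subset : p ⊆ H
  mul_mem : ∀ a ∈ p, ∀ b ∈ H, a * b ∈ p
  one_notMem : (1 : Q) ∉ p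
  mem_or_mem : ∀ a ∈ H, ∀ b ∈ H, a * b ∈ p → a ∈ p ∨ b ∈ p

/-- `𝔛(H)`: the minimal non-empty prime `s`-ideals of `H`. -/
def MinPrime (H : Submonoid Q) : Type _ :=
  {p : Set Q // Minimal (fun p => IsPrimeSIdeal H p ∧ p.Nonempty) p}

/-- The localization `H_p = (H \ p)⁻¹ H`, as a submonoid of `Q`. -/
def localization (H : Submonoid Q) (p : MinPrime H) : Submonoid Q where
  carrier := {x | ∃ s ∈ H, s ∉ p.1 ∧ s * x ∈ H}
  one_mem' := ⟨1, H.one_mem, p.2.1.1.one_notMem, by simp⟩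
  mul_mem' := by
    rintro x y ⟨s, hs, hsp, hx⟩ ⟨t, ht, htp, hy⟩
    refine ⟨s * t, H.mul_mem hs ht, fun h => ?_, ?_⟩
    · rcases p.2.1.1.mem_or_mem s hs t ht h with h | h
      · exact hsp h
      · exact htp h
    · rw [mul_mul_mul_comm]
      exact H.mul_mem hx hy

/-- `H` is weakly Krull: it is the intersection of its localizations at the primes in `𝔛(H)`,
and every element of `H` lies in only finitely many of these primes. -/
def IsWeaklyKrull (H : Submonoid Q) : Prop :=
  (H : Set Q) = ⋂ p : MinPrime H, (localization H p : Set Q) ∧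
    ∀ a ∈ H, {p : MinPrime H | a ∈ p.1}.Finite

/-- `F` is factorial and `F = F^× × [q_1, …, q_s]`: every element of `F` is of the form
`u q_1 ^ k_1 ⋯ q_s ^ k_s` with a unit `u` of `F` and unique exponents `k_i` (equivalently, `F` is
factorial and the `q_i` represent its prime elements, without repetition, up to associates). -/
def IsPrimeBasis (F : Submonoid Q) {s : ℕ} (q : Fin s → Q) : Prop :=
  (∀ i, q i ∈ F) ∧ ∀ x ∈ F, ∃! k : Fin s → ℕ, ∃ u, IsUnitOf F u ∧ x = u * ∏ i, q i ^ k i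

/-- `D` is finitely primary of rank `s`. (The overmonoid `F` lies in the quotient group of `D`,
because a multiple of it lies in `D`, so it is a submonoid of `Q`.) -/
def IsFinitelyPrimary (D : Submonoid Q) (s : ℕ) : Prop :=
  0 < s ∧ ∃ (F : Submonoid Q) (q : Fin s → Q), D ≤ F ∧ IsPrimeBasis F q ∧
    (∀ x ∈ D, ¬ IsUnitOf D x → ∃ y ∈ F, x = (∏ i, q i) * y) ∧
    ∃ α : ℕ, 0 < α ∧ ∀ y ∈ F, (∏ i, q i) ^ α * y ∈ D

/-! ### The group of fractional `v`-invertible `v`-ideals and the `v`-class group -/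

theorem mem_colon_iff {H : Submonoid Q} {A : Set Q} {x : Q} :
    x ∈ colon (H : Set Q) A ↔ ∀ b ∈ A, x * b ∈ H := Iff.rfl

theorem colon_anti {H : Submonoid Q} {A B : Set Q} (h : A ⊆ B) :
    colon (H : Set Q) B ⊆ colon (H : Set Q) A := fun _ hx b hb => hx b (h hb)

theorem subset_vClosure (H : Submonoid Q) (A : Set Q) : A ⊆ vClosure H A := by
  intro a ha b hb
  rw [mul_comm]
  exact hb a ha

theorem colon_vClosure (H : Submonoid Q) (A : Set Q) :
    colon (H : Set Q) (vClosure H A) = colon H A :=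
  Set.Subset.antisymm (colon_anti (subset_vClosure H A)) (subset_vClosure H (colon H A))

theorem vClosure_colon (H : Submonoid Q) (A : Set Q) :
    vClosure H (colon (H : Set Q) A) = colon H A := colon_vClosure H A

theorem vClosure_idem (H : Submonoid Q) (A : Set Q) :
    vClosure H (vClosure H A) = vClosure H A := vClosure_colon H _

theorem vClosure_mono {H : Submonoid Q} {A B : Set Q} (h : A ⊆ B) :
    vClosure H A ⊆ vClosure H B := colon_anti (colon_anti h)

theorem vClosure_vClosure_mul (H : Submonoid Q) (A B : Set Q) :
    vClosure H (vClosure H A * B) = vClosure H (A * B) := by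
  apply Set.Subset.antisymm
  · rw [← vClosure_idem H (A * B)]
    apply vClosure_mono
    rintro _ ⟨x, hx, b, hb, rfl⟩ c hc
    have h : c * b ∈ colon (H : Set Q) A := by
      intro a ha
      have := hc (a * b) ⟨a, ha, b, hb, rfl⟩
      rwa [mul_comm a b, ← mul_assoc] at this
    have := hx _ h
    change x * b * c ∈ H
    rwa [mul_assoc, mul_comm b c]
  · exact vClosure_mono (Set.mul_subset_mul_right (subset_vClosure H A))

theorem vClosure_mul_vClosure (H : Submonoid Q) (A B : Set Q) :
    vClosure H (A * vClosure H B) = vClosure H (A * B) := by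
  rw [mul_comm, vClosure_vClosure_mul, mul_comm]

theorem colon_self (H : Submonoid Q) : colon (H : Set Q) H = H := by
  ext x
  refine ⟨fun h => ?_, fun h b hb => H.mul_mem h hb⟩
  have := h 1 H.one_mem
  rwa [mul_one] at this

theorem vClosure_self (H : Submonoid Q) : vClosure H (H : Set Q) = H := by
  rw [vClosure, colon_self, colon_self]

theorem vClosure_self_mul (H : Submonoid Q) (A : Set Q) :
    vClosure H ((H : Set Q) * A) = vClosure H A := by
  apply Set.Subset.antisymm
  · rw [← vClosure_idem H A]
    apply vClosure_mono
    rintro _ ⟨x, hx, a, ha, rfl⟩ c hc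
    have := H.mul_mem hx (hc a ha)
    change x * a * c ∈ H
    rwa [mul_assoc, mul_comm a c]
  · apply vClosure_mono
    intro a ha
    exact ⟨1, H.one_mem, a, ha, one_mul a⟩

theorem colon_smul (H : Submonoid Q) (x : Q) :
    colon (H : Set Q) (x • (H : Set Q)) = x⁻¹ • (H : Set Q) := by
  ext y
  rw [Set.mem_smul_set_iff_inv_smul_mem, inv_inv, smul_eq_mul]
  constructor
  · intro h
    have := h x ⟨1, H.one_mem, by simp⟩
    rwa [mul_comm] at this
  · rintro h _ ⟨b, hb, rfl⟩
    have := H.mul_mem h hb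
    change y * (x * b) ∈ H
    rwa [← mul_assoc, mul_comm y x]

theorem vClosure_smul (H : Submonoid Q) (x : Q) :
    vClosure H (x • (H : Set Q)) = x • (H : Set Q) := by
  rw [vClosure, colon_smul, colon_smul, inv_inv]

theorem smul_mul_smul_self (H : Submonoid Q) (x y : Q) :
    (x • (H : Set Q)) * (y • (H : Set Q)) = (x * y) • (H : Set Q) := by
  rw [smul_mul_smul_comm, Submonoid.coe_mul_self_eq]

/-- The fractional `v`-invertible `v`-ideals of `H`: the subsets `A` of `Q` with `A_v = A` and
`(A A⁻¹)_v = H`. -/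
@[ext]
structure InvVIdeal (H : Submonoid Q) where
  carrier : Set Q
  vClosure_eq : vClosure H carrier = carrier
  inv_eq : vClosure H (carrier * colon (H : Set Q) carrier) = H

/-- The product is the `v`-product `(A B)_v`. -/
instance (H : Submonoid Q) : Mul (InvVIdeal H) where
  mul I J :=
    { carrier := vClosure H (I.carrier * J.carrier)
      vClosure_eq := vClosure_idem _ _
      inv_eq := by
        rw [colon_vClosure, vClosure_vClosure_mul]
        apply Set.Subset.antisymm
        · conv_rhs => rw [← vClosure_self H]
          apply vClosure_mono
          rintro _ ⟨a, ha, c, hc, rfl⟩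
          change a * c ∈ H
          rw [mul_comm]
          exact hc a ha
        · have h : vClosure H ((I.carrier * colon (H : Set Q) I.carrier) *
              (J.carrier * colon (H : Set Q) J.carrier)) = H := by
            rw [← vClosure_vClosure_mul, I.inv_eq, vClosure_self_mul, J.inv_eq]
          conv_lhs => rw [← h]
          apply vClosure_mono
          rw [mul_mul_mul_comm]
          apply Set.mul_subset_mul_left
          rintro _ ⟨c, hc, d, hd, rfl⟩ _ ⟨a, ha, b, hb, rfl⟩
          have := H.mul_mem (hc a ha) (hd b hb)
          change c * d * (a * b) ∈ H
          rwa [mul_mul_mul_comm] }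

instance (H : Submonoid Q) : One (InvVIdeal H) where
  one :=
    { carrier := H
      vClosure_eq := vClosure_self H
      inv_eq := by rw [colon_self, Submonoid.coe_mul_self_eq, vClosure_self] }

instance (H : Submonoid Q) : Inv (InvVIdeal H) where
  inv I :=
    { carrier := colon H I.carrier
      vClosure_eq := vClosure_colon _ _
      inv_eq := by
        change vClosure H (colon (H : Set Q) I.carrier * vClosure H I.carrier) = H
        rw [I.vClosure_eq, mul_comm, I.inv_eq] }

/-- The group `F_v(H)^×` of fractional `v`-invertible `v`-ideals under `v`-multiplication. -/
instance (H : Submonoid Q) : CommGroup (InvVIdeal H) :=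
  { Group.ofLeftAxioms
      (fun I J K => InvVIdeal.ext (by
        change vClosure H (vClosure H (I.carrier * J.carrier) * K.carrier) =
          vClosure H (I.carrier * vClosure H (J.carrier * K.carrier))
        rw [vClosure_vClosure_mul, vClosure_mul_vClosure, mul_assoc]) :
        ∀ I J K : InvVIdeal H, I * J * K = I * (J * K))
      (fun I => InvVIdeal.ext (by
        change vClosure H ((H : Set Q) * I.carrier) = I.carrier
        rw [vClosure_self_mul, I.vClosure_eq]))
      (fun I => InvVIdeal.ext (by
        change vClosure H (colon (H : Set Q) I.carrier * I.carrier) = (H : Set Q)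
        rw [mul_comm, I.inv_eq])) with
    mul_comm := fun I J => InvVIdeal.ext (by
      change vClosure H (I.carrier * J.carrier) = vClosure H (J.carrier * I.carrier)
      rw [mul_comm]) }

/-- The homomorphism `x ↦ xH` onto the group of fractional principal ideals. -/
def principal (H : Submonoid Q) : Q →* InvVIdeal H where
  toFun x :=
    { carrier := x • (H : Set Q)
      vClosure_eq := vClosure_smul H x
      inv_eq := by
        rw [colon_smul, smul_mul_smul_self, mul_inv_cancel, one_smul, vClosure_self] }
  map_one' := InvVIdeal.ext (one_smul Q (H : Set Q))
  map_mul' x y := InvVIdeal.ext (by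
    change (x * y) • (H : Set Q) = vClosure H ((x • (H : Set Q)) * (y • (H : Set Q)))
    rw [smul_mul_smul_self, vClosure_smul])

/-- The `v`-class group `C_v(H)` (written multiplicatively, so the trivial class is `1`). -/
abbrev VClassGroup (H : Submonoid Q) : Type _ := InvVIdeal H ⧸ (principal H).range

/-- The set `A` is a fractional `v`-invertible `v`-ideal of `H` and `g` is its class. -/
def HasClass (H : Submonoid Q) (A : Set Q) (g : VClassGroup H) : Prop :=
  ∃ I : InvVIdeal H, I.carrier = A ∧ (QuotientGroup.mk I : VClassGroup H) = g

/-- `[x] = g` for `p ∈ 𝔛(H)` and `x ∈ Q`, regarded as an element of the quotient group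
`Q / H_p^×` of `(H_p)_red`. For a `v`-noetherian weakly Krull monoid, localization identifies
the `v`-invertible `v`-ideals of `H` with the coproduct of the monoids `(H_p')_red`; under this
identification `x` corresponds to the fractional ideal which is `x H_p` at `p` and trivial at
all other `p'`, that is, to `x H_p ∩ ⋂_{p' ≠ p} H_p'`. -/
def HasLocalClass (H : Submonoid Q) (p : MinPrime H) (x : Q) (g : VClassGroup H) : Prop :=
  HasClass H ((x • (localization H p : Set Q)) ∩
    ⋂ p' : {p' : MinPrime H // p' ≠ p}, (localization H p'.1 : Set Q)) g

/-- `P^*`: the primes in `𝔛(H)` containing the conductor. -/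
def conductorPrimes (H : Submonoid Q) : Set (MinPrime H) := {p | conductor H ⊆ p.1}

/-- `G_p = {0}`: all units of the complete integral closure of `H_p` have trivial class. -/
def TrivialUnitClasses (H : Submonoid Q) (p : MinPrime H) : Prop :=
  ∀ ε : Q, IsUnitOf (completeIntegralClosure (localization H p)) ε → HasLocalClass H p ε 1

/-- The number of indices `i` with `[q_i] = e`. -/
noncomputable def numClass (H : Submonoid Q) (e : VClassGroup H) (p : MinPrime H)
    {s : ℕ} (q : Fin s → Q) : ℕ :=
  {i : Fin s | HasLocalClass H p (q i) e}.ncard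

open Classical in
/-- The invariant `d_p`. As `s ≥ 1` and there are at most `s` indices with `[q_i] = e`, the last
case says: `G_p ≠ {0}`, or `s ≥ 2` and exactly one `[q_i]` is `e`, or `s ≥ 3` and at least two
of the `[q_i]` are `e`. -/
noncomputable def localInvariant (H : Submonoid Q) (e : VClassGroup H) (p : MinPrime H)
    {s : ℕ} (q : Fin s → Q) : ℤ :=
  if TrivialUnitClasses H p ∧ s = 2 ∧ numClass H e p q = 2 then 2
  else if TrivialUnitClasses H p ∧ s = 1 then 0
  else if TrivialUnitClasses H p ∧ 2 ≤ s ∧ numClass H e p q = 0 then -1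
  else 1

end IdealTheory

end WeaklyKrull

namespace WeaklyKrull

/-! ## Factorizations in a commutative monoid -/

section Factorizations

section Distance

variable {R : Type*}

/-! The proof reduces the arithmetic of `H` to that of its localizations. Every family of local
elements `x_p` that are units for almost all `p` defines a `v`-invertible `v`-ideal with
localizations `x_p H_p`. Hence `H_red` embeds into the product of the monoids `D_p = (H_p)_red`, and
an element with components at one or two primes lies in the image as soon as its total class is
trivial (`blockData`). Since the class group has two elements, each `D_p` carries a class function
`χ` to `ℤ/2`. An atom of `H_red` is then of one of two kinds: an element of a single `D_p` that is
irreducible among the elements of class 0 (`atom_zero`), or a "mixed" pair of irreducible elements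
of class `e` at two different primes (`atom_one`).

Upper bound for the catenary degree. At a prime `i`, a product of two irreducibles of class `e` has
a factorization into at most `n_i = 1 + d_i` atoms of class 0 (`LocA`). Two mixed atoms meeting at
`i` can therefore be replaced by at most `n_i + 1` atoms, or by `n_i + n_j` if they also meet at
`j`. Repeating this leaves at most one mixed atom at each prime. For such factorizations a local
comparison (`LocB`), with steps of size at most `2 + |d_i|`, or an exchange of partners between two
mixed atoms, leads to an atom that depends only on the element. Cancelling it and inducting gives
`c(H) ≤ m + 2`, where `m` is the claimed maximum (`conn_of_local`).

Lower bound. A distance `d` forces `d + 2 ≤ c(H)`, because a chain must jump across the gap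
(`add_two_le_of_conn`). A `Gadget` of length `r` at `i` and one of length `r'` at `j` combine to an
element whose lengths are exactly `2` and `r + r'`. Lengths `2, …, 1 + d_i` occur at `i`, and a
prime of class `e` away from the conductor provides length `1`, so all of `1, …, m` are distances.
The value `d_i = -1` has no elements of class `e`, but lengths `2` and `3` occur for one element
(`exists_consecutive`). If `m = 0`, a unit of the complete integral closure of `H_p` outside `H_p`,
at a conductor prime, still makes factorizations non-unique, so `c(H) = 2`.

Local arithmetic. Seminormality gives `q_1 ⋯ q_s F ⊆ H_p`, so the non-units of `H_p` are exactly the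
elements of `F` with all exponents positive (`locShape_of_seminormal`). An element with some
exponent 1 is thus irreducible, and one element divides another as soon as its exponents are
strictly smaller. The values of `d_i` come from playing exponent vectors against parity. Away from
the conductor `H_p` is a discrete valuation monoid (`exists_generator`), and `d = 0`. -/

open Classical in
/-- The distance of two multisets. -/
noncomputable def mdist (z z' : Multiset R) : ℕ :=
  max (Multiset.card (z - z')) (Multiset.card (z' - z))

theorem mdist_comm (z z' : Multiset R) : mdist z z' = mdist z' z := max_comm _ _

theorem mdist_add_left (y z z' : Multiset R) : mdist (y + z) (y + z') = mdist z z' := by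
  classical
  unfold mdist
  congr 2
  · rw [← tsub_tsub, add_tsub_cancel_left]
  · rw [← tsub_tsub, add_tsub_cancel_left]

theorem mdist_le_of_card_le {N : ℕ} {z z' : Multiset R} (h : Multiset.card z ≤ N)
    (h' : Multiset.card z' ≤ N) : mdist z z' ≤ N := by
  classical
  exact max_le ((Multiset.card_le_card (Multiset.sub_le_self _ _)).trans h)
    ((Multiset.card_le_card (Multiset.sub_le_self _ _)).trans h')

/-- A decomposition of two multisets into a common part and their differences. -/
theorem exists_common_part (z z' : Multiset R) : ∃ y x x' : Multiset R, z = y + x ∧ z' = y + x' ∧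
    mdist z z' = max (Multiset.card x) (Multiset.card x') := by
  classical
  refine ⟨z ∩ z', z - z', z' - z, ?_, ?_, ?_⟩
  · rw [add_comm, Multiset.sub_add_inter]
  · rw [add_comm, Multiset.inter_comm, Multiset.sub_add_inter]
  · unfold mdist
    congr!

end Distance

variable {R : Type*} [CommMonoid R]

/-- The factorizations of `a` into irreducible elements of `R` itself. -/
def Fact (a : R) : Set (Multiset R) := {z | (∀ u ∈ z, Irreducible u) ∧ z.prod = a}

/-- A step of length at most `N` between factorizations of `a`. -/
def FactStep (N : ℕ) (a : R) (z z' : Multiset R) : Prop :=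
  z ∈ Fact a ∧ z' ∈ Fact a ∧ mdist z z' ≤ N

/-- Two factorizations of `a` are connected by an `N`-chain. -/
def Conn (N : ℕ) (a : R) : Multiset R → Multiset R → Prop :=
  Relation.ReflTransGen (FactStep N a)

theorem FactStep.symm {N : ℕ} {a : R} {z z' : Multiset R} (h : FactStep N a z z') :
    FactStep N a z' z := ⟨h.2.1, h.1, by rw [mdist_comm]; exact h.2.2⟩

theorem Conn.symm {N : ℕ} {a : R} {z z' : Multiset R} (h : Conn N a z z') : Conn N a z' z := by
  induction h with
  | refl => exact Relation.ReflTransGen.refl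
  | tail _ h ih => exact Relation.ReflTransGen.head h.symm ih

theorem Conn.trans {N : ℕ} {a : R} {z z' z'' : Multiset R} (h : Conn N a z z')
    (h' : Conn N a z' z'') : Conn N a z z'' := Relation.ReflTransGen.trans h h'

/-- The common part `y` does not contribute to the distance. Every elementary chain step in the
upper bound is such an exchange of `z` for `z'`. -/
theorem conn_of_add {N : ℕ} {a : R} {y z z' : Multiset R} (h : y + z ∈ Fact a)
    (hz' : ∀ u ∈ z', Irreducible u) (hp : z'.prod = z.prod)
    (hc : Multiset.card z ≤ N) (hc' : Multiset.card z' ≤ N) :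
    y + z' ∈ Fact a ∧ Conn N a (y + z) (y + z') := by
  have h' : y + z' ∈ Fact a := by
    refine ⟨fun u hu => ?_, ?_⟩
    · rcases Multiset.mem_add.1 hu with hu | hu
      · exact h.1 u (Multiset.mem_add.2 (Or.inl hu))
      · exact hz' u hu
    · rw [Multiset.prod_add, hp, ← Multiset.prod_add, h.2]
  refine ⟨h', Relation.ReflTransGen.single ⟨h, h', ?_⟩⟩
  rw [mdist_add_left]
  exact mdist_le_of_card_le hc hc'

theorem Conn.cons {N : ℕ} {a u : R} {z z' : Multiset R} (hu : Irreducible u)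
    (h : Conn N a z z') : Conn N (u * a) (u ::ₘ z) (u ::ₘ z') := by
  refine Relation.ReflTransGen.lift (fun z => u ::ₘ z) (fun x y hxy => ?_) _ _ h
  have key : ∀ x, x ∈ Fact a → u ::ₘ x ∈ Fact (u * a) := fun x hx =>
    ⟨fun v hv => (Multiset.mem_cons.1 hv).elim (fun h => h ▸ hu) (hx.1 v), by
      rw [Multiset.prod_cons, hx.2]⟩
  refine ⟨key x hxy.1, key y hxy.2.1, ?_⟩
  change mdist (u ::ₘ x) (u ::ₘ y) ≤ N
  rw [← Multiset.singleton_add, ← Multiset.singleton_add, mdist_add_left]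
  exact hxy.2.2

/-- A chain from inside to outside a set leaves it at some step. -/
theorem exists_step_of_not {α : Type*} {r : α → α → Prop} {P : α → Prop} {x y : α}
    (h : Relation.ReflTransGen r x y) (hx : P x) (hy : ¬ P y) :
    ∃ u v, r u v ∧ P u ∧ ¬ P v := by
  induction h with
  | refl => exact absurd hx hy
  | @tail b c _ hbc ih =>
    by_cases hb : P b
    · exact ⟨b, c, hbc, hb, hy⟩
    · exact ih hb

theorem eq_zero_of_prod_eq_one {z : Multiset R} (hz : ∀ u ∈ z, Irreducible u)
    (h : z.prod = 1) : z = 0 := by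
  induction z using Multiset.induction with
  | empty => rfl
  | cons u z _ =>
    rw [Multiset.prod_cons] at h
    exact absurd (IsUnit.of_mul_eq_one _ h) (hz u (Multiset.mem_cons_self u z)).not_isUnit

theorem eq_singleton_of_irreducible_prod {z : Multiset R} (hz : ∀ u ∈ z, Irreducible u)
    (h : Irreducible z.prod) : Multiset.card z = 1 := by
  induction z using Multiset.induction with
  | empty => exact absurd h (by simp)
  | cons u z _ =>
    rw [Multiset.prod_cons] at h
    rcases h.isUnit_or_isUnit rfl with h' | h'
    · exact absurd h' (hz u (Multiset.mem_cons_self u z)).not_isUnit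
    · rcases Multiset.empty_or_exists_mem z with rfl | ⟨v, hv⟩
      · simp
      · exact absurd (isUnit_of_dvd_unit (Multiset.dvd_prod hv) h')
          (hz v (Multiset.mem_cons_of_mem hv)).not_isUnit

variable (hcancel : ∀ a b c : R, a * b = a * c → b = c)
include hcancel

/-- At distance at most one, cancelling the common part leaves at most one atom on each side, and
the two remainders have the same product, so they agree. -/
theorem two_le_of_step_ne {N : ℕ} {a : R} {z z' : Multiset R} (h : FactStep N a z z')
    (hne : z ≠ z') : 2 ≤ N := by
  obtain ⟨y, x, x', rfl, rfl, hd⟩ := exists_common_part z z'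
  refine le_trans ?_ (hd ▸ h.2.2)
  by_contra hlt
  have hx : Multiset.card x ≤ 1 := by
    have := le_max_left (Multiset.card x) (Multiset.card x'); omega
  have hx' : Multiset.card x' ≤ 1 := by
    have := le_max_right (Multiset.card x) (Multiset.card x'); omega
  have hp : x.prod = x'.prod := by
    apply hcancel y.prod
    rw [← Multiset.prod_add, ← Multiset.prod_add, h.1.2, h.2.1.2]
  have hi : ∀ u ∈ x, Irreducible u := fun u hu => h.1.1 u (Multiset.mem_add.2 (Or.inr hu))
  have hi' : ∀ u ∈ x', Irreducible u := fun u hu => h.2.1.1 u (Multiset.mem_add.2 (Or.inr hu))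
  apply hne
  rcases Nat.le_one_iff_eq_zero_or_eq_one.1 hx with h0 | h1
  · rw [Multiset.card_eq_zero] at h0
    subst h0
    rw [eq_zero_of_prod_eq_one hi' hp.symm]
  · rcases Nat.le_one_iff_eq_zero_or_eq_one.1 hx' with h0' | h1'
    · rw [Multiset.card_eq_zero] at h0'
      subst h0'
      rw [eq_zero_of_prod_eq_one hi hp]
    · obtain ⟨u, rfl⟩ := Multiset.card_eq_one.1 h1
      obtain ⟨v, rfl⟩ := Multiset.card_eq_one.1 h1'
      simp only [Multiset.prod_singleton] at hp
      rw [hp]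

theorem two_le_of_conn_ne {N : ℕ} {a : R} {z z' : Multiset R} (h : Conn N a z z')
    (hne : z ≠ z') : 2 ≤ N := by
  obtain ⟨u, v, huv, hu, hv⟩ := exists_step_of_not (P := fun y => y = z) h rfl (Ne.symm hne)
  exact two_le_of_step_ne hcancel huv (fun h => hv (h ▸ hu))

/-- Some step of the chain jumps over the gap, so its lengths differ by at least `d`. After
cancelling the common part, the shorter side still has at least two atoms, since a product equal to
1 or to an atom has only one factorization. -/
theorem add_two_le_of_conn {N d : ℕ} (hd : 0 < d) {a : R} {z z' : Multiset R}
    (h : Conn N a z z') (hcard : Multiset.card z' = Multiset.card z + d)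
    (hgap : ∀ y ∈ Fact a, ¬ (Multiset.card z < Multiset.card y ∧
      Multiset.card y < Multiset.card z + d)) : d + 2 ≤ N := by
  obtain ⟨u, v, huv, hu, hv⟩ := exists_step_of_not
    (P := fun y => Multiset.card y ≤ Multiset.card z) h le_rfl (by omega)
  have hv' := hgap v huv.2.1
  obtain ⟨y, x, x', rfl, rfl, hdist⟩ := exists_common_part u v
  have hN := hdist ▸ huv.2.2
  have hx' := le_max_right (Multiset.card x) (Multiset.card x')
  rw [Multiset.card_add] at hu hv hv'
  have hp : x.prod = x'.prod := by
    apply hcancel y.prod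
    rw [← Multiset.prod_add, ← Multiset.prod_add, huv.1.2, huv.2.1.2]
  have hi : ∀ u ∈ x, Irreducible u := fun u hu => huv.1.1 u (Multiset.mem_add.2 (Or.inr hu))
  have hi' : ∀ u ∈ x', Irreducible u := fun u hu => huv.2.1.1 u (Multiset.mem_add.2 (Or.inr hu))
  have h2 : 2 ≤ Multiset.card x := by
    by_contra hlt
    rcases Nat.le_one_iff_eq_zero_or_eq_one.1 (by omega : Multiset.card x ≤ 1) with h0 | h1
    · rw [Multiset.card_eq_zero] at h0
      subst h0
      rw [eq_zero_of_prod_eq_one hi' hp.symm] at hv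
      simp at hv hu
      omega
    · obtain ⟨w, rfl⟩ := Multiset.card_eq_one.1 h1
      have := eq_singleton_of_irreducible_prod hi' (by
        rw [← hp, Multiset.prod_singleton]; exact hi w (Multiset.mem_singleton_self w))
      simp at hu
      omega
  omega

end Factorizations

/-! ## The set of distances and the catenary degree of a monoid -/

section Transfer

variable {M : Type*} [CommMonoid M]

theorem mem_setOfDistances_iff {d : ℕ} : d ∈ setOfDistances M ↔
    0 < d ∧ ∃ r : Associates M, ∃ z ∈ Fact r, ∃ z' ∈ Fact r,
      Multiset.card z' = Multiset.card z + d ∧ ∀ y ∈ Fact r,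
        ¬ (Multiset.card z < Multiset.card y ∧ Multiset.card y < Multiset.card z + d) := by
  constructor
  · intro h
    obtain ⟨a, hd, k, ⟨z, hz, rfl⟩, ⟨z', hz', h'⟩, hgap⟩ := Set.mem_iUnion.1 h
    exact ⟨hd, Associates.mk a, z, hz, z', hz', h', fun y hy => hgap _ ⟨y, hy, rfl⟩⟩
  · rintro ⟨hd, r, z, hz, z', hz', h', hgap⟩
    obtain ⟨a, rfl⟩ := Associates.mk_surjective r
    refine Set.mem_iUnion.2 ⟨a, hd, _, ⟨z, hz, rfl⟩, ⟨z', hz', h'⟩, ?_⟩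
    rintro _ ⟨y, hy, rfl⟩
    exact hgap y hy

theorem chainStep_iff {a : M} {N : ℕ} {z z' : Multiset (Associates M)} :
    ChainStep a N z z' ↔ FactStep N (Associates.mk a) z z' := by
  unfold ChainStep FactStep
  refine and_congr Iff.rfl (and_congr Iff.rfl ?_)
  rw [Nat.cast_le, factDist, mdist]
  congr!

theorem catenaryDegree_le {N : ℕ}
    (h : ∀ r : Associates M, ∀ z ∈ Fact r, ∀ z' ∈ Fact r, Conn N r z z') :
    catenaryDegree M ≤ N := by
  refine iSup_le fun a => sInf_le fun z hz z' hz' => ?_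
  exact Relation.ReflTransGen.mono (fun _ _ => chainStep_iff.2) _ _ (h _ z hz z' hz')

theorem le_catenaryDegree {K : ℕ} {r : Associates M} {z z' : Multiset (Associates M)}
    (hz : z ∈ Fact r) (hz' : z' ∈ Fact r) (h : ∀ N, Conn N r z z' → K ≤ N) :
    (K : ℕ∞) ≤ catenaryDegree M := by
  obtain ⟨a, rfl⟩ := Associates.mk_surjective r
  refine le_trans (le_sInf fun N hN => ?_) (le_iSup (fun a : M => catenaryDegreeOf a) a)
  cases N with
  | top => exact le_top
  | coe N =>
    rw [Nat.cast_le]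
    exact h N (Relation.ReflTransGen.mono (fun _ _ => chainStep_iff.1) _ _ (hN z hz z' hz'))

variable (hcancel : ∀ a b c : Associates M, a * b = a * c → b = c)
include hcancel

theorem add_two_le_catenaryDegree {d : ℕ} (hd : d ∈ setOfDistances M) :
    ((d + 2 : ℕ) : ℕ∞) ≤ catenaryDegree M := by
  obtain ⟨hd, r, z, hz, z', hz', h', hgap⟩ := mem_setOfDistances_iff.1 hd
  exact le_catenaryDegree hz hz' fun N h => add_two_le_of_conn hcancel hd h h' hgap

theorem two_le_catenaryDegree {r : Associates M} {z z' : Multiset (Associates M)}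
    (hz : z ∈ Fact r) (hz' : z' ∈ Fact r) (hne : z ≠ z') :
    ((2 : ℕ) : ℕ∞) ≤ catenaryDegree M :=
  le_catenaryDegree hz hz' fun _ h => two_le_of_conn_ne hcancel h hne

end Transfer

end WeaklyKrull


namespace WeaklyKrull

theorem zmod_two_cases (a : ZMod 2) : a = 0 ∨ a = 1 := by
  revert a; decide

theorem zmod_two_add_self (a : ZMod 2) : a + a = 0 := by
  revert a; decide

/-! ## Monoids with a class function to `ℤ/2` -/

section ClassFunction

variable {D : Type*} [CancelCommMonoid D]

/-- An irreducible element of non-trivial class. -/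
structure EAtom (χ : D → ZMod 2) (y : D) : Prop where
  cls : χ y = 1
  irr : ∀ a b, y = a * b → a = 1 ∨ b = 1

/-- An irreducible element of the submonoid of elements of trivial class. -/
structure BAtom (χ : D → ZMod 2) (y : D) : Prop where
  cls : χ y = 0
  ne_one : y ≠ 1
  -- The cofactor `b` then has class 0 as well.
  irr : ∀ a b, y = a * b → χ a = 0 → a = 1 ∨ b = 1

/-- A factorization into atoms of trivial class. -/
structure BFact (χ : D → ZMod 2) (T : Multiset D) (x : D) : Prop where
  mem : ∀ t ∈ T, BAtom χ t
  prod : T.prod = x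

/-- A factorization into atoms of trivial class and at most one atom of non-trivial class. -/
structure LFact (χ : D → ZMod 2) (T : Multiset D) (x : D) : Prop where
  mem : ∀ t ∈ T, BAtom χ t ∨ EAtom χ t
  count : T.countP (fun t => χ t = 1) ≤ 1
  prod : T.prod = x

/-- Products of two atoms of non-trivial class have short factorizations. -/
def LocA (χ : D → ZMod 2) (n : ℕ) : Prop :=
  ∀ y₁ y₂, EAtom χ y₁ → EAtom χ y₂ → ∃ T, BFact χ T (y₁ * y₂) ∧ Multiset.card T ≤ n

/-- Every `x` which is not an atom has a divisor `u` to which all factorizations of `x` are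
close. -/
def LocB (χ : D → ZMod 2) (N : ℕ) : Prop :=
  ∀ x, x ≠ 1 → ¬ BAtom χ x → ¬ EAtom χ x → ∃ u, BAtom χ u ∧ ∀ T, LFact χ T x →
    ∃ T₀ T₁ T₁', T = T₀ + T₁ ∧ LFact χ (T₀ + T₁') x ∧ u ∈ T₁' ∧
      Multiset.card T₁ ≤ N ∧ Multiset.card T₁' ≤ N

variable {χ : D → ZMod 2} (hχ : ∀ a b, χ (a * b) = χ a + χ b)
include hχ

theorem chi_one : χ 1 = 0 := by
  have := hχ 1 1
  rw [mul_one, zmod_two_add_self] at this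
  exact this

theorem EAtom.ne_one {y : D} (h : EAtom χ y) : y ≠ 1 := by
  rintro rfl
  have := h.cls
  rw [chi_one hχ] at this
  exact absurd this (by decide)

theorem chi_prod (T : Multiset D) : χ T.prod = (T.countP (fun t => χ t = 1) : ZMod 2) := by
  induction T using Multiset.induction with
  | empty => simp [chi_one hχ]
  | cons t T ih =>
    rw [Multiset.prod_cons, hχ, ih, Multiset.countP_cons]
    rcases zmod_two_cases (χ t) with h | h
    · rw [h, if_neg (by decide)]; simp
    · rw [h, if_pos rfl]; push_cast; ring

omit [CancelCommMonoid D] hχ in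
theorem countP_eq_zero_of_forall {T : Multiset D} (h : ∀ t ∈ T, χ t = 0) :
    T.countP (fun t => χ t = 1) = 0 := by
  rw [Multiset.countP_eq_zero]
  intro t ht h'
  rw [h t ht] at h'
  exact absurd h' (by decide)

theorem chi_prod_eq_zero {T : Multiset D} (h : ∀ t ∈ T, χ t = 0) : χ T.prod = 0 := by
  rw [chi_prod hχ, countP_eq_zero_of_forall h]; rfl

/-- The number of atoms of non-trivial class is determined by the product. -/
theorem LFact.count_eq {T : Multiset D} {x : D} (h : LFact χ T x) :
    (χ x = 0 ∧ T.countP (fun t => χ t = 1) = 0) ∨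
      (χ x = 1 ∧ T.countP (fun t => χ t = 1) = 1) := by
  have := chi_prod hχ T
  rw [h.prod] at this
  rcases Nat.le_one_iff_eq_zero_or_eq_one.1 h.count with h' | h'
  · left; rw [this, h']; exact ⟨rfl, rfl⟩
  · right; rw [this, h']; exact ⟨by simp, rfl⟩

theorem LFact.mem_of_cls_zero {T : Multiset D} {x : D} (h : LFact χ T x) (hx : χ x = 0) :
    ∀ t ∈ T, BAtom χ t := by
  intro t ht
  rcases h.mem t ht with h' | h'
  · exact h'
  · rcases h.count_eq hχ with h0 | h1
    · exact absurd h'.cls ((Multiset.countP_eq_zero.1 h0.2) t ht)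
    · rw [hx] at h1; exact absurd h1.1 (by decide)

/-- Replacing a part of a factorization by another factorization of the same element. -/
theorem LFact.replace {T₀ T₁ T₁' : Multiset D} {x : D} (h : LFact χ (T₀ + T₁) x)
    (h' : LFact χ T₁' T₁.prod) : LFact χ (T₀ + T₁') x := by
  have hc := h.count
  rw [Multiset.countP_add] at hc
  have h1 : LFact χ T₁ T₁.prod :=
    ⟨fun t ht => h.mem t (Multiset.mem_add.2 (Or.inr ht)), by omega, rfl⟩
  refine ⟨fun t ht => ?_, ?_, ?_⟩
  · rcases Multiset.mem_add.1 ht with ht | ht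
    · exact h.mem t (Multiset.mem_add.2 (Or.inl ht))
    · exact h'.mem t ht
  · rw [Multiset.countP_add]
    -- Both counts are at most one and congruent modulo 2 to the class of the same product.
    have : T₁'.countP (fun t => χ t = 1) = T₁.countP (fun t => χ t = 1) := by
      rcases h1.count_eq hχ with h0 | h0 <;> rcases h'.count_eq hχ with h2 | h2
      · rw [h0.2, h2.2]
      · rw [h0.1] at h2; exact absurd h2.1 (by decide)
      · rw [h0.1] at h2; exact absurd h2.1 (by decide)
      · rw [h0.2, h2.2]
    rw [this]; exact hc
  · rw [Multiset.prod_add, h'.prod, ← Multiset.prod_add, h.prod]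

variable (hred : ∀ a b : D, a * b = 1 → a = 1)
include hred

omit hχ in
theorem eq_zero_of_prod_one {T : Multiset D} (h1 : ∀ t ∈ T, t ≠ 1) (h : T.prod = 1) :
    T = 0 := by
  induction T using Multiset.induction with
  | empty => rfl
  | cons t T _ =>
    rw [Multiset.prod_cons] at h
    exact absurd (hred _ _ h) (h1 t (Multiset.mem_cons_self t T))

omit hχ in
/-- A factorization of an atom of trivial class is trivial. -/
theorem BFact.eq_singleton {T : Multiset D} {x : D} (h : BFact χ T x) (hx : BAtom χ x) :
    T = {x} := by
  rcases Multiset.empty_or_exists_mem T with rfl | ⟨t, ht⟩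
  · exact absurd h.prod.symm hx.ne_one
  · obtain ⟨T', rfl⟩ := Multiset.exists_cons_of_mem ht
    have hp := h.prod
    rw [Multiset.prod_cons] at hp
    rcases hx.irr _ _ hp.symm (h.mem t ht).cls with h1 | h1
    · exact absurd h1 (h.mem t ht).ne_one
    · have : T' = 0 := eq_zero_of_prod_one hred
        (fun s hs => (h.mem s (Multiset.mem_cons_of_mem hs)).ne_one) h1
      subst this
      simp at hp
      rw [hp]; rfl

theorem LFact.eq_singleton {T : Multiset D} {x : D} (h : LFact χ T x)
    (hx : BAtom χ x ∨ EAtom χ x) : T = {x} := by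
  rcases hx with hx | hx
  · exact BFact.eq_singleton hred ⟨h.mem_of_cls_zero hχ hx.cls, h.prod⟩ hx
  · have hne : ∀ t ∈ T, t ≠ 1 := fun t ht =>
      (h.mem t ht).elim (fun h => h.ne_one) (fun h => h.ne_one hχ)
    rcases Multiset.empty_or_exists_mem T with rfl | ⟨t, ht⟩
    · exact absurd h.prod.symm (hx.ne_one hχ)
    · obtain ⟨T', rfl⟩ := Multiset.exists_cons_of_mem ht
      have hp := h.prod
      rw [Multiset.prod_cons] at hp
      rcases hx.irr _ _ hp.symm with h1 | h1
      · exact absurd h1 (hne t ht)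
      · have : T' = 0 := eq_zero_of_prod_one hred
          (fun s hs => hne s (Multiset.mem_cons_of_mem hs)) h1
        subst this
        simp at hp
        rw [hp]; rfl

end ClassFunction

/-- Serves to pull a decomposition of the multiset of local components back to the atoms they come
from. -/
theorem exists_add_of_map_eq_add {α β : Type*} (f : α → β) {z : Multiset α} {T₀ T₁ : Multiset β}
    (h : z.map f = T₀ + T₁) : ∃ z₀ z₁, z = z₀ + z₁ ∧ z₀.map f = T₀ ∧ z₁.map f = T₁ := by
  induction T₁ using Multiset.induction generalizing z with
  | empty => exact ⟨z, 0, by simp, by simpa using h, by simp⟩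
  | cons t T ih =>
    rw [Multiset.add_cons] at h
    obtain ⟨r, hr, rfl⟩ := Multiset.mem_map.1 (h ▸ Multiset.mem_cons_self t (T₀ + T))
    obtain ⟨z', rfl⟩ := Multiset.exists_cons_of_mem hr
    rw [Multiset.map_cons, Multiset.cons_inj_right] at h
    obtain ⟨z₀, z₁, rfl, h0, h1⟩ := ih h
    exact ⟨z₀, r ::ₘ z₁, by rw [Multiset.add_cons], h0, by rw [Multiset.map_cons, h1]⟩

/-! ## Block monoids over a product of monoids, with class group of order two -/

/-- A monoid `R` embedded into a product of reduced cancellative monoids `D i`, as the submonoid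
of all elements of finite support and trivial class. -/
structure BlockData (R : Type*) [CommMonoid R] (ι : Type*) [DecidableEq ι] (D : ι → Type*)
    [∀ i, CancelCommMonoid (D i)] where
  χ : ∀ i, D i → ZMod 2
  χ_mul : ∀ i a b, χ i (a * b) = χ i a + χ i b
  red : ∀ i (a b : D i), a * b = 1 → a = 1
  Θ : R →* ∀ i, D i
  inj : Function.Injective Θ
  -- Divisibility in the product is divisibility in `R`: the embedding is a divisor homomorphism.
  dvd : ∀ a b δ, Θ a = Θ b * δ → ∃ c, a = b * c
  -- Elements supported on one or two components suffice, because all atoms turn out to be of these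
  -- two kinds.
  single : ∀ i y, χ i y = 0 → ∃ r, Θ r = Pi.mulSingle i y
  pair : ∀ i j (y : D i) (w : D j), i ≠ j → χ i y = 1 → χ j w = 1 →
    ∃ r, Θ r = Pi.mulSingle i y * Pi.mulSingle j w
  conv : ∀ r i y, Θ r = Pi.mulSingle i y → χ i y = 0
  -- An additive weight, positive away from 1, on which the induction in `conn_of_local` runs.
  size : R → ℕ
  size_mul : ∀ a b, size (a * b) = size a + size b
  size_pos : ∀ a, a ≠ 1 → 0 < size a

namespace BlockData

variable {R : Type*} [CommMonoid R] {ι : Type*} [DecidableEq ι] {D : ι → Type*}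
  [∀ i, CancelCommMonoid (D i)] (B : BlockData R ι D)

include B in
theorem mul_left_cancel {a b c : R} (h : a * b = a * c) : b = c := by
  apply B.inj
  have := congrArg B.Θ h
  rw [map_mul, map_mul] at this
  exact _root_.mul_left_cancel this

include B in
theorem isUnit_iff {r : R} : IsUnit r ↔ r = 1 := by
  refine ⟨fun h => ?_, fun h => h ▸ isUnit_one⟩
  obtain ⟨c, hc⟩ := h.exists_right_inv
  apply B.inj
  rw [map_one]
  funext i
  have := congrFun (congrArg B.Θ hc) i
  rw [map_mul, map_one] at this
  exact B.red i _ _ this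

include B in
theorem eq_one_or_eq_one {r a b : R} (hr : Irreducible r) (h : r = a * b) : a = 1 ∨ b = 1 :=
  (hr.isUnit_or_isUnit h).imp B.isUnit_iff.1 B.isUnit_iff.1

include B in
theorem irreducible_of {r : R} (h1 : r ≠ 1) (h : ∀ a b, r = a * b → a = 1 ∨ b = 1) :
    Irreducible r :=
  ⟨fun hu => h1 (B.isUnit_iff.1 hu), fun {a b} hab =>
    (h a b hab).imp B.isUnit_iff.2 B.isUnit_iff.2⟩

theorem eq_one_of_comp {r : R} (h : ∀ i, B.Θ r i = 1) : r = 1 := by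
  apply B.inj
  rw [map_one]
  exact funext h

theorem eq_mulSingle {δ : ∀ i, D i} {i : ι}
    (h : ∀ j, j ≠ i → δ j = 1) : δ = Pi.mulSingle i (δ i) := by
  funext j
  rcases eq_or_ne j i with rfl | hj
  · rw [Pi.mulSingle_eq_same]
  · rw [Pi.mulSingle_eq_of_ne hj, h j hj]

theorem ne_one_of_chi {i : ι} {y : D i} (h : B.χ i y = 1) : y ≠ 1 := by
  rintro rfl
  rw [chi_one (B.χ_mul i)] at h
  exact absurd h (by decide)

theorem chi_ne_one {i : ι} {y : D i} (h : B.χ i y ≠ 1) : B.χ i y = 0 :=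
  (zmod_two_cases _).resolve_right h

theorem comp_eq_one {a b : R} {j : ι} (h : B.Θ (a * b) j = 1) : B.Θ a j = 1 ∧ B.Θ b j = 1 := by
  rw [map_mul] at h
  refine ⟨B.red j _ _ h, B.red j _ (B.Θ a j) ?_⟩
  rw [mul_comm]; exact h

/-- As the `D j` are reduced, both factors are supported at `i`. By `conv` they have class 0, so
local irreducibility applies. -/
theorem irreducible_single {r : R} {i : ι} {y : D i} (hy : BAtom (B.χ i) y)
    (hr : B.Θ r = Pi.mulSingle i y) : Irreducible r := by
  refine B.irreducible_of ?_ ?_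
  · rintro rfl
    have := congrFun hr i
    rw [map_one, Pi.mulSingle_eq_same] at this
    exact hy.ne_one this.symm
  · rintro a b rfl
    have hj : ∀ j, j ≠ i → B.Θ a j = 1 ∧ B.Θ b j = 1 := fun j hj => by
      apply B.comp_eq_one
      rw [hr, Pi.mulSingle_eq_of_ne hj]
    have hi := congrFun hr i
    rw [map_mul, Pi.mulSingle_eq_same] at hi
    have ha := B.conv a i _ (eq_mulSingle fun j h => (hj j h).1)
    refine (hy.irr _ _ hi.symm ha).imp (fun h => ?_) (fun h => ?_)
    · apply B.eq_one_of_comp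
      intro j
      by_cases hji : j = i
      · subst hji; exact h
      · exact (hj j hji).1
    · apply B.eq_one_of_comp
      intro j
      by_cases hji : j = i
      · subst hji; exact h
      · exact (hj j hji).2

theorem pair_left {i j : ι} (hij : i ≠ j) (y : D i) (w : D j) :
    (Pi.mulSingle i y * Pi.mulSingle j w : ∀ i, D i) i = y := by
  rw [Pi.mul_apply, Pi.mulSingle_eq_same, Pi.mulSingle_eq_of_ne hij, mul_one]

theorem pair_right {i j : ι} (hij : i ≠ j) (y : D i) (w : D j) :
    (Pi.mulSingle i y * Pi.mulSingle j w : ∀ i, D i) j = w := by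
  rw [mul_comm, pair_left hij.symm]

theorem pair_other {i j k : ι} (hi : k ≠ i) (hj : k ≠ j) (y : D i) (w : D j) :
    (Pi.mulSingle i y * Pi.mulSingle j w : ∀ i, D i) k = 1 := by
  rw [Pi.mul_apply, Pi.mulSingle_eq_of_ne hi, Pi.mulSingle_eq_of_ne hj, mul_one]

/-- In a factorization each of `y` and `w` goes entirely into one factor. If they went into
different factors, one factor would be supported at `i` alone with non-trivial class, contradicting
`conv`. -/
theorem irreducible_pair {r : R} {i j : ι} (hij : i ≠ j) {y : D i} {w : D j}
    (hy : EAtom (B.χ i) y) (hw : EAtom (B.χ j) w)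
    (hr : B.Θ r = Pi.mulSingle i y * Pi.mulSingle j w) : Irreducible r := by
  have hri : B.Θ r i = y := by rw [hr, pair_left hij]
  have hrj : B.Θ r j = w := by rw [hr, pair_right hij]
  refine B.irreducible_of ?_ ?_
  · rintro rfl
    rw [map_one] at hri
    exact hy.ne_one (B.χ_mul i) hri.symm
  · rintro a b rfl
    have hk : ∀ k, k ≠ i → k ≠ j → B.Θ a k = 1 ∧ B.Θ b k = 1 := fun k h1 h2 => by
      apply B.comp_eq_one
      rw [hr, pair_other h1 h2]
    have hi := hri
    have hj := hrj
    rw [map_mul] at hi hj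
    have key : ∀ c : R, (∀ k, k ≠ i → k ≠ j → B.Θ c k = 1) → B.Θ c i = 1 → B.Θ c j = 1 → c = 1 :=
      fun c h h1 h2 => B.eq_one_of_comp fun k => by
        by_cases hki : k = i
        · subst hki; exact h1
        · by_cases hkj : k = j
          · subst hkj; exact h2
          · exact h k hki hkj
    have bad : ∀ c : R, (∀ k, k ≠ i → k ≠ j → B.Θ c k = 1) → B.Θ c i = y → B.Θ c j = 1 → False := by
      intro c h h1 h2
      have h3 := B.conv c i (B.Θ c i) (eq_mulSingle fun k hki => by
        by_cases hkj : k = j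
        · subst hkj; exact h2
        · exact h k hki hkj)
      rw [h1, hy.cls] at h3
      exact absurd h3 (by decide)
    rcases hy.irr _ _ hi.symm with h1 | h1 <;> rcases hw.irr _ _ hj.symm with h2 | h2
    · exact Or.inl (key a (fun k u v => (hk k u v).1) h1 h2)
    · refine (bad b (fun k u v => (hk k u v).2) ?_ h2).elim
      rw [← hi]; simp [h1]
    · refine (bad a (fun k u v => (hk k u v).1) ?_ h2).elim
      rw [← hi]; simp [h1]
    · exact Or.inr (key b (fun k u v => (hk k u v).2) h1 h2)

/-- In any splitting of `y` one factor has class 0. It comes from an element of `R` dividing the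
atom `r`, hence is trivial, because `r` also has the component `w`. -/
theorem eAtom_left {r : R} (hirr : Irreducible r) {i j : ι} (hij : i ≠ j) {y : D i} {w : D j}
    (hy : B.χ i y = 1) (hw : B.χ j w = 1)
    (hr : B.Θ r = Pi.mulSingle i y * Pi.mulSingle j w) : EAtom (B.χ i) y := by
  have key : ∀ a b, y = a * b → B.χ i a = 0 → a = 1 := by
    intro a b hab ha
    obtain ⟨s, hs⟩ := B.single i a ha
    obtain ⟨c, hc⟩ := B.dvd r s (Pi.mulSingle i b * Pi.mulSingle j w) (by
      rw [hr, hs, ← mul_assoc, ← Pi.mulSingle_mul, hab])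
    rcases B.eq_one_or_eq_one hirr hc with rfl | rfl
    · have := congrFun hs i
      rw [map_one, Pi.mulSingle_eq_same] at this
      exact this.symm
    · rw [mul_one] at hc
      subst hc
      have h1 := congrFun hr j
      rw [pair_right hij, hs, Pi.mulSingle_eq_of_ne hij.symm] at h1
      exact absurd h1.symm (B.ne_one_of_chi hw)
  refine ⟨hy, fun a b hab => ?_⟩
  rcases zmod_two_cases (B.χ i a) with ha | ha
  · exact Or.inl (key a b hab ha)
  · refine Or.inr (key b a (by rw [hab, mul_comm]) ?_)
    have := B.χ_mul i a b
    rw [← hab, hy, ha] at this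
    rcases zmod_two_cases (B.χ i b) with hb | hb
    · exact hb
    · rw [hb] at this; exact absurd this (by decide)

/-- A component of trivial class splits off as an element of `R`, so an atom having such a
non-trivial component consists of nothing else. -/
theorem atom_zero {r : R} (hirr : Irreducible r) {i : ι} (h1 : B.Θ r i ≠ 1)
    (h0 : B.χ i (B.Θ r i) = 0) :
    BAtom (B.χ i) (B.Θ r i) ∧ B.Θ r = Pi.mulSingle i (B.Θ r i) := by
  have hs : B.Θ r = Pi.mulSingle i (B.Θ r i) := by
    obtain ⟨s, hs⟩ := B.single i _ h0
    obtain ⟨c, hc⟩ := B.dvd r s (Function.update (B.Θ r) i 1) (by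
      rw [hs]
      funext j
      rcases eq_or_ne j i with rfl | hj
      · simp
      · simp [hj])
    rcases B.eq_one_or_eq_one hirr hc with rfl | rfl
    · have := congrFun hs i
      rw [map_one, Pi.mulSingle_eq_same] at this
      exact absurd this.symm h1
    · rw [mul_one] at hc
      conv_lhs => rw [hc]
      exact hs
  refine ⟨⟨h0, h1, fun a b hab ha => ?_⟩, hs⟩
  have hb : B.χ i b = 0 := by
    have := B.χ_mul i a b
    rw [← hab, h0, ha, zero_add] at this
    exact this.symm
  obtain ⟨s, hsa⟩ := B.single i a ha
  obtain ⟨t, htb⟩ := B.single i b hb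
  have : r = s * t := by
    apply B.inj
    rw [map_mul, hsa, htb, ← Pi.mulSingle_mul, ← hab, ← hs]
  refine (B.eq_one_or_eq_one hirr this).imp (fun h => ?_) (fun h => ?_)
  · subst h
    have := congrFun hsa i
    rw [map_one, Pi.mulSingle_eq_same] at this
    exact this.symm
  · subst h
    have := congrFun htb i
    rw [map_one, Pi.mulSingle_eq_same] at this
    exact this.symm

/-- By `conv` there is a second non-trivial component, and by `atom_zero` it cannot have class 0.
The two components together form an element of `R` dividing `r`, hence all of `r`. Together with
`atom_zero` this classifies the atoms. -/
theorem atom_one {r : R} (hirr : Irreducible r) {i : ι} (h1 : B.χ i (B.Θ r i) = 1) :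
    EAtom (B.χ i) (B.Θ r i) ∧ ∃ j, i ≠ j ∧ EAtom (B.χ j) (B.Θ r j) ∧
      B.Θ r = Pi.mulSingle i (B.Θ r i) * Pi.mulSingle j (B.Θ r j) := by
  have hne := B.ne_one_of_chi h1
  obtain ⟨j, hji, hj⟩ : ∃ j, j ≠ i ∧ B.Θ r j ≠ 1 := by
    by_contra! hcon
    have := B.conv r i _ (eq_mulSingle hcon)
    rw [h1] at this
    exact absurd this (by decide)
  have hj1 : B.χ j (B.Θ r j) = 1 := by
    rcases zmod_two_cases (B.χ j (B.Θ r j)) with h0 | h0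
    · have := congrFun (B.atom_zero hirr hj h0).2 i
      rw [Pi.mulSingle_eq_of_ne hji.symm] at this
      exact absurd this hne
    · exact h0
  have hs : B.Θ r = Pi.mulSingle i (B.Θ r i) * Pi.mulSingle j (B.Θ r j) := by
    obtain ⟨s, hs⟩ := B.pair i j _ _ hji.symm h1 hj1
    obtain ⟨c, hc⟩ := B.dvd r s (Function.update (Function.update (B.Θ r) i 1) j 1) (by
      rw [hs]
      funext k
      rw [Pi.mul_apply]
      rcases eq_or_ne k j with rfl | hkj
      · rw [pair_right hji.symm]; simp
      · rcases eq_or_ne k i with rfl | hki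
        · rw [pair_left hji.symm]; simp [hkj]
        · rw [pair_other hki hkj]; simp [hkj, hki])
    rcases B.eq_one_or_eq_one hirr hc with rfl | rfl
    · have := congrFun hs i
      rw [map_one, pair_left hji.symm] at this
      exact absurd this.symm hne
    · rw [mul_one] at hc
      conv_lhs => rw [hc]
      exact hs
  refine ⟨B.eAtom_left hirr hji.symm h1 hj1 hs, j, hji.symm, ?_, hs⟩
  exact B.eAtom_left hirr hji hj1 h1 (by rw [mul_comm]; exact hs)

/-- The element of `R` with the single component `y`, for `y` of trivial class. -/
noncomputable def lift (i : ι) (y : D i) : R :=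
  if h : B.χ i y = 0 then (B.single i y h).choose else 1

theorem Θ_lift {i : ι} {y : D i} (h : B.χ i y = 0) : B.Θ (B.lift i y) = Pi.mulSingle i y := by
  rw [lift, dif_pos h]
  exact (B.single i y h).choose_spec

theorem irreducible_lift {i : ι} {y : D i} (hy : BAtom (B.χ i) y) : Irreducible (B.lift i y) :=
  B.irreducible_single hy (B.Θ_lift hy.cls)

theorem Θ_prod_single {i : ι} {z : Multiset R} (h : ∀ r ∈ z, B.Θ r = Pi.mulSingle i (B.Θ r i)) :
    B.Θ z.prod = Pi.mulSingle i (z.map fun r => B.Θ r i).prod := by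
  induction z using Multiset.induction with
  | empty => simp
  | cons r z ih =>
    rw [Multiset.prod_cons, map_mul, ih fun s hs => h s (Multiset.mem_cons_of_mem hs),
      Multiset.map_cons, Multiset.prod_cons, Pi.mulSingle_mul,
      ← h r (Multiset.mem_cons_self r z)]

theorem Θ_prod_lift {i : ι} {T : Multiset (D i)} (h : ∀ t ∈ T, B.χ i t = 0) :
    B.Θ (T.map (B.lift i)).prod = Pi.mulSingle i T.prod := by
  induction T using Multiset.induction with
  | empty => simp
  | cons t T ih =>
    rw [Multiset.map_cons, Multiset.prod_cons, map_mul, ih fun s hs =>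
      h s (Multiset.mem_cons_of_mem hs), B.Θ_lift (h t (Multiset.mem_cons_self t T)),
      Multiset.prod_cons, Pi.mulSingle_mul]

theorem irreducible_of_mem_map_lift {i : ι} {T : Multiset (D i)} (h : ∀ t ∈ T, BAtom (B.χ i) t) :
    ∀ u ∈ T.map (B.lift i), Irreducible u := by
  intro u hu
  obtain ⟨t, ht, rfl⟩ := Multiset.mem_map.1 hu
  exact B.irreducible_lift (h t ht)

theorem Θ_prod_apply (z : Multiset R) (i : ι) :
    B.Θ z.prod i = (z.map fun r => B.Θ r i).prod := by
  induction z using Multiset.induction with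
  | empty => simp
  | cons r z ih => rw [Multiset.prod_cons, map_mul, Pi.mul_apply, ih, Multiset.map_cons,
      Multiset.prod_cons]

/-- No two atoms in `z` have a common component of non-trivial class. -/
def Reduced (z : Multiset R) : Prop :=
  ∀ i, (z.countP fun r => B.χ i (B.Θ r i) = 1) ≤ 1

open Classical in
/-- The part of a factorization consisting of the atoms with non-trivial `i`-th component. -/
noncomputable def part (i : ι) (z : Multiset R) : Multiset R := z.filter fun r => B.Θ r i ≠ 1

/-- By the classification of atoms every non-trivial component of an atom is a local atom. This is
the passage from global reduced factorizations to local ones. -/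
theorem lFact_part {a : R} {z : Multiset R} (hz : z ∈ Fact a) (hred : B.Reduced z) (i : ι) :
    LFact (B.χ i) ((B.part i z).map fun r => B.Θ r i) (B.Θ a i) := by
  classical
  refine ⟨?_, ?_, ?_⟩
  · intro t ht
    obtain ⟨r, hr, rfl⟩ := Multiset.mem_map.1 ht
    obtain ⟨hr, h1⟩ := Multiset.mem_filter.1 hr
    rcases zmod_two_cases (B.χ i (B.Θ r i)) with h0 | h0
    · exact Or.inl (B.atom_zero (hz.1 r hr) h1 h0).1
    · exact Or.inr (B.atom_one (hz.1 r hr) h0).1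
  · rw [Multiset.countP_map, ← Multiset.countP_eq_card_filter]
    exact (Multiset.countP_le_of_le _ (Multiset.filter_le _ _)).trans (hred i)
  · rw [← hz.2, ← B.Θ_prod_apply]
    conv_rhs => rw [← Multiset.filter_add_not (fun r => B.Θ r i ≠ 1) z]
    rw [Multiset.prod_add, map_mul, Pi.mul_apply, B.Θ_prod_apply (Multiset.filter _ z)]
    have : ((Multiset.filter (fun r => ¬ B.Θ r i ≠ 1) z).map fun r => B.Θ r i).prod = 1 := by
      apply Multiset.prod_eq_one
      intro t ht
      obtain ⟨r, hr, rfl⟩ := Multiset.mem_map.1 ht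
      exact not_not.1 (Multiset.mem_filter.1 hr).2
    rw [B.Θ_prod_apply (Multiset.filter (fun r => ¬ B.Θ r i ≠ 1) z), this, mul_one,
      B.Θ_prod_apply]
    rfl

end BlockData

end WeaklyKrull


/-! ### Chains of factorizations in a block monoid: the upper bound -/

namespace WeaklyKrull

namespace BlockData

variable {R : Type*} [CommMonoid R] {ι : Type*} [DecidableEq ι] {D : ι → Type*}
  [∀ i, CancelCommMonoid (D i)] (B : BlockData R ι D)

/-- An element with some component of non-trivial class. -/
def Mixed (r : R) : Prop := ∃ i, B.χ i (B.Θ r i) = 1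

theorem not_mixed_lift {i : ι} {t : D i} (ht : B.χ i t = 0) : ¬ B.Mixed (B.lift i t) := by
  rintro ⟨k, hk⟩
  rw [B.Θ_lift ht] at hk
  rcases eq_or_ne k i with rfl | hki
  · rw [Pi.mulSingle_eq_same, ht] at hk
    exact absurd hk (by decide)
  · rw [Pi.mulSingle_eq_of_ne hki, chi_one (B.χ_mul k)] at hk
    exact absurd hk (by decide)

open Classical in
/-- The number of mixed atoms. -/
noncomputable def numMixed (z : Multiset R) : ℕ := z.countP B.Mixed

theorem numMixed_add (z z' : Multiset R) :
    B.numMixed (z + z') = B.numMixed z + B.numMixed z' := by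
  classical
  exact Multiset.countP_add _ _ _

theorem numMixed_map_lift {i : ι} {T : Multiset (D i)} (h : ∀ t ∈ T, BAtom (B.χ i) t) :
    B.numMixed (T.map (B.lift i)) = 0 := by
  classical
  unfold numMixed
  rw [Multiset.countP_eq_zero]
  intro u hu
  obtain ⟨t, ht, rfl⟩ := Multiset.mem_map.1 hu
  exact B.not_mixed_lift (h t ht).cls

variable {n : ι → ℕ} {N : ℕ} (hA : ∀ i, LocA (B.χ i) (n i)) (h2 : 2 ≤ N)
  (hn1 : ∀ i, n i + 1 ≤ N) (hnn : ∀ i j, i ≠ j → n i + n j ≤ N)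
include hA h2 hn1 hnn

/-- Two mixed atoms meet at `i`. The product of their `i`-th components is refactored by `LocA`.
Their partner components, at `j` and `j'`, are refactored too if `j = j'`, and otherwise form a
single new mixed atom. So two mixed atoms become none or one, at a cost of `n i + n j` or `n i + 1`
atoms. -/
theorem exists_numMixed_lt {a : R} {z : Multiset R} (hz : z ∈ Fact a) (hnr : ¬ B.Reduced z) :
    ∃ z' ∈ Fact a, Conn N a z z' ∧ B.numMixed z' < B.numMixed z := by
  classical
  unfold Reduced at hnr
  push Not at hnr
  obtain ⟨i, hi⟩ := hnr
  obtain ⟨r, hr, hr1⟩ := Multiset.countP_pos.1 (lt_trans zero_lt_one hi)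
  obtain ⟨z', rfl⟩ := Multiset.exists_cons_of_mem hr
  rw [Multiset.countP_cons, if_pos hr1] at hi
  obtain ⟨r', hr', hr1'⟩ := Multiset.countP_pos.1 (Nat.lt_of_succ_lt_succ hi)
  obtain ⟨z₀, rfl⟩ := Multiset.exists_cons_of_mem hr'
  have hirr : Irreducible r := hz.1 r (by simp)
  have hirr' : Irreducible r' := hz.1 r' (by simp)
  obtain ⟨hy, j, hij, hw, hΘ⟩ := B.atom_one hirr hr1
  obtain ⟨hy', j', hij', hw', hΘ'⟩ := B.atom_one hirr' hr1'
  obtain ⟨T, hT, hTc⟩ := hA i _ _ hy hy'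
  have hzz : r ::ₘ r' ::ₘ z₀ = z₀ + (r ::ₘ {r'}) := by
    rw [Multiset.add_cons, add_comm, Multiset.singleton_add]
  rw [hzz] at hz ⊢
  have hmix : B.numMixed (z₀ + (r ::ₘ {r'})) = B.numMixed z₀ + 2 := by
    rw [numMixed_add]
    congr 1
    unfold numMixed
    rw [Multiset.countP_cons_of_pos _ ⟨i, hr1⟩, ← Multiset.cons_zero,
      Multiset.countP_cons_of_pos _ ⟨i, hr1'⟩]
    rfl
  have hcard : Multiset.card (r ::ₘ {r'}) ≤ N := by simpa using h2
  have hprod : B.Θ (r ::ₘ {r'}).prod = Pi.mulSingle i (B.Θ r i * B.Θ r' i) *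
      (Pi.mulSingle j (B.Θ r j) * Pi.mulSingle j' (B.Θ r' j')) := by
    rw [Multiset.prod_cons, Multiset.prod_singleton, map_mul, Pi.mulSingle_mul]
    conv_lhs => rw [hΘ, hΘ']
    exact mul_mul_mul_comm _ _ _ _
  have hTi := B.irreducible_of_mem_map_lift hT.mem
  have hTΘ := B.Θ_prod_lift fun t ht => (hT.mem t ht).cls
  rw [hT.prod] at hTΘ
  by_cases hjj : j = j'
  · subst hjj
    obtain ⟨T', hT', hTc'⟩ := hA j _ _ hw hw'
    have hTi' := B.irreducible_of_mem_map_lift hT'.mem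
    have hTΘ' := B.Θ_prod_lift fun t ht => (hT'.mem t ht).cls
    rw [hT'.prod] at hTΘ'
    obtain ⟨hf, hc⟩ := conn_of_add (N := N) hz (z' := T.map (B.lift i) + T'.map (B.lift j))
      (fun u hu => (Multiset.mem_add.1 hu).elim (hTi u) (hTi' u))
      (B.inj (by rw [Multiset.prod_add, map_mul, hprod, hTΘ, hTΘ', Pi.mulSingle_mul j]))
      hcard (by
        rw [Multiset.card_add, Multiset.card_map, Multiset.card_map]
        exact (add_le_add hTc hTc').trans (hnn i j hij))
    refine ⟨_, hf, hc, ?_⟩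
    rw [hmix, numMixed_add, numMixed_add, B.numMixed_map_lift hT.mem, B.numMixed_map_lift hT'.mem]
    omega
  · obtain ⟨s, hs⟩ := B.pair j j' _ _ hjj hw.cls hw'.cls
    have hsi := B.irreducible_pair hjj hw hw' hs
    obtain ⟨hf, hc⟩ := conn_of_add (N := N) hz (z' := T.map (B.lift i) + {s})
      (fun u hu => (Multiset.mem_add.1 hu).elim (hTi u)
        (fun h => (Multiset.mem_singleton.1 h) ▸ hsi))
      (B.inj (by rw [Multiset.prod_add, map_mul, hprod, hTΘ, Multiset.prod_singleton, hs]))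
      hcard (by
        rw [Multiset.card_add, Multiset.card_map, Multiset.card_singleton]
        exact (add_le_add_left hTc 1).trans (hn1 i))
    refine ⟨_, hf, hc, ?_⟩
    rw [hmix, numMixed_add, numMixed_add, B.numMixed_map_lift hT.mem]
    have : B.numMixed {s} ≤ 1 := by
      unfold numMixed
      exact (Multiset.countP_le_card _ _).trans (by simp)
    omega

theorem exists_reduced {a : R} {z : Multiset R} (hz : z ∈ Fact a) :
    ∃ z' ∈ Fact a, Conn N a z z' ∧ B.Reduced z' := by
  induction hm : B.numMixed z using Nat.strong_induction_on generalizing z with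
  | _ m ih =>
    by_cases hr : B.Reduced z
    · exact ⟨z, hz, Relation.ReflTransGen.refl, hr⟩
    · obtain ⟨z', hz', hc, hlt⟩ := B.exists_numMixed_lt hA h2 hn1 hnn hz hr
      obtain ⟨z'', hz'', hc', hr'⟩ := ih _ (hm ▸ hlt) hz' rfl
      exact ⟨z'', hz'', hc.trans hc', hr'⟩

omit hA h2 hn1 hnn in
/-- Replacing the `i`-th components of some atoms by another factorization of their product. -/
theorem exists_replace {i : ι} {z : Multiset R} (hz : ∀ r ∈ z, Irreducible r)
    (h1 : ∀ r ∈ z, B.Θ r i ≠ 1) {x : D i} (hx : LFact (B.χ i) (z.map fun r => B.Θ r i) x)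
    {T : Multiset (D i)} (hT : LFact (B.χ i) T x) {u : D i} (hu : u ∈ T)
    (huB : BAtom (B.χ i) u) :
    ∃ z' : Multiset R, (∀ r ∈ z', Irreducible r) ∧ z'.prod = z.prod ∧
      Multiset.card z' = Multiset.card T ∧ B.lift i u ∈ z' := by
  classical
  have hsingle : ∀ r ∈ z, B.χ i (B.Θ r i) = 0 → B.Θ r = Pi.mulSingle i (B.Θ r i) :=
    fun r hr h0 => (B.atom_zero (hz r hr) (h1 r hr) h0).2
  rcases zmod_two_cases (B.χ i x) with h0 | h0
  · have hxm := hx.mem_of_cls_zero (B.χ_mul i) h0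
    have hTm := hT.mem_of_cls_zero (B.χ_mul i) h0
    refine ⟨T.map (B.lift i), B.irreducible_of_mem_map_lift hTm, ?_, Multiset.card_map _ _,
      Multiset.mem_map_of_mem _ hu⟩
    apply B.inj
    rw [B.Θ_prod_lift fun t ht => (hTm t ht).cls, B.Θ_prod_single fun r hr =>
      hsingle r hr (hxm _ (Multiset.mem_map_of_mem _ hr)).cls, hT.prod, hx.prod]
  · obtain ⟨t, ht, ht1⟩ : ∃ t ∈ T, B.χ i t = 1 := by
      rw [← Multiset.countP_pos]
      rcases hT.count_eq (B.χ_mul i) with h | h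
      · rw [h.1] at h0; exact absurd h0 (by decide)
      · rw [h.2]; exact one_pos
    obtain ⟨r, hr, hr1⟩ : ∃ r ∈ z, B.χ i (B.Θ r i) = 1 := by
      have : ∃ t ∈ z.map fun r => B.Θ r i, B.χ i t = 1 := by
        rw [← Multiset.countP_pos]
        rcases hx.count_eq (B.χ_mul i) with h | h
        · rw [h.1] at h0; exact absurd h0 (by decide)
        · rw [h.2]; exact one_pos
      obtain ⟨t, ht, h⟩ := this
      obtain ⟨r, hr, rfl⟩ := Multiset.mem_map.1 ht
      exact ⟨r, hr, h⟩
    obtain ⟨T, rfl⟩ := Multiset.exists_cons_of_mem ht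
    obtain ⟨z, rfl⟩ := Multiset.exists_cons_of_mem hr
    have hc := hT.count
    rw [Multiset.countP_cons, if_pos ht1] at hc
    have hTm : ∀ s ∈ T, BAtom (B.χ i) s := fun s hs =>
      (hT.mem s (Multiset.mem_cons_of_mem hs)).resolve_right fun h =>
        Multiset.countP_eq_zero.1 (by omega : Multiset.countP (fun t => B.χ i t = 1) T = 0) s hs
          h.cls
    have hc' := hx.count
    rw [Multiset.map_cons, Multiset.countP_cons, if_pos hr1] at hc'
    have hzm : ∀ s ∈ z, B.Θ s = Pi.mulSingle i (B.Θ s i) := fun s hs =>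
      hsingle s (Multiset.mem_cons_of_mem hs) (B.chi_ne_one
        (Multiset.countP_eq_zero.1 (by omega : Multiset.countP (fun t => B.χ i t = 1)
          (z.map fun r => B.Θ r i) = 0) _ (Multiset.mem_map_of_mem _ hs)))
    have htE : EAtom (B.χ i) t := (hT.mem t ht).resolve_left fun h => by
      have := h.cls
      rw [ht1] at this
      exact absurd this (by decide)
    -- The atom `t` of non-trivial class in the new factorization takes over the partner component,
    -- at `j`, of the mixed atom `r` that is removed.
    obtain ⟨-, j, hij, hw, hΘ⟩ := B.atom_one (hz r hr) hr1
    obtain ⟨s, hs⟩ := B.pair i j _ _ hij ht1 hw.cls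
    refine ⟨s ::ₘ T.map (B.lift i), ?_, ?_, by simp, ?_⟩
    · intro v hv
      rcases Multiset.mem_cons.1 hv with rfl | hv
      · exact B.irreducible_pair hij htE hw hs
      · exact B.irreducible_of_mem_map_lift hTm v hv
    · apply B.inj
      have e1 := hT.prod
      have e2 := hx.prod
      rw [Multiset.prod_cons] at e1
      rw [Multiset.map_cons, Multiset.prod_cons] at e2
      rw [Multiset.prod_cons, Multiset.prod_cons, map_mul, map_mul, hs,
        B.Θ_prod_lift fun t ht => (hTm t ht).cls, B.Θ_prod_single hzm, hΘ, mul_right_comm,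
        ← Pi.mulSingle_mul, e1, mul_right_comm, ← Pi.mulSingle_mul]
      rw [pair_right hij, e2]
    · refine Multiset.mem_cons_of_mem (Multiset.mem_map_of_mem _ ?_)
      rcases Multiset.mem_cons.1 hu with rfl | hu
      · have := huB.cls
        rw [ht1] at this
        exact absurd this (by decide)
      · exact hu

variable (hB : ∀ i, LocB (B.χ i) N)
include hB

-- If some component of `a` is neither trivial nor a local atom, `LocB` provides `u`. If all are
-- atoms and one has class 0, that component is an atom of every reduced factorization. Otherwise
-- all components have class `e`, and a reduced factorization amounts to a pairing of the support.
-- Fix two primes `i`, `j`; exchanging the partners of `i` and `j` creates the fixed atom on `{i,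
-- j}` by a step of size 2.
omit hA hn1 hnn in
theorem exists_common_atom {a : R} (ha : a ≠ 1) : ∃ u, Irreducible u ∧
    ∀ z ∈ Fact a, B.Reduced z → ∃ z' ∈ Fact a, Conn N a z z' ∧ u ∈ z' := by
  classical
  by_cases hcase : ∃ i, B.Θ a i ≠ 1 ∧ ¬ BAtom (B.χ i) (B.Θ a i) ∧ ¬ EAtom (B.χ i) (B.Θ a i)
  · obtain ⟨i, hi1, hib, hie⟩ := hcase
    obtain ⟨u, hu, hloc⟩ := hB i _ hi1 hib hie
    refine ⟨B.lift i u, B.irreducible_lift hu, fun z hz hzr => ?_⟩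
    obtain ⟨T₀, T₁, T₁', hT, hL, huT, hc, hc'⟩ := hloc _ (B.lFact_part hz hzr i)
    have hL0 := B.lFact_part hz hzr i
    obtain ⟨z₀, z₁, hp, rfl, rfl⟩ := exists_add_of_map_eq_add _ hT
    have hz1 : ∀ r ∈ z₁, r ∈ B.part i z := fun r hr => hp ▸ Multiset.mem_add.2 (Or.inr hr)
    rw [hT] at hL0
    have hpr : T₁'.prod = (z₁.map fun r => B.Θ r i).prod := by
      have := hL.prod.trans hL0.prod.symm
      rw [Multiset.prod_add, Multiset.prod_add] at this
      exact _root_.mul_left_cancel this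
    have hL1 : LFact (B.χ i) (z₁.map fun r => B.Θ r i) T₁'.prod := by
      refine ⟨fun t ht => hL0.mem t (Multiset.mem_add.2 (Or.inr ht)), ?_, hpr.symm⟩
      have := hL0.count
      rw [Multiset.countP_add] at this
      omega
    have hL1' : LFact (B.χ i) T₁' T₁'.prod := by
      refine ⟨fun t ht => hL.mem t (Multiset.mem_add.2 (Or.inr ht)), ?_, rfl⟩
      have := hL.count
      rw [Multiset.countP_add] at this
      omega
    obtain ⟨z₁', hirr, hprod, hcard, hmem⟩ := B.exists_replace
      (fun r hr => hz.1 r (Multiset.mem_of_le (Multiset.filter_le _ _) (hz1 r hr)))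
      (fun r hr => (Multiset.mem_filter.1 (hz1 r hr)).2) hL1 hL1' huT hu
    obtain ⟨y, hzz⟩ : ∃ y, z = (y + z₀) + z₁ := by
      refine ⟨z.filter (fun r => ¬ B.Θ r i ≠ 1), ?_⟩
      rw [add_assoc, ← hp, add_comm]
      exact (Multiset.filter_add_not (fun r => B.Θ r i ≠ 1) z).symm
    rw [hzz] at hz
    obtain ⟨hf, hconn⟩ := conn_of_add (N := N) hz hirr hprod (by simpa using hc)
      (by rw [hcard]; exact hc')
    exact ⟨_, hf, hzz ▸ hconn, Multiset.mem_add.2 (Or.inr hmem)⟩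
  · push Not at hcase
    have hatom : ∀ i, B.Θ a i ≠ 1 → BAtom (B.χ i) (B.Θ a i) ∨ EAtom (B.χ i) (B.Θ a i) :=
      fun i hi => or_iff_not_imp_left.2 (hcase i hi)
    have hsing : ∀ z ∈ Fact a, B.Reduced z → ∀ i, B.Θ a i ≠ 1 →
        (B.part i z).map (fun r => B.Θ r i) = {B.Θ a i} := fun z hz hr i hi =>
      LFact.eq_singleton (B.χ_mul i) (B.red i) (B.lFact_part hz hr i) (hatom i hi)
    have hmem : ∀ z ∈ Fact a, B.Reduced z → ∀ i, B.Θ a i ≠ 1 → ∃ r ∈ z, B.Θ r i = B.Θ a i := by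
      intro z hz hr i hi
      have := hsing z hz hr i hi
      obtain ⟨r, hr, h⟩ := Multiset.mem_map.1 (this ▸ Multiset.mem_singleton_self (B.Θ a i))
      exact ⟨r, Multiset.mem_of_le (Multiset.filter_le _ _) hr, h⟩
    have huniq : ∀ z ∈ Fact a, B.Reduced z → ∀ i, ∀ r ∈ z, B.Θ r i ≠ 1 → B.Θ a i ≠ 1 →
        B.Θ r i = B.Θ a i := by
      intro z hz hr i r hrz hri hi
      have h := hsing z hz hr i hi
      apply Multiset.mem_singleton.1
      rw [← h]
      exact Multiset.mem_map_of_mem (fun r => B.Θ r i) (Multiset.mem_filter.2 ⟨hrz, hri⟩)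
    by_cases hb : ∃ i, B.Θ a i ≠ 1 ∧ B.χ i (B.Θ a i) = 0
    · obtain ⟨i, hi1, hi0⟩ := hb
      have hbat : BAtom (B.χ i) (B.Θ a i) := (hatom i hi1).resolve_right fun h => by
        have := h.cls
        rw [hi0] at this
        exact absurd this (by decide)
      refine ⟨_, B.irreducible_lift hbat, fun z hz hzr =>
        ⟨z, hz, Relation.ReflTransGen.refl, ?_⟩⟩
      obtain ⟨r, hr, hri⟩ := hmem z hz hzr i hi1
      have : r = B.lift i (B.Θ a i) := by
        apply B.inj
        rw [B.Θ_lift hi0, ← hri]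
        exact (B.atom_zero (hz.1 r hr) (by rw [hri]; exact hi1) (by rw [hri]; exact hi0)).2
      exact this ▸ hr
    · push Not at hb
      have hE : ∀ i, B.Θ a i ≠ 1 → EAtom (B.χ i) (B.Θ a i) := fun i hi =>
        (hatom i hi).resolve_left fun h => hb i hi h.cls
      obtain ⟨i, hi⟩ : ∃ i, B.Θ a i ≠ 1 := by
        by_contra! hcon
        exact ha (B.eq_one_of_comp hcon)
      obtain ⟨j, hji, hj⟩ : ∃ j, j ≠ i ∧ B.Θ a j ≠ 1 := by
        by_contra! hcon
        exact hb i hi (B.conv a i _ (eq_mulSingle hcon))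
      obtain ⟨u, hu⟩ := B.pair i j _ _ hji.symm (hE i hi).cls (hE j hj).cls
      have huirr := B.irreducible_pair hji.symm (hE i hi) (hE j hj) hu
      refine ⟨u, huirr, fun z hz hzr => ?_⟩
      by_cases huz : u ∈ z
      · exact ⟨z, hz, Relation.ReflTransGen.refl, huz⟩
      obtain ⟨r, hr, hri⟩ := hmem z hz hzr i hi
      obtain ⟨r', hr', hrj⟩ := hmem z hz hzr j hj
      obtain ⟨-, k, hik, hk, hΘ⟩ := B.atom_one (hz.1 r hr) (by rw [hri]; exact (hE i hi).cls)
      obtain ⟨-, l, hjl, hl, hΘ'⟩ := B.atom_one (hz.1 r' hr') (by rw [hrj]; exact (hE j hj).cls)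
      have hkj : k ≠ j := by
        rintro rfl
        have h := huniq z hz hzr k r hr (B.ne_one_of_chi hk.cls) hj
        rw [hri, h, ← hu] at hΘ
        exact huz (B.inj hΘ ▸ hr)
      have hli : l ≠ i := by
        rintro rfl
        have h := huniq z hz hzr l r' hr' (B.ne_one_of_chi hl.cls) hi
        rw [hrj, h, mul_comm, ← hu] at hΘ'
        exact huz (B.inj hΘ' ▸ hr')
      have hrr : r' ≠ r := by
        rintro rfl
        have := congrFun hΘ j
        rw [pair_other hji hkj.symm, hrj] at this
        exact hj this
      obtain ⟨z', rfl⟩ := Multiset.exists_cons_of_mem hr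
      obtain ⟨z₀, rfl⟩ := Multiset.exists_cons_of_mem
        ((Multiset.mem_cons.1 hr').resolve_left hrr)
      -- A common partner would contradict reducedness at that prime.
      have hkl : k ≠ l := by
        rintro rfl
        have := hzr k
        rw [Multiset.countP_cons, if_pos hk.cls, Multiset.countP_cons, if_pos hl.cls] at this
        omega
      obtain ⟨s, hs⟩ := B.pair k l _ _ hkl hk.cls hl.cls
      have hzz : r ::ₘ r' ::ₘ z₀ = z₀ + (r ::ₘ {r'}) := by
        rw [Multiset.add_cons, add_comm, Multiset.singleton_add]
      rw [hzz] at hz ⊢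
      obtain ⟨hf, hc⟩ := conn_of_add (N := N) hz (z' := u ::ₘ {s})
        (fun v hv => by
          rcases Multiset.mem_cons.1 hv with rfl | hv
          · exact huirr
          · rw [Multiset.mem_singleton.1 hv]; exact B.irreducible_pair hkl hk hl hs)
        (B.inj (by
          simp only [Multiset.prod_cons, Multiset.prod_singleton, map_mul]
          rw [hu, hs]
          conv_rhs => rw [hΘ, hΘ', hri, hrj]
          exact mul_mul_mul_comm _ _ _ _))
        (by simpa using h2) (by simpa using h2)
      exact ⟨_, hf, hc, by simp⟩

/-- Any two factorizations are connected by an `N`-chain. -/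
theorem conn_of_local (a : R) : ∀ z ∈ Fact a, ∀ z' ∈ Fact a, Conn N a z z' := by
  induction hm : B.size a using Nat.strong_induction_on generalizing a with
  | _ m ih =>
    intro z hz z' hz'
    by_cases ha : a = 1
    · subst ha
      rw [eq_zero_of_prod_eq_one hz.1 hz.2, eq_zero_of_prod_eq_one hz'.1 hz'.2]
      exact Relation.ReflTransGen.refl
    obtain ⟨u, hu, hcommon⟩ := B.exists_common_atom h2 hB ha
    -- Every factorization is first made reduced and then moved to one containing `u`; cancelling
    -- `u` lowers the size.
    have key : ∀ z ∈ Fact a, ∃ y, u ::ₘ y ∈ Fact a ∧ Conn N a z (u ::ₘ y) := by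
      intro z hz
      obtain ⟨z₁, hz₁, hc, hr⟩ := B.exists_reduced hA h2 hn1 hnn hz
      obtain ⟨z₂, hz₂, hc', hu₂⟩ := hcommon z₁ hz₁ hr
      obtain ⟨y, rfl⟩ := Multiset.exists_cons_of_mem hu₂
      exact ⟨y, hz₂, hc.trans hc'⟩
    obtain ⟨y, hy, hc⟩ := key z hz
    obtain ⟨y', hy', hc'⟩ := key z' hz'
    have hp : y'.prod = y.prod := by
      have h := hy'.2.trans hy.2.symm
      rw [Multiset.prod_cons, Multiset.prod_cons] at h
      exact B.mul_left_cancel h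
    have ha' : a = u * y.prod := by rw [← hy.2, Multiset.prod_cons]
    have hlt : B.size y.prod < m := by
      rw [← hm, ha', B.size_mul]
      have := B.size_pos u (fun h => hu.not_isUnit (h ▸ isUnit_one))
      omega
    have hconn := ih _ hlt y.prod rfl y
      ⟨fun v hv => hy.1 v (Multiset.mem_cons_of_mem hv), rfl⟩ y'
      ⟨fun v hv => hy'.1 v (Multiset.mem_cons_of_mem hv), hp⟩
    have := hconn.cons hu
    rw [← ha'] at this
    exact hc.trans (this.trans hc'.symm)

end BlockData

end WeaklyKrull


/-! ### Elements with exactly two prescribed lengths: the lower bound -/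

namespace WeaklyKrull

/-- A product of two atoms of non-trivial class, all of whose factorizations into atoms of trivial
class have length `r`, and all of whose other factorizations have length two. -/
def Gadget {D : Type*} [CancelCommMonoid D] (χ : D → ZMod 2) (r : ℕ) : Prop :=
  ∃ y₁ y₂, EAtom χ y₁ ∧ EAtom χ y₂ ∧
    (∀ y w, y₁ * y₂ = y * w → EAtom χ y → EAtom χ w) ∧
    (∀ T, BFact χ T (y₁ * y₂) → Multiset.card T = r) ∧ ∃ T, BFact χ T (y₁ * y₂)

namespace BlockData

variable {R : Type*} [CommMonoid R] {ι : Type*} [DecidableEq ι] {D : ι → Type*}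
  [∀ i, CancelCommMonoid (D i)] (B : BlockData R ι D)

theorem map_lift_mem_fact {i : ι} {T : Multiset (D i)} {x : D i} (h : BFact (B.χ i) T x) :
    T.map (B.lift i) ∈ Fact (B.lift i x) := by
  have hx : B.χ i x = 0 := h.prod ▸ chi_prod_eq_zero (B.χ_mul i) fun t ht => (h.mem t ht).cls
  refine ⟨B.irreducible_of_mem_map_lift h.mem, B.inj ?_⟩
  rw [B.Θ_prod_lift fun t ht => (h.mem t ht).cls, h.prod, B.Θ_lift hx]

theorem map_lift_injOn {i : ι} {T T' : Multiset (D i)} (h : ∀ t ∈ T, B.χ i t = 0)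
    (h' : ∀ t ∈ T', B.χ i t = 0) (heq : T.map (B.lift i) = T'.map (B.lift i)) : T = T' := by
  have key : ∀ T : Multiset (D i), (∀ t ∈ T, B.χ i t = 0) →
      (T.map (B.lift i)).map (fun r => B.Θ r i) = T := by
    intro T hT
    rw [Multiset.map_map]
    conv_rhs => rw [← Multiset.map_id' T]
    refine Multiset.map_congr rfl fun t ht => ?_
    rw [Function.comp_apply, B.Θ_lift (hT t ht), Pi.mulSingle_eq_same]
  rw [← key T h, ← key T' h', heq]

/-- A mixed atom in `z` has components of class `e` at both `i` and `j`. By `hx` and `hx'` its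
cofactor has irreducible components there too, so it is a single atom and the length is 2. Without
mixed atoms, `z` is the union of a factorization of `x` and one of `x'`. -/
theorem card_eq_of_gadgets {i j : ι} (hij : i ≠ j) {r r' : ℕ} {x : D i} {x' : D j}
    (hx0 : B.χ i x = 0) (hx0' : B.χ j x' = 0)
    (hx : ∀ y w, x = y * w → EAtom (B.χ i) y → EAtom (B.χ i) w)
    (hx' : ∀ y w, x' = y * w → EAtom (B.χ j) y → EAtom (B.χ j) w)
    (hr : ∀ T, BFact (B.χ i) T x → Multiset.card T = r)
    (hr' : ∀ T, BFact (B.χ j) T x' → Multiset.card T = r') {a : R}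
    (ha : B.Θ a = Pi.mulSingle i x * Pi.mulSingle j x') {z : Multiset R} (hz : z ∈ Fact a) :
    Multiset.card z = 2 ∨ Multiset.card z = r + r' := by
  classical
  have hai : B.Θ a i = x := by rw [ha, pair_left hij]
  have haj : B.Θ a j = x' := by rw [ha, pair_right hij]
  have hsupp : ∀ u ∈ z, ∀ k, B.Θ u k ≠ 1 → k = i ∨ k = j := by
    intro u hu k hk
    by_contra! hcon
    have h1 : B.Θ a k = 1 := by rw [ha, pair_other hcon.1 hcon.2]
    obtain ⟨z', rfl⟩ := Multiset.exists_cons_of_mem hu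
    rw [← hz.2, Multiset.prod_cons] at h1
    exact hk (B.comp_eq_one h1).1
  by_cases hmix : ∃ u ∈ z, B.Mixed u
  · left
    obtain ⟨u, hu, k, hk⟩ := hmix
    obtain ⟨hEk, l, hkl, hEl, -⟩ := B.atom_one (hz.1 u hu) hk
    have hE : EAtom (B.χ i) (B.Θ u i) ∧ EAtom (B.χ j) (B.Θ u j) := by
      rcases hsupp u hu k (B.ne_one_of_chi hEk.cls) with rfl | rfl <;>
        rcases hsupp u hu l (B.ne_one_of_chi hEl.cls) with rfl | rfl
      · exact absurd rfl hkl
      · exact ⟨hEk, hEl⟩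
      · exact ⟨hEl, hEk⟩
      · exact absurd rfl hkl
    obtain ⟨z', rfl⟩ := Multiset.exists_cons_of_mem hu
    have hp := hz.2
    rw [Multiset.prod_cons] at hp
    have hci := hx (B.Θ u i) (B.Θ z'.prod i) (by rw [← hai, ← hp, map_mul]; rfl) hE.1
    have hcj := hx' (B.Θ u j) (B.Θ z'.prod j) (by rw [← haj, ← hp, map_mul]; rfl) hE.2
    have hc : B.Θ z'.prod =
        Pi.mulSingle i (B.Θ z'.prod i) * Pi.mulSingle j (B.Θ z'.prod j) := by
      funext k
      rcases eq_or_ne k i with rfl | hki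
      · rw [pair_left hij]
      rcases eq_or_ne k j with rfl | hkj
      · rw [pair_right hij]
      rw [pair_other hki hkj]
      have h1 : B.Θ a k = 1 := by rw [ha, pair_other hki hkj]
      rw [← hp] at h1
      exact (B.comp_eq_one h1).2
    have := eq_singleton_of_irreducible_prod
      (fun v hv => hz.1 v (Multiset.mem_cons_of_mem hv)) (B.irreducible_pair hij hci hcj hc)
    rw [Multiset.card_cons, this]
  · right
    push Not at hmix
    have hred : B.Reduced z := fun k => by
      have : (z.countP fun r => B.χ k (B.Θ r k) = 1) = 0 :=
        Multiset.countP_eq_zero.2 fun u hu h => hmix u hu ⟨k, h⟩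
      omega
    have h1 := B.lFact_part hz hred i
    have h2 := B.lFact_part hz hred j
    rw [hai] at h1
    rw [haj] at h2
    have h3 := hr _ ⟨h1.mem_of_cls_zero (B.χ_mul i) hx0, h1.prod⟩
    have h4 := hr' _ ⟨h2.mem_of_cls_zero (B.χ_mul j) hx0', h2.prod⟩
    rw [Multiset.card_map] at h3 h4
    have h5 : z = B.part i z + B.part j z := by
      conv_lhs => rw [← Multiset.filter_add_not (fun r => B.Θ r i ≠ 1) z]
      unfold part
      congr 1
      refine Multiset.filter_congr fun u hu => ?_
      rw [not_not]
      constructor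
      · intro hi hj
        refine (hz.1 u hu).not_isUnit (B.isUnit_iff.2 (B.eq_one_of_comp fun k => ?_))
        by_contra hk
        rcases hsupp u hu k hk with rfl | rfl
        · exact hk hi
        · exact hk hj
      · intro hj
        have hj0 := B.chi_ne_one fun h => hmix u hu ⟨j, h⟩
        rw [(B.atom_zero (hz.1 u hu) hj hj0).2, Pi.mulSingle_eq_of_ne hij]
    rw [h5, Multiset.card_add, h3, h4]

/-- The element is the product of the mixed atoms `(y₁, w₁)` and `(y₂, w₂)`; refactoring both local
products separately gives the other length. -/
theorem exists_fact_of_gadgets {i j : ι} (hij : i ≠ j) {r r' : ℕ} (h : Gadget (B.χ i) r)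
    (h' : Gadget (B.χ j) r') : ∃ a : R, ∃ z ∈ Fact a, ∃ z' ∈ Fact a, Multiset.card z = 2 ∧
      Multiset.card z' = r + r' ∧
      ∀ y ∈ Fact a, Multiset.card y = 2 ∨ Multiset.card y = r + r' := by
  obtain ⟨y₁, y₂, hy₁, hy₂, hdec, hlen, T, hT⟩ := h
  obtain ⟨w₁, w₂, hw₁, hw₂, hdec', hlen', T', hT'⟩ := h'
  obtain ⟨u, hu⟩ := B.pair i j _ _ hij hy₁.cls hw₁.cls
  obtain ⟨v, hv⟩ := B.pair i j _ _ hij hy₂.cls hw₂.cls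
  have hΘ : B.Θ (u * v) = Pi.mulSingle i (y₁ * y₂) * Pi.mulSingle j (w₁ * w₂) := by
    rw [map_mul, hu, hv, mul_mul_mul_comm, ← Pi.mulSingle_mul, ← Pi.mulSingle_mul]
  refine ⟨u * v, u ::ₘ {v}, ⟨?_, by simp⟩, T.map (B.lift i) + T'.map (B.lift j), ⟨?_, ?_⟩, by simp,
    ?_, ?_⟩
  · intro s hs
    rcases Multiset.mem_cons.1 hs with rfl | hs
    · exact B.irreducible_pair hij hy₁ hw₁ hu
    · rw [Multiset.mem_singleton.1 hs]
      exact B.irreducible_pair hij hy₂ hw₂ hv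
  · exact fun s hs => (Multiset.mem_add.1 hs).elim (B.irreducible_of_mem_map_lift hT.mem s)
      (B.irreducible_of_mem_map_lift hT'.mem s)
  · apply B.inj
    rw [Multiset.prod_add, map_mul, B.Θ_prod_lift fun t ht => (hT.mem t ht).cls,
      B.Θ_prod_lift fun t ht => (hT'.mem t ht).cls, hT.prod, hT'.prod, hΘ]
  · rw [Multiset.card_add, Multiset.card_map, Multiset.card_map, hlen T hT, hlen' T' hT']
  · have h11 : (1 : ZMod 2) + 1 = 0 := by decide
    exact fun y hy => B.card_eq_of_gadgets hij (by rw [B.χ_mul, hy₁.cls, hy₂.cls, h11])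
      (by rw [B.χ_mul, hw₁.cls, hw₂.cls, h11]) hdec hdec' hlen hlen' hΘ hy

end BlockData

section Distances

variable {M : Type*} [CommMonoid M] {ι : Type*} [DecidableEq ι] {D : ι → Type*}
  [∀ i, CancelCommMonoid (D i)] (B : BlockData (Associates M) ι D)
include B

theorem mem_setOfDistances_of_gadgets {i j : ι} (hij : i ≠ j) {r r' d : ℕ}
    (h : Gadget (B.χ i) r) (h' : Gadget (B.χ j) r') (hd : 0 < d) (hrd : r + r' = d + 2) :
    d ∈ setOfDistances M := by
  obtain ⟨a, z, hz, z', hz', h2, h3, h4⟩ := B.exists_fact_of_gadgets hij h h'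
  refine mem_setOfDistances_iff.2 ⟨hd, a, z, hz, z', hz', by omega, fun y hy => ?_⟩
  have := h4 y hy
  omega

theorem one_mem_setOfDistances {i : ι} {T T' : Multiset (D i)} {x : D i}
    (h : BFact (B.χ i) T x) (h' : BFact (B.χ i) T' x)
    (hc : Multiset.card T' = Multiset.card T + 1) : 1 ∈ setOfDistances M := by
  refine mem_setOfDistances_iff.2 ⟨one_pos, _, _, B.map_lift_mem_fact h, _,
    B.map_lift_mem_fact h', by simpa using hc, fun y _ => ?_⟩
  omega

theorem two_le_catenaryDegree_of_bFact {i : ι} {T T' : Multiset (D i)} {x : D i}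
    (h : BFact (B.χ i) T x) (h' : BFact (B.χ i) T' x) (hne : T ≠ T') :
    ((2 : ℕ) : ℕ∞) ≤ catenaryDegree M :=
  two_le_catenaryDegree (fun _ _ _ h => B.mul_left_cancel h) (B.map_lift_mem_fact h)
    (B.map_lift_mem_fact h') fun heq => hne (B.map_lift_injOn (fun t ht => (h.mem t ht).cls)
      (fun t ht => (h'.mem t ht).cls) heq)

end Distances

end WeaklyKrull


namespace WeaklyKrull

/-! ## Local arithmetic: seminormal finitely primary monoids -/

/-- `D` is a reduced seminormal finitely primary monoid, with exponents `k`. -/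
structure LocalData {D : Type*} [CancelCommMonoid D] (χ : D → ZMod 2) {J : Type*}
    (k : D → J → ℕ) : Prop where
  chi_mul : ∀ a b, χ (a * b) = χ a + χ b
  k_mul : ∀ a b j, k (a * b) j = k a j + k b j
  pos : ∀ x, x ≠ 1 → ∀ j, 1 ≤ k x j
  -- Strict inequality is needed: the quotient must have positive exponents, and seminormality
  -- places all such elements in the monoid.
  sub : ∀ u x, (∀ j, k u j < k x j) → ∃ y, x = u * y
  ex : ∀ a : J → ℕ, (∀ j, 1 ≤ a j) → ∃ y, ∀ j, k y j = a j
  nonempty : Nonempty J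

namespace LocalData

variable {D : Type*} [CancelCommMonoid D] {χ : D → ZMod 2} {J : Type*} {k : D → J → ℕ}
  (L : LocalData χ k)
include L

theorem k_one (j : J) : k 1 j = 0 := by
  have := L.k_mul 1 1 j
  rw [mul_one] at this
  omega

theorem ne_one_of_pos {y : D} {j : J} (h : 1 ≤ k y j) : y ≠ 1 := by
  rintro rfl
  rw [L.k_one] at h
  omega

theorem red (a b : D) (h : a * b = 1) : a = 1 := by
  by_contra ha
  obtain ⟨j⟩ := L.nonempty
  have := L.k_mul a b j
  rw [h, L.k_one] at this
  have := L.pos a ha j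
  omega

/-- Every element other than 1 has all exponents at least 1, so a proper product has all exponents
at least 2. A single exponent 1 is the certificate of irreducibility used throughout. -/
theorem irr_of_one {y : D} {j : J} (h : k y j = 1) : ∀ a b, y = a * b → a = 1 ∨ b = 1 := by
  rintro a b rfl
  by_contra! hcon
  have h1 := L.pos a hcon.1 j
  have h2 := L.pos b hcon.2 j
  rw [L.k_mul] at h
  omega

theorem bAtom_of_one {y : D} {j : J} (h : k y j = 1) (h0 : χ y = 0) : BAtom χ y :=
  ⟨h0, L.ne_one_of_pos h.ge, fun a b hab _ => L.irr_of_one h a b hab⟩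

theorem eAtom_of_one {y : D} {j : J} (h : k y j = 1) (h0 : χ y = 1) : EAtom χ y :=
  ⟨h0, L.irr_of_one h⟩

theorem atom_of_one {y : D} {j : J} (h : k y j = 1) : BAtom χ y ∨ EAtom χ y :=
  (zmod_two_cases (χ y)).imp (L.bAtom_of_one h) (L.eAtom_of_one h)

theorem ne_one_of_atom {y : D} (h : BAtom χ y ∨ EAtom χ y) : y ≠ 1 :=
  h.elim (fun h => h.ne_one) (fun h => h.ne_one L.chi_mul)

theorem sub_k {u x : D} (h : ∀ j, k u j < k x j) :
    ∃ y, x = u * y ∧ (∀ j, k y j = k x j - k u j) ∧ y ≠ 1 := by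
  obtain ⟨y, rfl⟩ := L.sub u x h
  have hy : ∀ j, k y j = k (u * y) j - k u j := fun j => by rw [L.k_mul]; omega
  obtain ⟨j⟩ := L.nonempty
  refine ⟨y, rfl, hy, L.ne_one_of_pos (j := j) ?_⟩
  have := h j
  rw [hy]
  omega

theorem split {x : D} {a : J → ℕ} (h1 : ∀ j, 1 ≤ a j) (h : ∀ j, a j < k x j) :
    ∃ y y', x = y * y' ∧ (∀ j, k y j = a j) ∧ (∀ j, k y' j = k x j - a j) := by
  obtain ⟨y, hy⟩ := L.ex a h1
  obtain ⟨y', h1, h2, -⟩ := L.sub_k (u := y) (x := x) fun j => by rw [hy]; exact h j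
  exact ⟨y, y', h1, hy, fun j => by rw [h2, hy]⟩

theorem two_le_of_mul {a b : D} (ha : a ≠ 1) (hb : b ≠ 1) (j : J) : 2 ≤ k (a * b) j := by
  rw [L.k_mul]
  have := L.pos a ha j
  have := L.pos b hb j
  omega

theorem card_le {T : Multiset D} (h : ∀ t ∈ T, t ≠ 1) (j : J) :
    Multiset.card T ≤ k T.prod j := by
  induction T using Multiset.induction with
  | empty => simp
  | cons t T ih =>
    rw [Multiset.card_cons, Multiset.prod_cons, L.k_mul]
    have := ih fun s hs => h s (Multiset.mem_cons_of_mem hs)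
    have := L.pos t (h t (Multiset.mem_cons_self t T)) j
    omega

omit L in
theorem lFact_singleton {y : D} (h : BAtom χ y ∨ EAtom χ y) : LFact χ {y} y :=
  ⟨fun t ht => Multiset.mem_singleton.1 ht ▸ h,
    (Multiset.countP_le_card _ _).trans (by simp), by simp⟩

omit L in
theorem LFact.cons {u v : D} {T : Multiset D} (hu : BAtom χ u) (h : LFact χ T v) :
    LFact χ (u ::ₘ T) (u * v) := by
  refine ⟨fun t ht => ?_, ?_, by rw [Multiset.prod_cons, h.prod]⟩
  · rcases Multiset.mem_cons.1 ht with rfl | ht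
    · exact Or.inl hu
    · exact h.mem t ht
  · rw [Multiset.countP_cons, if_neg (by rw [hu.cls]; decide)]
    exact h.count

omit L in
-- A factorization of such an `x` has at least two atoms. At most one of them has non-trivial class,
-- so one of class 0 can be listed first.
theorem exists_two {x : D} (h1 : x ≠ 1) (hb : ¬ BAtom χ x) (he : ¬ EAtom χ x) {T : Multiset D}
    (hT : LFact χ T x) : ∃ y₁ y₂ T₀, T = T₀ + (y₁ ::ₘ {y₂}) ∧ BAtom χ y₁ ∧
      (BAtom χ y₂ ∨ EAtom χ y₂) := by
  have hc : ∃ y y' T₀, T = y ::ₘ y' ::ₘ T₀ := by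
    rcases Multiset.empty_or_exists_mem T with rfl | ⟨y, hy⟩
    · exact absurd hT.prod.symm h1
    obtain ⟨T, rfl⟩ := Multiset.exists_cons_of_mem hy
    rcases Multiset.empty_or_exists_mem T with rfl | ⟨y', hy'⟩
    · have h := hT.mem y hy
      have hp := hT.prod
      simp at hp
      subst hp
      exact absurd h (not_or.2 ⟨hb, he⟩)
    obtain ⟨T, rfl⟩ := Multiset.exists_cons_of_mem hy'
    exact ⟨y, y', T, rfl⟩
  obtain ⟨y, y', T₀, rfl⟩ := hc
  have key : ∀ y y' : D, y ::ₘ y' ::ₘ T₀ = T₀ + (y ::ₘ {y'}) := fun y y' => by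
    rw [Multiset.add_cons, add_comm, Multiset.singleton_add]
  have hy := hT.mem y (by simp)
  have hy' := hT.mem y' (by simp)
  rcases hy with h | h
  · exact ⟨y, y', T₀, key _ _, h, hy'⟩
  · refine ⟨y', y, T₀, by rw [Multiset.cons_swap, key], hy'.resolve_right fun h' => ?_, Or.inr h⟩
    have := hT.count
    rw [Multiset.countP_cons, if_pos h.cls, Multiset.countP_cons, if_pos h'.cls] at this
    omega

/-- Produces the conclusion of `LocB`: a part `T₁` with product `u * v` gives way to `u` and a short
factorization of `v`. -/
theorem exists_replacement {N : ℕ} {x u : D} (hu : BAtom χ u) {T₀ T₁ : Multiset D}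
    (hT : LFact χ (T₀ + T₁) x) {v : D} (hv : T₁.prod = u * v) {T' : Multiset D}
    (hT' : LFact χ T' v) (hc : Multiset.card T₁ ≤ N) (hc' : Multiset.card T' + 1 ≤ N) :
    ∃ S₀ S₁ S₁', T₀ + T₁ = S₀ + S₁ ∧ LFact χ (S₀ + S₁') x ∧ u ∈ S₁' ∧
      Multiset.card S₁ ≤ N ∧ Multiset.card S₁' ≤ N := by
  refine ⟨T₀, T₁, u ::ₘ T', rfl, hT.replace L.chi_mul ?_, Multiset.mem_cons_self _ _, hc,
    by simpa using hc'⟩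
  rw [hv]
  exact LFact.cons hu hT'

/-! ### Rank one, units of trivial class -/

section RankOne

variable {j₀ : J} (hj : ∀ j, j = j₀)
include hj

theorem bAtom_iff_one (hχ : ∀ x, χ x = 0) (y : D) : BAtom χ y ↔ k y j₀ = 1 := by
  refine ⟨fun h => ?_, fun h => L.bAtom_of_one h (hχ y)⟩
  have h1 := L.pos y h.ne_one j₀
  by_contra hne
  obtain ⟨u, v, rfl, hu, hv⟩ := L.split (x := y) (a := fun _ => 1) (fun _ => le_rfl)
    (fun j => by rw [hj j]; omega)
  rcases h.irr u v rfl (hχ u) with rfl | rfl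
  · exact L.ne_one_of_pos (j := j₀) (by rw [hu]) rfl
  · refine L.ne_one_of_pos (j := j₀) ?_ rfl
    rw [hv]
    omega

/-- Class 0 means even exponent. From exponent 4 on, an element of exponent 2 splits off, while
exponent 2 splits only into factors of exponent 1, which have class 1. -/
theorem bAtom_iff_two (hχ : ∀ x, χ x = (k x j₀ : ZMod 2)) (y : D) :
    BAtom χ y ↔ k y j₀ = 2 := by
  constructor
  · intro h
    have h1 := L.pos y h.ne_one j₀
    have h0 := h.cls
    rw [hχ, ZMod.natCast_eq_zero_iff_even] at h0
    obtain ⟨m, hm⟩ := h0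
    by_contra hne
    obtain ⟨u, v, rfl, hu, hv⟩ := L.split (x := y) (a := fun _ => 2) (fun _ => by norm_num)
      (fun j => by rw [hj j]; omega)
    rcases h.irr u v rfl (by rw [hχ, hu]; rfl) with rfl | rfl
    · exact L.ne_one_of_pos (j := j₀) (by rw [hu]; norm_num) rfl
    · refine L.ne_one_of_pos (j := j₀) ?_ rfl
      rw [hv]
      omega
  · intro h
    refine ⟨by rw [hχ, h]; rfl, L.ne_one_of_pos (j := j₀) (by omega), ?_⟩
    rintro a b rfl ha
    by_contra! hcon
    have h1 := L.pos a hcon.1 j₀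
    have h2 := L.pos b hcon.2 j₀
    rw [L.k_mul] at h
    rw [hχ, ZMod.natCast_eq_zero_iff_even] at ha
    obtain ⟨m, hm⟩ := ha
    omega

theorem eAtom_iff (hχ : ∀ x, χ x = (k x j₀ : ZMod 2)) (y : D) :
    EAtom χ y ↔ k y j₀ = 1 := by
  refine ⟨fun h => ?_, fun h => L.eAtom_of_one h (by rw [hχ, h]; rfl)⟩
  have h1 := L.pos y (h.ne_one L.chi_mul) j₀
  by_contra hne
  obtain ⟨u, v, rfl, hu, hv⟩ := L.split (x := y) (a := fun _ => 1) (fun _ => le_rfl)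
    (fun j => by rw [hj j]; omega)
  rcases h.irr u v rfl with rfl | rfl
  · exact L.ne_one_of_pos (j := j₀) (by rw [hu]) rfl
  · refine L.ne_one_of_pos (j := j₀) ?_ rfl
    rw [hv]
    omega

theorem locA_rank_one (hχ : (∀ x, χ x = 0) ∨ ∀ x, χ x = (k x j₀ : ZMod 2)) : LocA χ 1 := by
  intro y₁ y₂ h₁ h₂
  rcases hχ with hχ | hχ
  · have := h₁.cls
    rw [hχ] at this
    exact absurd this (by decide)
  · refine ⟨{y₁ * y₂}, ⟨fun t ht => ?_, by simp⟩, by simp⟩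
    rw [Multiset.mem_singleton.1 ht, L.bAtom_iff_two hj hχ, L.k_mul,
      (L.eAtom_iff hj hχ _).1 h₁, (L.eAtom_iff hj hχ _).1 h₂]

/-- Here atoms are recognized by their exponents. All atoms of class 0 have the same exponent as
`u`, so the quotient of `y₁ * y₂` by `u` has the exponent of `y₂` and is an atom. -/
theorem locB_rank_one (hχ : (∀ x, χ x = 0) ∨ ∀ x, χ x = (k x j₀ : ZMod 2)) : LocB χ 2 := by
  intro x hx1 hb he
  rcases hχ with hχ | hχ
  · obtain ⟨u, hu'⟩ := L.ex (fun _ => 1) fun _ => le_rfl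
    have hu : k u j₀ = 1 := hu' j₀
    refine ⟨u, (L.bAtom_iff_one hj hχ u).2 hu, fun T hT => ?_⟩
    obtain ⟨y₁, y₂, T₀, rfl, hy₁, hy₂⟩ := exists_two hx1 hb he hT
    have h2 : k y₂ j₀ = 1 := by
      refine (L.bAtom_iff_one hj hχ y₂).1 (hy₂.resolve_right fun h => ?_)
      have := h.cls
      rw [hχ] at this
      exact absurd this (by decide)
    have h1 := (L.bAtom_iff_one hj hχ y₁).1 hy₁
    obtain ⟨v, hv, hvk, -⟩ := L.sub_k (u := u) (x := y₁ * y₂) (fun j => by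
      rw [hj j, L.k_mul, hu]; omega)
    refine L.exists_replacement ((L.bAtom_iff_one hj hχ u).2 hu) hT (v := v)
      (by simpa using hv) (T' := {v}) (lFact_singleton (L.atom_of_one (j := j₀) ?_)) (by simp)
      (by simp)
    rw [hvk, L.k_mul, hu]
    omega
  · obtain ⟨u, hu'⟩ := L.ex (fun _ => 2) fun _ => by norm_num
    have hu : k u j₀ = 2 := hu' j₀
    refine ⟨u, (L.bAtom_iff_two hj hχ u).2 hu, fun T hT => ?_⟩
    obtain ⟨y₁, y₂, T₀, rfl, hy₁, hy₂⟩ := exists_two hx1 hb he hT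
    have h1 := (L.bAtom_iff_two hj hχ y₁).1 hy₁
    have hy2 := L.pos y₂ (L.ne_one_of_atom hy₂) j₀
    obtain ⟨v, hv, hvk, -⟩ := L.sub_k (u := u) (x := y₁ * y₂) (fun j => by
      rw [hj j, L.k_mul, hu]; omega)
    have hvy : k v j₀ = k y₂ j₀ := by
      rw [hvk, L.k_mul, hu]
      omega
    refine L.exists_replacement ((L.bAtom_iff_two hj hχ u).2 hu) hT (v := v)
      (by simpa using hv) (T' := {v}) (lFact_singleton ?_) (by simp)
      (by simp)
    rw [L.bAtom_iff_two hj hχ, L.eAtom_iff hj hχ, hvy, ← L.bAtom_iff_two hj hχ,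
      ← L.eAtom_iff hj hχ]
    exact hy₂

/-- If the units are non-trivial, factorizations are not unique. -/
theorem exists_two_bFact_rank_one (hχ : (∀ x, χ x = 0) ∨ ∀ x, χ x = (k x j₀ : ZMod 2))
    {y y' : D} (hy : k y j₀ = 1) (hy' : k y' j₀ = 1) (hne : y ≠ y') :
    ∃ T T' x, BFact χ T x ∧ BFact χ T' x ∧ T ≠ T' := by
  -- The two factorizations are `b * b = b' * v`, where `v` is an atom because of its exponent.
  have key : ∀ b b' : D, BAtom χ b → BAtom χ b' → b ≠ b' → k b' j₀ = k b j₀ →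
      (∀ v, k v j₀ = k b j₀ → BAtom χ v) → ∃ T T' x, BFact χ T x ∧ BFact χ T' x ∧ T ≠ T' := by
    intro b b' hb hb' hne hk hatom
    have h1 := L.pos b hb.ne_one j₀
    obtain ⟨v, hv, hvk, -⟩ := L.sub_k (u := b') (x := b * b) (fun j => by
      rw [hj j, L.k_mul, hk]; omega)
    have hvb := hatom v (by rw [hvk, L.k_mul, hk]; omega)
    refine ⟨b ::ₘ {b}, b' ::ₘ {v}, b * b, ⟨?_, by simp⟩, ⟨?_, by simp [hv]⟩, fun h => hne ?_⟩
    · simp [hb]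
    · simp [hb', hvb]
    · have : b' ∈ b ::ₘ {b} := h ▸ Multiset.mem_cons_self _ _
      rcases Multiset.mem_cons.1 this with h | h
      · exact h.symm
      · exact (Multiset.mem_singleton.1 h).symm
  rcases hχ with hχ | hχ
  · refine key y y' ((L.bAtom_iff_one hj hχ _).2 hy) ((L.bAtom_iff_one hj hχ _).2 hy') hne
      (by rw [hy, hy']) fun v hv => (L.bAtom_iff_one hj hχ _).2 (by rw [hv, hy])
  · refine key (y * y) (y * y') ((L.bAtom_iff_two hj hχ _).2 (by rw [L.k_mul, hy]))
      ((L.bAtom_iff_two hj hχ _).2 (by rw [L.k_mul, hy, hy']))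
      (fun h => hne (mul_left_cancel h)) (by rw [L.k_mul, L.k_mul, hy, hy'])
      fun v hv => (L.bAtom_iff_two hj hχ _).2 (by rw [hv, L.k_mul, hy])

theorem gadget_rank_one (hχ : ∀ x, χ x = (k x j₀ : ZMod 2)) : Gadget χ 1 := by
  obtain ⟨u, hu⟩ := L.ex (fun _ => 1) fun _ => le_rfl
  have hu1 : k u j₀ = 1 := by rw [hu]
  have huE := (L.eAtom_iff hj hχ u).2 hu1
  have huu : BAtom χ (u * u) := (L.bAtom_iff_two hj hχ _).2 (by rw [L.k_mul, hu1])
  refine ⟨u, u, huE, huE, fun y w h hy => ?_, fun T hT => ?_, {u * u}, fun t ht => ?_, by simp⟩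
  · rw [L.eAtom_iff hj hχ] at hy ⊢
    have := L.k_mul y w j₀
    rw [← h, L.k_mul, hu1, hy] at this
    omega
  · rw [hT.eq_singleton L.red huu]; rfl
  · rw [Multiset.mem_singleton.1 ht]; exact huu

end RankOne

end LocalData

end WeaklyKrull


/-! ### Local arithmetic in general: short factorizations and gadgets -/

namespace WeaklyKrull

theorem exists_le_card_eq {α : Type*} {T : Multiset α} {n : ℕ} (h : n ≤ Multiset.card T) :
    ∃ S ≤ T, Multiset.card S = n := by
  induction T using Quotient.inductionOn with
  | _ l => exact ⟨(l.take n : List α), (List.take_sublist n l).subperm, by simpa using h⟩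

namespace LocalData

variable {D : Type*} [CancelCommMonoid D] {χ : D → ZMod 2} {J : Type*} {k : D → J → ℕ}
  (L : LocalData χ k)
include L

theorem locA_of_short {ρ : ℕ} (hC : ∀ v, v ≠ 1 → ∃ T, LFact χ T v ∧ Multiset.card T ≤ ρ) :
    LocA χ ρ := by
  intro y₁ y₂ h₁ h₂
  have hne : y₁ * y₂ ≠ 1 := fun h => h₁.ne_one L.chi_mul (L.red _ _ h)
  obtain ⟨T, hT, hc⟩ := hC _ hne
  refine ⟨T, ⟨hT.mem_of_cls_zero L.chi_mul ?_, hT.prod⟩, hc⟩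
  rw [L.chi_mul, h₁.cls, h₂.cls]
  decide

omit L in
theorem short_two {y y' : D} (h : BAtom χ y) (h' : BAtom χ y' ∨ EAtom χ y') :
    ∃ T, LFact χ T (y * y') ∧ Multiset.card T ≤ 2 :=
  ⟨_, LFact.cons h (lFact_singleton h'), by simp⟩

/-- The product has exponent 2 at `o`, so it has at most two proper factors, each then of exponent 1
at `o` and irreducible. The splitting `z₁ * z₂` into elements of class 0 excludes length 1. -/
theorem gadget_two {y₁ y₂ z₁ z₂ : D} {o : J} (h₁ : k y₁ o = 1) (h₂ : k y₂ o = 1)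
    (hc₁ : χ y₁ = 1) (hc₂ : χ y₂ = 1) (hz : y₁ * y₂ = z₁ * z₂) (hz₁ : k z₁ o = 1)
    (hcz : χ z₁ = 0) : Gadget χ 2 := by
  have hx : k (y₁ * y₂) o = 2 := by rw [L.k_mul, h₁, h₂]
  have hcx : χ (y₁ * y₂) = 0 := by rw [L.chi_mul, hc₁, hc₂]; decide
  have hz₂ : k z₂ o = 1 := by
    rw [hz, L.k_mul, hz₁] at hx
    omega
  have hcz₂ : χ z₂ = 0 := by
    rw [hz, L.chi_mul, hcz, zero_add] at hcx
    exact hcx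
  refine ⟨y₁, y₂, L.eAtom_of_one h₁ hc₁, L.eAtom_of_one h₂ hc₂, fun y w h hy => ?_,
    fun T hT => ?_, z₁ ::ₘ {z₂}, fun t ht => ?_, by simp [hz]⟩
  · have hw : χ w = 1 := by
      rw [h, L.chi_mul, hy.cls] at hcx
      rcases zmod_two_cases (χ w) with h0 | h0
      · rw [h0] at hcx; exact absurd hcx (by decide)
      · exact h0
    have hw1 : w ≠ 1 := by
      rintro rfl
      rw [chi_one L.chi_mul] at hw
      exact absurd hw (by decide)
    refine L.eAtom_of_one (j := o) ?_ hw
    have := L.pos y (hy.ne_one L.chi_mul) o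
    have := L.pos w hw1 o
    rw [h, L.k_mul] at hx
    omega
  · have hle := L.card_le (fun t ht => (hT.mem t ht).ne_one) o
    rw [hT.prod, hx] at hle
    rcases Nat.lt_or_ge (Multiset.card T) 2 with hlt | hge
    · exfalso
      rcases Nat.le_one_iff_eq_zero_or_eq_one.1 (Nat.lt_succ_iff.1 hlt) with h0 | h0
      · rw [Multiset.card_eq_zero] at h0
        subst h0
        have := hT.prod
        rw [Multiset.prod_zero] at this
        rw [← this, L.k_one] at hx
        omega
      · obtain ⟨t, rfl⟩ := Multiset.card_eq_one.1 h0
        have hb := hT.mem t (by simp)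
        have hp := hT.prod
        rw [Multiset.prod_singleton, hz] at hp
        rcases hb.irr _ _ hp hcz with rfl | rfl
        · rw [L.k_one] at hz₁; omega
        · rw [L.k_one] at hz₂; omega
    · omega
  · rcases Multiset.mem_cons.1 ht with rfl | ht
    · exact L.bAtom_of_one hz₁ hcz
    · rw [Multiset.mem_singleton.1 ht]
      exact L.bAtom_of_one hz₂ hcz₂

/-! ### Units of non-trivial class -/

section NontrivialUnits

-- A unit of class `e` allows exponents and class to be prescribed independently.
variable (hnt : ∀ a : J → ℕ, (∀ j, 1 ≤ a j) → ∀ g, ∃ y, (∀ j, k y j = a j) ∧ χ y = g)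
include hnt

/-- If all exponents are at least 2, an element of class 0 with all exponents 1 splits off. -/
theorem exists_one_of_atom {y : D} (hy : BAtom χ y ∨ EAtom χ y) : ∃ j, k y j = 1 := by
  by_contra! hcon
  obtain ⟨u, hu, hu0⟩ := hnt (fun _ => 1) (fun _ => le_rfl) 0
  have hne := L.ne_one_of_atom hy
  obtain ⟨v, rfl, -, hv⟩ := L.sub_k (u := u) (x := y) fun j => by
    have := L.pos y hne j
    have := hcon j
    rw [hu]
    omega
  obtain ⟨j⟩ := L.nonempty
  have hu1 : u ≠ 1 := L.ne_one_of_pos (j := j) (by rw [hu])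
  rcases hy with hy | hy
  · exact (hy.irr u v rfl hu0).elim hu1 hv
  · exact (hy.irr u v rfl).elim hu1 hv

/-- The first factor is given exponent 1 at `a` and all but 1 of the exponent at `b`, so that both
factors are irreducible; its class can be chosen to be 0. -/
theorem short_of_nontrivial {a b : J} (hab : a ≠ b) {v : D} (hv : v ≠ 1) :
    ∃ T, LFact χ T v ∧ Multiset.card T ≤ 2 := by
  classical
  by_cases h1 : ∃ j, k v j = 1
  · obtain ⟨j, hj⟩ := h1
    exact ⟨{v}, lFact_singleton (L.atom_of_one hj), by simp⟩
  push Not at h1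
  have h2 : ∀ j, 2 ≤ k v j := fun j => by
    have := L.pos v hv j
    have := h1 j
    omega
  obtain ⟨y, hy, hy0⟩ := hnt (fun j => if j = b then k v b - 1 else 1) (fun j => by
    have := h2 b
    split_ifs <;> omega) 0
  obtain ⟨y', rfl, hy', -⟩ := L.sub_k (u := y) (x := v) fun j => by
    have := h2 j
    rw [hy]
    split_ifs with h
    · subst h; omega
    · omega
  refine short_two (L.bAtom_of_one (j := a) (by rw [hy, if_neg hab]) hy0)
    (L.atom_of_one (j := b) ?_)
  have := h2 b
  rw [hy', hy, if_pos rfl]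
  omega

/-- Replacing `y₁` by an element `z` of class 0 with the same exponents leaves a cofactor with the
exponents of `y₂`, also of class 0. Each has some exponent 1 because `y₁` and `y₂` do. -/
theorem locA_of_nontrivial : LocA χ 2 := by
  intro y₁ y₂ h₁ h₂
  obtain ⟨z, hz, hz0⟩ := hnt (k y₁) (L.pos y₁ (h₁.ne_one L.chi_mul)) 0
  obtain ⟨z', hzz, hz', -⟩ := L.sub_k (u := z) (x := y₁ * y₂) fun j => by
    have := L.pos y₂ (h₂.ne_one L.chi_mul) j
    rw [hz, L.k_mul]
    omega
  obtain ⟨i, hi⟩ := L.exists_one_of_atom hnt (Or.inr h₁)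
  obtain ⟨j, hj⟩ := L.exists_one_of_atom hnt (Or.inr h₂)
  have h0 : χ z' = 0 := by
    have := L.chi_mul z z'
    rw [← hzz, L.chi_mul, h₁.cls, h₂.cls, hz0, zero_add] at this
    rw [← this]
    decide
  refine ⟨z ::ₘ {z'}, ⟨fun t ht => ?_, by simp [hzz]⟩, by simp⟩
  rcases Multiset.mem_cons.1 ht with rfl | ht
  · exact L.bAtom_of_one (j := i) (by rw [hz, hi]) hz0
  · rw [Multiset.mem_singleton.1 ht]
    exact L.bAtom_of_one (j := j) (by rw [hz', hz, L.k_mul, hj]; omega) h0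

theorem locB_of_nontrivial : LocB χ 3 := by
  intro x hx1 hb he
  obtain ⟨j₀⟩ := L.nonempty
  obtain ⟨u, hu, hu0⟩ := hnt (fun _ => 1) (fun _ => le_rfl) 0
  have hub := L.bAtom_of_one (j := j₀) (by rw [hu]) hu0
  refine ⟨u, hub, fun T hT => ?_⟩
  obtain ⟨y₁, y₂, T₀, rfl, hy₁, hy₂⟩ := exists_two hx1 hb he hT
  obtain ⟨v, hv, hvk, hv1⟩ := L.sub_k (u := u) (x := y₁ * y₂) fun j => by
    have := L.two_le_of_mul hy₁.ne_one (L.ne_one_of_atom hy₂) j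
    rw [hu]
    omega
  -- In rank at least two the cofactor of `u` has length at most 2. In rank one both `y₁` and `y₂`
  -- have exponent 1, so it is an atom.
  obtain ⟨T', hT', hc⟩ : ∃ T, LFact χ T v ∧ Multiset.card T ≤ 2 := by
    by_cases hJ : ∃ j, j ≠ j₀
    · obtain ⟨j, hj⟩ := hJ
      exact L.short_of_nontrivial hnt hj hv1
    · push Not at hJ
      obtain ⟨i, hi⟩ := L.exists_one_of_atom hnt (Or.inl hy₁)
      obtain ⟨j, hj⟩ := L.exists_one_of_atom hnt hy₂
      rw [hJ i] at hi
      rw [hJ j] at hj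
      refine ⟨{v}, lFact_singleton (L.atom_of_one (j := j₀) ?_), by simp⟩
      rw [hvk, L.k_mul, hi, hj, hu]
  exact L.exists_replacement hub hT (v := v) (by simpa using hv) hT' (by simp) (by omega)

theorem gadget_of_nontrivial : Gadget χ 2 := by
  obtain ⟨o⟩ := L.nonempty
  obtain ⟨y, hy, hy1⟩ := hnt (fun _ => 1) (fun _ => le_rfl) 1
  obtain ⟨z, hz, hz0⟩ := hnt (fun _ => 1) (fun _ => le_rfl) 0
  obtain ⟨z', hzz, -, -⟩ := L.sub_k (u := z) (x := y * y) fun j => by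
    rw [hz, L.k_mul, hy]
    omega
  exact L.gadget_two (hy o) (hy o) hy1 hy1 hzz (hz o) hz0

end NontrivialUnits

/-! ### Units of trivial class, rank at least two -/

section TrivialUnits

-- `E` is the set of indices whose prime has class `e`; with units of trivial class, it determines
-- `χ`.
variable {E : Finset J} (hχ : ∀ x, χ x = ∑ j ∈ E, (k x j : ZMod 2))
include hχ

omit [CancelCommMonoid D] L in
theorem chi_of_one {y : D} (h : ∀ j ∈ E, k y j = 1) : χ y = (E.card : ZMod 2) := by
  rw [hχ, Finset.sum_congr rfl fun j hj => by rw [h j hj]]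
  simp

omit [CancelCommMonoid D] L in
theorem chi_of_add_ite [DecidableEq J] {y : D} {j : J} (hj : j ∈ E) {m : ℕ}
    (h : ∀ i, k y i = 1 + if i = j then m else 0) : χ y = (E.card : ZMod 2) + m := by
  rw [hχ, Finset.sum_congr rfl fun i _ => by rw [h i]]
  push_cast
  rw [Finset.sum_add_distrib, Finset.sum_ite_eq', if_pos hj]
  simp

/-- Any proper factor has exponent 1 at every index of `E`, hence the class of `|E|`, which is odd.
Such atoms need not have an exponent 1 anywhere. -/
theorem bAtom_of_two (hE : (E.card : ZMod 2) = 1) {v : D} (h : ∀ j ∈ E, k v j = 2) :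
    BAtom χ v := by
  obtain ⟨j, hj⟩ : E.Nonempty := by
    rw [← Finset.card_pos]
    rcases Nat.eq_zero_or_pos E.card with h0 | h0
    · rw [h0] at hE; exact absurd hE (by decide)
    · exact h0
  refine ⟨?_, L.ne_one_of_pos (j := j) (by rw [h j hj]; norm_num), ?_⟩
  · rw [hχ]
    exact Finset.sum_eq_zero fun j hj => by rw [h j hj]; rfl
  · rintro a b rfl ha
    by_contra! hcon
    have : ∀ j ∈ E, k a j = 1 := fun j hj => by
      have h1 := L.pos a hcon.1 j
      have h2 := L.pos b hcon.2 j
      have h3 := h j hj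
      rw [L.k_mul] at h3
      omega
    rw [chi_of_one hχ this, hE] at ha
    exact absurd ha (by decide)

-- The three indices have separate roles: exponent 1 of `y` at `a` and of `y'` at `b` make both
-- factors irreducible, and the free exponent `m` of `y` at `c`, equal to 1 or 2, adjusts the class
-- of `y` to 0. The bound `3 ≤ k v c` leaves room for `m = 2`.
omit hχ in
theorem exists_three {a b c : J} (hab : a ≠ b) (hac : a ≠ c) (hbc : b ≠ c) {v : D}
    (hχ : ∀ x, χ x = ∑ j ∈ E, (k x j : ZMod 2)) (hc : c ∈ E) (h2 : ∀ j, 2 ≤ k v j)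
    (h3 : 3 ≤ k v c) : ∃ T, LFact χ T v ∧ Multiset.card T ≤ 2 := by
  classical
  have hsum : ∀ m : ℕ, ∀ y : D, (∀ j, k y j = if j = c then m else if j = b then k v b - 1 else 1) →
      χ y = (m : ZMod 2) + ∑ j ∈ E.erase c, ((if j = b then k v b - 1 else 1 : ℕ) : ZMod 2) := by
    intro m y hy
    rw [hχ, ← Finset.add_sum_erase E _ hc, hy, if_pos rfl]
    congr 1
    refine Finset.sum_congr rfl fun j hj => ?_
    rw [hy, if_neg (Finset.ne_of_mem_erase hj)]
  obtain ⟨m, hm, hm1, hm2⟩ : ∃ m : ℕ, (m : ZMod 2) +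
      ∑ j ∈ E.erase c, ((if j = b then k v b - 1 else 1 : ℕ) : ZMod 2) = 0 ∧ 1 ≤ m ∧ m ≤ 2 := by
    rcases zmod_two_cases (∑ j ∈ E.erase c, ((if j = b then k v b - 1 else 1 : ℕ) : ZMod 2))
      with h | h
    · exact ⟨2, by rw [h]; rfl, by norm_num, le_rfl⟩
    · exact ⟨1, by rw [h]; rfl, le_rfl, by norm_num⟩
  obtain ⟨y, y', rfl, hy, hy'⟩ := L.split (x := v)
    (a := fun j => if j = c then m else if j = b then k v b - 1 else 1)
    (fun j => by
      have := h2 b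
      split_ifs <;> omega)
    (fun j => by
      have := h2 j
      split_ifs with h h'
      · subst h; omega
      · subst h'; omega
      · omega)
  have hyk := hy
  refine short_two (L.bAtom_of_one (j := a) ?_ ?_) (L.atom_of_one (j := b) ?_)
  · rw [hyk, if_neg hac, if_neg hab]
  · rw [hsum m y hyk, hm]
  · have := h2 b
    rw [hy', if_neg hbc, if_pos rfl]
    omega

/-- Beyond the easy case of an exponent 1 and the case delegated to `hbig`, all exponents on `E`
equal 2. If `|E|` is odd, `v` is itself an atom. If `|E|` is even, splitting `v` with exponent 1 at
`a` on one side and at `b` on the other gives the first factor exponent 1 on all of `E`, hence class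
0. -/
theorem short_of_trivial {a b : J} (hab : a ≠ b)
    {ρ : ℕ} (hρ : 2 ≤ ρ)
    (hbig : ∀ v, (∀ j, 2 ≤ k v j) → ∀ c ∈ E, 3 ≤ k v c →
      ∃ T, LFact χ T v ∧ Multiset.card T ≤ ρ) {v : D} (hv : v ≠ 1) :
    ∃ T, LFact χ T v ∧ Multiset.card T ≤ ρ := by
  classical
  by_cases h1 : ∃ j, k v j = 1
  · obtain ⟨j, hj⟩ := h1
    exact ⟨{v}, lFact_singleton (L.atom_of_one hj), by rw [Multiset.card_singleton]; omega⟩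
  push Not at h1
  have h2 : ∀ j, 2 ≤ k v j := fun j => by
    have := L.pos v hv j
    have := h1 j
    omega
  by_cases hc : ∃ c ∈ E, 3 ≤ k v c
  · obtain ⟨c, hcE, hc⟩ := hc
    exact hbig v h2 c hcE hc
  push Not at hc
  have hE2 : ∀ j ∈ E, k v j = 2 := fun j hj => by
    have := h2 j
    have := hc j hj
    omega
  rcases zmod_two_cases (E.card : ZMod 2) with hE | hE
  · obtain ⟨y, y', rfl, hy, hy'⟩ := L.split (x := v)
      (a := fun j => if j = b then k v b - 1 else 1)
      (fun j => by
        have := h2 b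
        split_ifs <;> omega)
      (fun j => by
        have := h2 j
        split_ifs with h
        · subst h; omega
        · omega)
    have hyk := hy
    obtain ⟨T, hT, hTc⟩ := short_two (L.bAtom_of_one (j := a) (y := y) (by rw [hyk, if_neg hab]) (by
        rw [chi_of_one hχ (fun j hj => ?_), hE]
        rw [hyk]
        split_ifs with h
        · subst h; rw [hE2 j hj]
        · rfl))
      (L.atom_of_one (j := b) (y := y') (by
        have := h2 b
        rw [hy', if_pos rfl]
        omega))
    exact ⟨T, hT, hTc.trans hρ⟩
  · exact ⟨{v}, lFact_singleton (Or.inl (L.bAtom_of_two hχ hE hE2)), by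
      rw [Multiset.card_singleton]; omega⟩

-- Only the exponent at `c` determines the class. For an even exponent, `y` takes 2 at `c`, an atom
-- by `bAtom_of_two`, and leaves 1 at `o`. For an odd exponent, `y` takes 1 at `o` and leaves 1 at
-- `c`, keeping an even exponent at `c`.
omit hχ in
theorem short_of_rank_two_left {c o : J} (hJ : ∀ j, j = c ∨ j = o) (hco : c ≠ o)
    (hχ : ∀ x, χ x = (k x c : ZMod 2)) {v : D} (h2 : ∀ j, 2 ≤ k v j) (h3 : 3 ≤ k v c) :
    ∃ T, LFact χ T v ∧ Multiset.card T ≤ 2 := by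
  classical
  have ho := h2 o
  rcases zmod_two_cases (χ v) with h0 | h0
  · rw [hχ, ZMod.natCast_eq_zero_iff_even] at h0
    obtain ⟨m, hm⟩ := h0
    obtain ⟨y, y', rfl, hy, hy'⟩ := L.split (x := v) (a := fun j => if j = c then 2 else k v o - 1)
      (fun j => by split_ifs <;> omega)
      (fun j => by
        rcases hJ j with rfl | rfl
        · rw [if_pos rfl]; omega
        · rw [if_neg hco.symm]; omega)
    have hyc : k y c = 2 := by rw [hy, if_pos rfl]
    refine short_two (L.bAtom_of_two (E := {c}) (by simpa using hχ) (by simp) ?_)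
      (L.atom_of_one (j := o) ?_)
    · intro j hj
      rw [Finset.mem_singleton.1 hj, hyc]
    · rw [hy', if_neg hco.symm]; omega
  · rw [hχ, ZMod.natCast_eq_one_iff_odd] at h0
    obtain ⟨m, hm⟩ := h0
    obtain ⟨y, y', rfl, hy, hy'⟩ := L.split (x := v) (a := fun j => if j = c then k v c - 1 else 1)
      (fun j => by split_ifs <;> omega)
      (fun j => by
        rcases hJ j with rfl | rfl
        · rw [if_pos rfl]; omega
        · rw [if_neg hco.symm]; omega)
    have hyk := hy
    refine short_two (L.bAtom_of_one (j := o) ?_ ?_) (L.atom_of_one (j := c) ?_)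
    · rw [hyk, if_neg hco.symm]
    · rw [hχ, hyk, if_pos rfl, ZMod.natCast_eq_zero_iff_even]
      exact ⟨m, by omega⟩
    · rw [hy', if_pos rfl]; omega

-- Splitting exponents `(m, n)` as `(1, n - 1)` and `(m - 1, 1)` gives two irreducibles, both of
-- class `e` only if `m` and `n` are both odd. In that case `(1, 1)` is removed first, making both
-- exponents even; this is the source of the bound 3.
omit hχ in
theorem short_of_rank_two_both {c o : J} (hJ : ∀ j, j = c ∨ j = o) (hco : c ≠ o)
    (hχ : ∀ x, χ x = ((k x c + k x o : ℕ) : ZMod 2)) {v : D} (h2 : ∀ j, 2 ≤ k v j) :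
    ∃ T, LFact χ T v ∧ Multiset.card T ≤ 3 := by
  classical
  have key : ∀ {w : D}, (∀ j, 2 ≤ k w j) → (Even (k w c) ∨ Even (k w o)) →
      ∃ T, LFact χ T w ∧ Multiset.card T ≤ 2 := by
    intro w h2 hev
    have hc := h2 c
    have ho := h2 o
    obtain ⟨y, y', rfl, hy, hy'⟩ := L.split (x := w) (a := fun j => if j = c then 1 else k w o - 1)
      (fun j => by split_ifs <;> omega)
      (fun j => by
        rcases hJ j with rfl | rfl
        · rw [if_pos rfl]; omega
        · rw [if_neg hco.symm]; omega)
    have hyc : k y c = 1 := by rw [hy, if_pos rfl]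
    have hyo : k y o = k (y * y') o - 1 := by rw [hy, if_neg hco.symm]
    have hyc' : k y' c = k (y * y') c - 1 := by rw [hy', if_pos rfl]
    have hyo' : k y' o = 1 := by rw [hy', if_neg hco.symm]; omega
    have h1 := L.atom_of_one hyc
    have h1' := L.atom_of_one hyo'
    rcases h1 with h1 | h1
    · exact short_two h1 h1'
    rcases h1' with h1' | h1'
    · rw [mul_comm]
      exact short_two h1' (Or.inr h1)
    exfalso
    have e1 := h1.cls
    have e2 := h1'.cls
    rw [hχ, ZMod.natCast_eq_one_iff_odd] at e1 e2
    obtain ⟨m, hm⟩ := e1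
    obtain ⟨m', hm'⟩ := e2
    rcases hev with ⟨r, hr⟩ | ⟨r, hr⟩ <;> omega
  by_cases hev : Even (k v c) ∨ Even (k v o)
  · obtain ⟨T, hT, hc⟩ := key h2 hev
    exact ⟨T, hT, by omega⟩
  · rw [not_or, Nat.not_even_iff_odd, Nat.not_even_iff_odd] at hev
    obtain ⟨⟨m, hm⟩, ⟨m', hm'⟩⟩ := hev
    have hc := h2 c
    have ho := h2 o
    obtain ⟨y, w, rfl, hy, hw⟩ := L.split (x := v) (a := fun j => 1) (fun _ => le_rfl)
      (fun j => h2 j)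
    have hyk := hy
    obtain ⟨T, hT, hTc⟩ := key (w := w) (fun j => by
      rw [hw]
      rcases hJ j with rfl | rfl <;> omega) (Or.inl ⟨m, by rw [hw]; omega⟩)
    refine ⟨y ::ₘ T, LFact.cons (L.bAtom_of_one (j := c) (hyk c) ?_) hT, by rw [Multiset.card_cons]; omega⟩
    rw [hχ, hyk, hyk]
    rfl

/-- It suffices to find an atom `u` of class 0, depending only on `x`, whose exponents are strictly
below those of a product of at most three atoms of any factorization; the cofactor is short by `hC`.
For `|E|` even, all exponents 1 work with any two atoms. For `|E|` odd, one exponent at some `j ∈ E`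
has to be raised to 2. -/
theorem locB_of_trivial {ρ : ℕ} (hρ : 2 ≤ ρ) {a b : J} (hab : a ≠ b)
    (hC : ∀ v, v ≠ 1 → ∃ T, LFact χ T v ∧ Multiset.card T ≤ ρ) : LocB χ (ρ + 1) := by
  classical
  intro x hx1 hb he
  have hmain : ∀ {u : D}, BAtom χ u → ∀ {T₀ T₁ : Multiset D}, LFact χ (T₀ + T₁) x →
      Multiset.card T₁ ≤ 3 → (∀ j, k u j < k T₁.prod j) →
      ∃ S₀ S₁ S₁', T₀ + T₁ = S₀ + S₁ ∧ LFact χ (S₀ + S₁') x ∧ u ∈ S₁' ∧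
        Multiset.card S₁ ≤ ρ + 1 ∧ Multiset.card S₁' ≤ ρ + 1 := by
    intro u hu T₀ T₁ hT hc hk
    obtain ⟨v, hv, -, hv1⟩ := L.sub_k hk
    obtain ⟨T', hT', hc'⟩ := hC v hv1
    exact L.exists_replacement hu hT hv hT' (by omega) (by omega)
  rcases zmod_two_cases (E.card : ZMod 2) with hE | hE
  · obtain ⟨u, hu⟩ := L.ex (fun _ => 1) fun _ => le_rfl
    have huk := hu
    have hub : BAtom χ u := L.bAtom_of_one (huk a) (by rw [chi_of_one hχ fun j _ => huk j, hE])
    refine ⟨u, hub, fun T hT => ?_⟩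
    obtain ⟨y₁, y₂, T₀, rfl, hy₁, hy₂⟩ := exists_two hx1 hb he hT
    refine hmain hub hT (by simp) fun j => ?_
    have := L.two_le_of_mul hy₁.ne_one (L.ne_one_of_atom hy₂) j
    rw [Multiset.prod_cons, Multiset.prod_singleton, huk]
    omega
  · have hEne : ∃ j, j ∈ E := by
      rcases E.eq_empty_or_nonempty with rfl | h
      · rw [Finset.card_empty] at hE
        exact absurd hE (by decide)
      · exact h
    -- The index `j` must be fixed before a factorization is given; that its exponent is at least 3
    -- is proved once a factorization is available.
    obtain ⟨j, hjE, hj⟩ : ∃ j ∈ E, (∃ i ∈ E, 3 ≤ k x i) → 3 ≤ k x j := by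
      by_cases h : ∃ i ∈ E, 3 ≤ k x i
      · obtain ⟨i, hi, h3⟩ := h
        exact ⟨i, hi, fun _ => h3⟩
      · obtain ⟨j, hj⟩ := hEne
        exact ⟨j, hj, fun h' => absurd h' h⟩
    obtain ⟨o, ho⟩ : ∃ o, o ≠ j := by
      by_cases h : a = j
      · exact ⟨b, fun h' => hab (h.trans h'.symm)⟩
      · exact ⟨a, h⟩
    obtain ⟨u, hu⟩ := L.ex (fun i => 1 + if i = j then 1 else 0) fun _ => Nat.le_add_right _ _
    have huk := hu
    have hub : BAtom χ u := by
      refine L.bAtom_of_one (j := o) (by rw [huk, if_neg ho]) ?_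
      rw [chi_of_add_ite hχ hjE huk, hE]
      decide
    refine ⟨u, hub, fun T hT => ?_⟩
    have hne : ∀ t ∈ T, t ≠ 1 := fun t ht => L.ne_one_of_atom (hT.mem t ht)
    obtain ⟨y₁, y₂, T₀, hTe, hy₁, hy₂⟩ := exists_two hx1 hb he hT
    -- Otherwise the class-0 atom `y₁` would have exponent 1 on all of `E`, and so odd class.
    have h3 : 3 ≤ k x j := by
      apply hj
      by_contra! hcon
      have h1 : ∀ i ∈ E, k y₁ i = 1 := by
        intro i hi
        have hp := hT.prod
        rw [hTe, Multiset.prod_add, Multiset.prod_cons, Multiset.prod_singleton] at hp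
        have hlt := hcon i hi
        rw [← hp, L.k_mul, L.k_mul] at hlt
        have := L.pos y₁ hy₁.ne_one i
        have := L.pos y₂ (L.ne_one_of_atom hy₂) i
        omega
      have := hy₁.cls
      rw [chi_of_one hχ h1, hE] at this
      exact absurd this (by decide)
    by_cases hbig : ∃ y ∈ T, 2 ≤ k y j
    · obtain ⟨y, hy, hyj⟩ := hbig
      obtain ⟨T', rfl⟩ := Multiset.exists_cons_of_mem hy
      have hcard : 2 ≤ Multiset.card (y ::ₘ T') := by rw [hTe]; simp
      obtain ⟨y', hy'⟩ : ∃ y', y' ∈ T' := by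
        rcases Multiset.empty_or_exists_mem T' with rfl | h
        · simp at hcard
        · exact h
      obtain ⟨T'', rfl⟩ := Multiset.exists_cons_of_mem hy'
      have hzz : y ::ₘ y' ::ₘ T'' = T'' + (y ::ₘ {y'}) := by
        rw [Multiset.add_cons, add_comm, Multiset.singleton_add]
      rw [hzz] at hT ⊢
      refine hmain hub hT (by simp) fun i => ?_
      have h1 := L.pos y (hne y (by simp)) i
      have h2 := L.pos y' (hne y' (by simp)) i
      rw [Multiset.prod_cons, Multiset.prod_singleton, huk, L.k_mul]
      split_ifs with h
      · subst h; omega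
      · omega
    -- All atoms have exponent 1 at `j`, so there are at least three of them, and three suffice.
    · push Not at hbig
      have hcard : 3 ≤ Multiset.card T := by
        have : ∀ S : Multiset D, (∀ y ∈ S, k y j < 2) → k S.prod j ≤ Multiset.card S := by
          intro S
          induction S using Multiset.induction with
          | empty => intro _; simp [L.k_one]
          | cons s S ih =>
            intro h
            rw [Multiset.prod_cons, L.k_mul, Multiset.card_cons]
            have := ih fun y hy => h y (Multiset.mem_cons_of_mem hy)
            have := h s (Multiset.mem_cons_self s S)
            omega
        have := this T hbig
        rw [hT.prod] at this
        omega
      obtain ⟨T₁, hle, hT₁⟩ := exists_le_card_eq hcard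
      obtain ⟨T₂, rfl⟩ := Multiset.le_iff_exists_add.1 hle
      rw [add_comm] at hT ⊢
      refine hmain hub hT (by omega) fun i => ?_
      have := L.card_le (T := T₁) (fun t ht => hne t (Multiset.mem_add.2 (Or.inl ht))) i
      rw [huk]
      split_ifs <;> omega

/-- Let `y_m` have exponent `1 + m` at `j` and 1 elsewhere, so that its class is `|E| + m`. The
required two factorizations come from `y₁ * y₁ = y₀ * z` for `|E|` even and from `y₀ * y₂ = y₁ * z`
for `|E|` odd. -/
theorem gadget_of_trivial {j o : J} (hj : j ∈ E) (hjo : o ≠ j) : Gadget χ 2 := by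
  classical
  have hex : ∀ m : ℕ, ∃ y, (∀ i, k y i = 1 + if i = j then m else 0) := fun m => by
    obtain ⟨y, hy⟩ := L.ex (fun i => 1 + if i = j then m else 0) fun _ => Nat.le_add_right _ _
    exact ⟨y, hy⟩
  obtain ⟨y₀, h₀⟩ := hex 0
  obtain ⟨y₁, h₁⟩ := hex 1
  obtain ⟨y₂, h₂⟩ := hex 2
  have c₀ := chi_of_add_ite hχ hj h₀
  have c₁ := chi_of_add_ite hχ hj h₁
  have c₂ := chi_of_add_ite hχ hj h₂
  rcases zmod_two_cases (E.card : ZMod 2) with hE | hE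
  · rw [hE] at c₀ c₁
    obtain ⟨z, hz, -⟩ := L.sub_k (u := y₀) (x := y₁ * y₁) fun i => by
      rw [L.k_mul, h₀, h₁]
      split_ifs <;> omega
    exact L.gadget_two (o := o) (by rw [h₁, if_neg hjo]) (by rw [h₁, if_neg hjo])
      (by rw [c₁]; rfl) (by rw [c₁]; rfl) hz (by rw [h₀, if_neg hjo]) (by rw [c₀]; rfl)
  · rw [hE] at c₀ c₁ c₂
    obtain ⟨z, hz, -⟩ := L.sub_k (u := y₁) (x := y₀ * y₂) fun i => by
      rw [L.k_mul, h₀, h₁, h₂]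
      split_ifs <;> omega
    exact L.gadget_two (o := o) (by rw [h₀, if_neg hjo]) (by rw [h₂, if_neg hjo])
      (by rw [c₀]; rfl) (by rw [c₂]; rfl) hz (by rw [h₁, if_neg hjo]) (by rw [c₁]; rfl)

-- The element is `(1, 2) * (2, 1)`, with exponents `(3, 3)`, which also equals a product of three
-- elements with exponents `(1, 1)`. An atom of class 0 has an exponent 1, since otherwise `(1, 1)`
-- splits off; so length 1 is impossible. Two factors of class 0 would have exponents `(1, 1)` and
-- `(2, 2)`, the latter not an atom. More than three factors exceed the exponent.
omit hχ in
theorem gadget_three {c o : J} (hJ : ∀ j, j = c ∨ j = o) (hco : c ≠ o)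
    (hχ : ∀ x, χ x = ((k x c + k x o : ℕ) : ZMod 2)) : Gadget χ 3 := by
  classical
  have hex : ∀ m n : ℕ, 1 ≤ m → 1 ≤ n → ∃ y, k y c = m ∧ k y o = n := fun m n hm hn => by
    obtain ⟨y, hy⟩ := L.ex (fun j => if j = c then m else n) fun j => by
      split_ifs <;> assumption
    exact ⟨y, by rw [hy, if_pos rfl], by rw [hy, if_neg hco.symm]⟩
  have hsub : ∀ x u, k u c < k x c → k u o < k x o → ∃ y, x = u * y := fun x u h h' =>
    L.sub u x fun j => by rcases hJ j with rfl | rfl <;> assumption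
  obtain ⟨y₁, h₁c, h₁o⟩ := hex 1 2 (by norm_num) (by norm_num)
  obtain ⟨y₂, h₂c, h₂o⟩ := hex 2 1 (by norm_num) (by norm_num)
  obtain ⟨u, huc, huo⟩ := hex 1 1 (by norm_num) (by norm_num)
  have hu0 : χ u = 0 := by rw [hχ, huc, huo]; rfl
  have hub := L.bAtom_of_one huc hu0
  have c₁ : χ y₁ = 1 := by rw [hχ, h₁c, h₁o]; rfl
  have c₂ : χ y₂ = 1 := by rw [hχ, h₂c, h₂o]; rfl
  have hxc : k (y₁ * y₂) c = 3 := by rw [L.k_mul, h₁c, h₂c]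
  have hxo : k (y₁ * y₂) o = 3 := by rw [L.k_mul, h₁o, h₂o]
  have hnot : ∀ w, BAtom χ w → ¬ (2 ≤ k w c ∧ 2 ≤ k w o) := by
    rintro w hw ⟨h1, h2⟩
    obtain ⟨v, rfl⟩ := hsub w u (by omega) (by omega)
    rcases hw.irr u v rfl hu0 with h | h
    · exact hub.ne_one h
    · subst h
      rw [mul_one] at h1
      omega
  refine ⟨y₁, y₂, L.eAtom_of_one h₁c c₁, L.eAtom_of_one h₂o c₂, fun y w h hy => ?_,
    fun T hT => ?_, ?_⟩
  · have hw : χ w = 1 := by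
      have := L.chi_mul y w
      rw [← h, L.chi_mul, c₁, c₂, hy.cls] at this
      rcases zmod_two_cases (χ w) with h0 | h0
      · rw [h0] at this; exact absurd this (by decide)
      · exact h0
    have hw1 : w ≠ 1 := by
      rintro rfl
      rw [chi_one L.chi_mul] at hw
      exact absurd hw (by decide)
    have hy1 := hy.ne_one L.chi_mul
    have a1 := L.pos y hy1 c
    have a2 := L.pos y hy1 o
    have a3 := L.pos w hw1 c
    have a4 := L.pos w hw1 o
    rw [h, L.k_mul] at hxc hxo
    have hodd := hw
    rw [hχ, ZMod.natCast_eq_one_iff_odd] at hodd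
    obtain ⟨m, hm⟩ := hodd
    by_cases h1 : k w c = 1
    · exact L.eAtom_of_one h1 hw
    · exact L.eAtom_of_one (j := o) (by omega) hw
  · have hle := L.card_le (fun t ht => (hT.mem t ht).ne_one) c
    rw [hT.prod, hxc] at hle
    rcases Multiset.empty_or_exists_mem T with rfl | ⟨t, ht⟩
    · have := hT.prod
      rw [Multiset.prod_zero] at this
      rw [← this, L.k_one] at hxc
      omega
    obtain ⟨T, rfl⟩ := Multiset.exists_cons_of_mem ht
    have hp := hT.prod
    rw [Multiset.prod_cons] at hp
    have htb := hT.mem t ht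
    rcases Multiset.empty_or_exists_mem T with rfl | ⟨t', ht'⟩
    · rw [Multiset.prod_zero, mul_one] at hp
      exact (hnot t htb ⟨by rw [hp, hxc]; norm_num, by rw [hp, hxo]; norm_num⟩).elim
    obtain ⟨T, rfl⟩ := Multiset.exists_cons_of_mem ht'
    have htb' := hT.mem t' (by simp)
    rcases Multiset.empty_or_exists_mem T with rfl | ⟨t'', ht''⟩
    · exfalso
      rw [Multiset.prod_cons, Multiset.prod_zero, mul_one] at hp
      rw [← hp, L.k_mul] at hxc hxo
      have e1 := htb.cls
      rw [hχ, ZMod.natCast_eq_zero_iff_even] at e1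
      obtain ⟨m, hm⟩ := e1
      have a1 := L.pos t htb.ne_one c
      have a2 := L.pos t htb.ne_one o
      have a3 := L.pos t' htb'.ne_one c
      have a4 := L.pos t' htb'.ne_one o
      by_cases h : 2 ≤ k t c ∧ 2 ≤ k t o
      · exact hnot t htb h
      · refine hnot t' htb' ⟨?_, ?_⟩ <;> omega
    · obtain ⟨T, rfl⟩ := Multiset.exists_cons_of_mem ht''
      simp only [Multiset.card_cons] at hle ⊢
      omega
  · obtain ⟨v, hv⟩ := hsub (y₁ * y₂) u (by omega) (by omega)
    have hvc : k v c = 2 := by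
      rw [hv, L.k_mul] at hxc; omega
    have hvo : k v o = 2 := by
      rw [hv, L.k_mul] at hxo; omega
    obtain ⟨w, rfl⟩ := hsub v u (by omega) (by omega)
    rw [L.k_mul] at hvc hvo
    have hwb : BAtom χ w := L.bAtom_of_one (j := c) (by omega) (by
      rw [hχ, (by omega : k w c = 1), (by omega : k w o = 1)]; rfl)
    refine ⟨u ::ₘ u ::ₘ {w}, fun t ht => ?_, by simp [hv]⟩
    simp only [Multiset.mem_cons, Multiset.mem_singleton] at ht
    rcases ht with rfl | rfl | rfl <;> assumption

omit hχ in
/-- If all classes are trivial and the rank is at least two, there are factorizations of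
consecutive lengths. -/
theorem exists_consecutive {a b : J} (hab : a ≠ b) (hχ : ∀ x, χ x = 0) :
    ∃ T T' x, BFact χ T x ∧ BFact χ T' x ∧ Multiset.card T' = Multiset.card T + 1 := by
  classical
  -- With all exponents 3, `x` splits into three elements with all exponents 1, and also into two
  -- atoms, one having exponent 1 at `a` and the other at `b`.
  obtain ⟨x, hx⟩ := L.ex (fun _ => 3) fun _ => by norm_num
  have hxk := hx
  obtain ⟨y, y', hyy, hy, hy'⟩ := L.split (x := x) (a := fun j => if j = a then 1 else 2)
    (fun j => by split_ifs <;> norm_num)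
    (fun j => by rw [hxk]; split_ifs <;> norm_num)
  obtain ⟨u, v, huv, hu, hv⟩ := L.split (x := x) (a := fun j => 1) (fun _ => le_rfl)
    (fun j => by rw [hxk]; norm_num)
  have huk := hu
  obtain ⟨w, hvw, hw, -⟩ := L.sub_k (u := u) (x := v) fun j => by
    rw [huk, hv, hxk]; norm_num
  have hyb := L.bAtom_of_one (j := a) (y := y) (by rw [hy, if_pos rfl]) (hχ y)
  have hyb' := L.bAtom_of_one (j := b) (y := y') (by rw [hy', if_neg hab.symm, hxk]) (hχ y')
  have hub := L.bAtom_of_one (huk a) (hχ u)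
  have hwb := L.bAtom_of_one (j := a) (y := w) (by rw [hw, hv, huk, hxk]) (hχ w)
  refine ⟨y ::ₘ {y'}, u ::ₘ u ::ₘ {w}, x, ⟨fun t ht => ?_, by simp [hyy]⟩,
    ⟨fun t ht => ?_, by rw [huv, hvw]; simp⟩, by simp⟩
  · simp only [Multiset.mem_cons, Multiset.mem_singleton] at ht
    rcases ht with rfl | rfl <;> assumption
  · simp only [Multiset.mem_cons, Multiset.mem_singleton] at ht
    rcases ht with rfl | rfl | rfl <;> assumption

end TrivialUnits

end LocalData

end WeaklyKrull


namespace WeaklyKrull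

open scoped Pointwise

/-! ## Localizations at minimal primes -/

section Localization

variable {Q : Type*} [CommGroup Q] {H : Submonoid Q}

/-- The group of units of a submonoid, as a subgroup of the ambient group. -/
def unitGroup (D : Submonoid Q) : Subgroup Q where
  carrier := {u | IsUnitOf D u}
  one_mem' := ⟨D.one_mem, by rw [inv_one]; exact D.one_mem⟩
  mul_mem' := fun {a b} ha hb =>
    ⟨D.mul_mem ha.1 hb.1, by rw [mul_inv]; exact D.mul_mem ha.2 hb.2⟩
  inv_mem' := fun {a} ha => ⟨ha.2, by rw [inv_inv]; exact ha.1⟩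

/-- The group of units of the localization `H_p`. -/
abbrev locUnits (p : MinPrime H) : Subgroup Q := unitGroup (localization H p)

theorem le_localization (p : MinPrime H) : H ≤ localization H p := fun x hx =>
  ⟨1, H.one_mem, p.2.1.1.one_notMem, by rwa [one_mul]⟩

theorem mem_locUnits_of_notMem {p : MinPrime H} {s : Q} (hs : s ∈ H) (hsp : s ∉ p.1) :
    s ∈ locUnits p :=
  ⟨le_localization p hs, s, hs, hsp, by rw [mul_inv_cancel]; exact H.one_mem⟩

theorem notMem_of_mem_locUnits {p : MinPrime H} {x : Q} (hx : x ∈ locUnits p) : x ∉ p.1 := by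
  intro hxp
  obtain ⟨s, -, hsp, hsx⟩ := hx.2
  apply hsp
  have := p.2.1.1.mul_mem x hxp _ hsx
  rwa [mul_comm, inv_mul_cancel_right] at this

theorem eq_of_subset {p p' : MinPrime H} (h : p.1 ⊆ p'.1) : p = p' :=
  Subtype.ext (Set.Subset.antisymm h (p'.2.2 p.2.1 h))

/-- `H_p` is a primary monoid. -/
theorem exists_pow_mul_eq (p : MinPrime H) {t b : Q} (ht : t ∈ p.1) (hb : b ∈ H) :
    ∃ n : ℕ, ∃ u ∈ H, u ∉ p.1 ∧ ∃ h ∈ H, b * h = u * t ^ n := by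
  by_contra hcon
  -- `S` is the set of divisors of elements `u * t ^ n`. Its complement in `H` is a prime `s`-ideal
  -- inside `p`; if it contained `b`, minimality would make it equal to `p`, although it omits `t`.
  let S : Set Q := {x | ∃ n : ℕ, ∃ u ∈ H, u ∉ p.1 ∧ ∃ h ∈ H, x * h = u * t ^ n}
  have hprime : IsPrimeSIdeal H ((H : Set Q) \ S) := by
    refine ⟨Set.sdiff_subset, ?_, ?_, ?_⟩
    · rintro a ⟨ha, haS⟩ c hc
      refine ⟨H.mul_mem ha hc, fun h => haS ?_⟩
      obtain ⟨n, u, hu, hup, h, hh, he⟩ := h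
      exact ⟨n, u, hu, hup, c * h, H.mul_mem hc hh, by rw [← mul_assoc, he]⟩
    · exact fun h => h.2 ⟨0, 1, H.one_mem, p.2.1.1.one_notMem, 1, H.one_mem, by simp⟩
    · rintro a ha c hc ⟨-, hac⟩
      by_contra! hcon
      have h1 : a ∈ S := by
        by_contra h
        exact hcon.1 ⟨ha, h⟩
      have h2 : c ∈ S := by
        by_contra h
        exact hcon.2 ⟨hc, h⟩
      obtain ⟨n, u, hu, hup, h, hh, he⟩ := h1
      obtain ⟨n', u', hu', hup', h', hh', he'⟩ := h2
      refine hac ⟨n + n', u * u', H.mul_mem hu hu', fun h => ?_, h * h', H.mul_mem hh hh', ?_⟩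
      · exact (p.2.1.1.mem_or_mem u hu u' hu' h).elim hup hup'
      · rw [mul_mul_mul_comm, he, he', pow_add, mul_mul_mul_comm]
  have hsub : (H : Set Q) \ S ⊆ p.1 := by
    rintro x ⟨hx, hxS⟩
    by_contra hxp
    exact hxS ⟨0, x, hx, hxp, 1, H.one_mem, by simp⟩
  have := p.2.2 ⟨hprime, ⟨b, hb, hcon⟩⟩ hsub ht
  exact this.2 ⟨1, 1, H.one_mem, p.2.1.1.one_notMem, 1, H.one_mem, by simp⟩

variable (hQ : IsQuotientGroup H)
include hQ

theorem exists_pow_mul_mem (p : MinPrime H) {t : Q} (ht : t ∈ p.1) (z : Q) :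
    ∃ n : ℕ, t ^ n * z ∈ localization H p := by
  obtain ⟨a, ha, b, hb, rfl⟩ := hQ z
  obtain ⟨n, u, hu, hup, h, hh, he⟩ := exists_pow_mul_eq p ht hb
  refine ⟨n, u, hu, hup, ?_⟩
  have : u * (t ^ n * (a * b⁻¹)) = h * a := by
    rw [← mul_assoc, ← he, mul_comm b h, mul_assoc, mul_comm a, mul_inv_cancel_left]
  rw [this]
  exact H.mul_mem hh ha

/-- Distinct minimal primes are incomparable, so each `p₀ ≠ p` contains some `t` outside `p`. A
power of `t` clears the denominator at `p₀` and is a unit at `p`. -/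
theorem exists_mul_mem_of_finset (p : MinPrime H) (S : Finset (MinPrime H)) (z : MinPrime H → Q) :
    ∃ u ∈ H, u ∉ p.1 ∧ ∀ p' ∈ S, p' ≠ p → u * z p' ∈ localization H p' := by
  classical
  induction S using Finset.induction_on with
  | empty => exact ⟨1, H.one_mem, p.2.1.1.one_notMem, by simp⟩
  | insert p₀ S _ ih =>
    obtain ⟨u, hu, hup, h⟩ := ih
    by_cases hp : p₀ = p
    · refine ⟨u, hu, hup, fun p' hp' hne => ?_⟩
      rcases Finset.mem_insert.1 hp' with rfl | hp'
      · exact absurd hp hne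
      · exact h p' hp' hne
    · obtain ⟨t, ht, htp⟩ := Set.not_subset.1 fun hsub => hp (eq_of_subset (p := p₀) (p' := p) hsub)
      have htH := p₀.2.1.1.subset ht
      obtain ⟨n, hn⟩ := exists_pow_mul_mem hQ p₀ ht (z p₀)
      have htn : t ^ n ∉ p.1 := notMem_of_mem_locUnits
        ((locUnits p).pow_mem (mem_locUnits_of_notMem htH htp) n)
      refine ⟨u * t ^ n, H.mul_mem hu (H.pow_mem htH n), fun h' => ?_, fun p' hp' hne => ?_⟩
      · exact (p.2.1.1.mem_or_mem u hu _ (H.pow_mem htH n) h').elim hup htn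
      · rcases Finset.mem_insert.1 hp' with rfl | hp'
        · rw [mul_assoc]
          exact Submonoid.mul_mem _ (le_localization _ hu) hn
        · rw [mul_right_comm]
          exact Submonoid.mul_mem _ (h p' hp' hne) (le_localization _ (H.pow_mem htH n))

variable (hwk : IsWeaklyKrull H)
include hwk

omit hQ in
theorem mem_iff_forall_localization {x : Q} : x ∈ H ↔ ∀ p : MinPrime H, x ∈ localization H p := by
  have : x ∈ (H : Set Q) ↔ x ∈ ⋂ p : MinPrime H, (localization H p : Set Q) := by rw [← hwk.1]
  rw [Set.mem_iInter] at this
  exact this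

theorem finite_notMem_locUnits (x : Q) : {p : MinPrime H | x ∉ locUnits p}.Finite := by
  obtain ⟨a, ha, b, hb, rfl⟩ := hQ x
  refine ((hwk.2 a ha).union (hwk.2 b hb)).subset fun p hp => ?_
  by_contra hcon
  rw [Set.mem_union, not_or] at hcon
  exact hp ((locUnits p).mul_mem (mem_locUnits_of_notMem ha hcon.1)
    ((locUnits p).inv_mem (mem_locUnits_of_notMem hb hcon.2)))

/-- Approximation: a local element at `p` can be multiplied by a unit of `H_p` such that the
result satisfies given divisibility conditions at all other primes. -/
theorem exists_approx {x : MinPrime H → Q} (hx : {p | x p ∉ locUnits p}.Finite) (p : MinPrime H) :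
    ∃ y, (x p)⁻¹ * y ∈ locUnits p ∧ ∀ p', (x p')⁻¹ * y ∈ localization H p' := by
  classical
  obtain ⟨u, hu, hup, h⟩ := exists_mul_mem_of_finset hQ p
    (hx.union (finite_notMem_locUnits hQ hwk (x p))).toFinset fun p' => (x p')⁻¹ * x p
  have hup' : (x p)⁻¹ * (u * x p) ∈ locUnits p := by
    rw [mul_comm u, inv_mul_cancel_left]
    exact mem_locUnits_of_notMem hu hup
  refine ⟨u * x p, hup', fun p' => ?_⟩
  rcases eq_or_ne p' p with rfl | hne
  · exact hup'.1
  rw [mul_left_comm]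
  by_cases hmem : p' ∈ (hx.union (finite_notMem_locUnits hQ hwk (x p))).toFinset
  · exact h p' hmem hne
  · rw [Set.Finite.mem_toFinset, Set.mem_union, not_or] at hmem
    have h1 : x p' ∈ locUnits p' := not_not.1 hmem.1
    have h2 : x p ∈ locUnits p' := not_not.1 hmem.2
    exact Submonoid.mul_mem _ (le_localization p' hu) (Submonoid.mul_mem _ h1.2 h2.1)

/-! ## Ideals given by local data -/

omit hQ hwk in
/-- The fractional ideal with prescribed localizations `x_p H_p`. -/
def famIdeal (x : MinPrime H → Q) : Set Q := {y | ∀ p, (x p)⁻¹ * y ∈ localization H p}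

/-- The families of local elements almost all of which are units. -/
def admissible : Subgroup (MinPrime H → Q) where
  carrier := {x | {p | x p ∉ locUnits p}.Finite}
  one_mem' := finite_notMem_locUnits hQ hwk 1
  mul_mem' := fun {a b} ha hb => by
    refine (Set.Finite.union ha hb).subset fun p hp => ?_
    by_contra hcon
    rw [Set.mem_union, not_or] at hcon
    exact hp ((locUnits p).mul_mem (not_not.1 hcon.1) (not_not.1 hcon.2))
  inv_mem' := fun {a} ha => by
    refine Set.Finite.subset ha fun p hp hcon => hp ((locUnits p).inv_mem hcon)

/-- At each `p` the ideals contain elements that generate their localizations there, by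
`exists_approx`; testing `c` against these products determines `c` locally. All further ideal
arithmetic follows from this computation. -/
theorem colon_famIdeal_mul {x y : MinPrime H → Q} (hx : x ∈ admissible hQ hwk)
    (hy : y ∈ admissible hQ hwk) :
    colon (H : Set Q) (famIdeal x * famIdeal y) = famIdeal (x * y)⁻¹ := by
  ext c
  constructor
  · intro hc p
    obtain ⟨a, ha, ha'⟩ := exists_approx hQ hwk hx p
    obtain ⟨b, hb, hb'⟩ := exists_approx hQ hwk hy p
    have h1 := le_localization p (hc (a * b) ⟨a, ha', b, hb', rfl⟩)
    have h2 := Submonoid.mul_mem _ h1 (Submonoid.mul_mem _ ha.2 hb.2)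
    convert h2 using 1
    simp only [Pi.inv_apply, Pi.mul_apply, inv_inv, mul_inv]
    apply mul_left_cancel (a := a * b)
    rw [show a * b * (c * (a * b) * (x p * a⁻¹ * (y p * b⁻¹))) =
      (c * (a * b) * (x p * y p)) * ((a * a⁻¹) * (b * b⁻¹)) by ac_rfl]
    rw [mul_inv_cancel, mul_inv_cancel, mul_one, mul_one]
    ac_rfl
  · rintro hc _ ⟨a, ha, b, hb, rfl⟩
    change c * (a * b) ∈ H
    rw [mem_iff_forall_localization hwk]
    intro p
    have h := Submonoid.mul_mem _ (hc p) (Submonoid.mul_mem _ (ha p) (hb p))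
    convert h using 1
    simp only [Pi.inv_apply, Pi.mul_apply, inv_inv]
    rw [show x p * y p * c * ((x p)⁻¹ * a * ((y p)⁻¹ * b)) =
      ((x p) * (x p)⁻¹) * ((y p) * (y p)⁻¹) * (c * (a * b)) by ac_rfl]
    rw [mul_inv_cancel, mul_inv_cancel, one_mul, one_mul]

omit hQ in
theorem famIdeal_one : famIdeal (1 : MinPrime H → Q) = (H : Set Q) := by
  ext y
  change (∀ p, (1 : Q)⁻¹ * y ∈ localization H p) ↔ y ∈ H
  rw [mem_iff_forall_localization hwk]
  simp

theorem colon_famIdeal {x : MinPrime H → Q} (hx : x ∈ admissible hQ hwk) :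
    colon (H : Set Q) (famIdeal x) = famIdeal x⁻¹ := by
  have := colon_famIdeal_mul hQ hwk hx (admissible hQ hwk).one_mem
  rw [mul_one] at this
  rw [← this]
  ext c
  rw [famIdeal_one hwk]
  constructor
  · rintro hc _ ⟨a, ha, b, hb, rfl⟩
    have := H.mul_mem (hc a ha) hb
    rwa [mul_assoc] at this
  · intro hc a ha
    have := hc (a * 1) ⟨a, ha, 1, H.one_mem, rfl⟩
    rwa [mul_one] at this

theorem vClosure_famIdeal_mul {x y : MinPrime H → Q} (hx : x ∈ admissible hQ hwk)
    (hy : y ∈ admissible hQ hwk) : vClosure H (famIdeal x * famIdeal y) = famIdeal (x * y) := by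
  rw [vClosure, colon_famIdeal_mul hQ hwk hx hy,
    colon_famIdeal hQ hwk ((admissible hQ hwk).inv_mem ((admissible hQ hwk).mul_mem hx hy)),
    inv_inv]

/-- The `v`-invertible `v`-ideal with prescribed localizations. -/
def idealHom :
    admissible hQ hwk →* InvVIdeal H where
  toFun x :=
    { carrier := famIdeal x.1
      vClosure_eq := by
        rw [vClosure, colon_famIdeal hQ hwk x.2,
          colon_famIdeal hQ hwk ((admissible hQ hwk).inv_mem x.2), inv_inv]
      inv_eq := by
        rw [colon_famIdeal hQ hwk x.2,
          vClosure_famIdeal_mul hQ hwk x.2 ((admissible hQ hwk).inv_mem x.2), mul_inv_cancel,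
          famIdeal_one hwk] }
  map_one' := InvVIdeal.ext (famIdeal_one hwk)
  map_mul' x y := InvVIdeal.ext (vClosure_famIdeal_mul hQ hwk x.2 y.2).symm

omit hQ hwk in
theorem famIdeal_subset {x y : MinPrime H → Q} (h : ∀ p, (y p)⁻¹ * x p ∈ localization H p) :
    famIdeal x ⊆ famIdeal y := fun z hz p => by
  have := Submonoid.mul_mem _ (h p) (hz p)
  rwa [mul_assoc, mul_inv_cancel_left] at this

theorem mul_mem_of_famIdeal_subset {x y : MinPrime H → Q} (hx : x ∈ admissible hQ hwk)
    (h : famIdeal x ⊆ famIdeal y) (p : MinPrime H) : (y p)⁻¹ * x p ∈ localization H p := by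
  obtain ⟨z, hz, hz'⟩ := exists_approx hQ hwk hx p
  have := Submonoid.mul_mem _ (h hz' p) hz.2
  rwa [mul_inv, inv_inv, mul_comm (x p), mul_assoc, mul_inv_cancel_left] at this

theorem const_mem_admissible (a : Q) : (fun _ => a) ∈ admissible hQ hwk :=
  finite_notMem_locUnits hQ hwk a

theorem idealHom_const (a : Q) :
    idealHom hQ hwk ⟨fun _ => a, const_mem_admissible hQ hwk a⟩ = principal H a := by
  apply InvVIdeal.ext
  change famIdeal (fun _ => a) = a • (H : Set Q)
  ext y
  rw [Set.mem_smul_set_iff_inv_smul_mem, smul_eq_mul]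
  exact (mem_iff_forall_localization hwk).symm

/-- Principal ideals come from constant families, and a family is recovered from its ideal up to
local units. -/
theorem mk_idealHom_eq_one_iff (x : admissible hQ hwk) :
    (QuotientGroup.mk (idealHom hQ hwk x) : VClassGroup H) = 1 ↔
      ∃ a : Q, ∀ p, (x.1 p)⁻¹ * a ∈ locUnits p := by
  rw [QuotientGroup.eq_one_iff]
  constructor
  · rintro ⟨a, ha⟩
    rw [← idealHom_const hQ hwk] at ha
    have h : famIdeal (fun _ => a) = famIdeal x.1 := congrArg InvVIdeal.carrier ha
    refine ⟨a, fun p => ⟨mul_mem_of_famIdeal_subset hQ hwk (const_mem_admissible hQ hwk a)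
      h.subset p, ?_⟩⟩
    rw [mul_inv, inv_inv, mul_comm]
    exact mul_mem_of_famIdeal_subset hQ hwk x.2 h.symm.subset p
  · rintro ⟨a, ha⟩
    refine ⟨a, ?_⟩
    rw [← idealHom_const hQ hwk]
    apply InvVIdeal.ext
    refine Set.Subset.antisymm (famIdeal_subset fun p => (ha p).1) (famIdeal_subset fun p => ?_)
    have := (ha p).2
    rwa [mul_inv, inv_inv, mul_comm] at this

open Classical in
theorem mulSingle_mem_admissible (p : MinPrime H) (x : Q) :
    (Pi.mulSingle p x : MinPrime H → Q) ∈ admissible hQ hwk := by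
  refine (Set.finite_singleton p).subset fun p' hp' => ?_
  by_contra hne
  apply hp'
  rw [Pi.mulSingle_eq_of_ne (by simpa using hne)]
  exact (locUnits p').one_mem

open Classical in
/-- The class of the `v`-ideal which is `x H_p` at `p` and trivial at all other primes. -/
noncomputable def localClass (p : MinPrime H) :
    Q →* VClassGroup H where
  toFun x := QuotientGroup.mk (idealHom hQ hwk ⟨_, mulSingle_mem_admissible hQ hwk p x⟩)
  map_one' := by
    rw [mk_idealHom_eq_one_iff]
    refine ⟨1, fun p' => ?_⟩
    change ((Pi.mulSingle p (1 : Q) : MinPrime H → Q) p')⁻¹ * 1 ∈ locUnits p'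
    rw [Pi.mulSingle_one]
    simp [(locUnits p').one_mem]
  map_mul' x y := by
    rw [← QuotientGroup.mk_mul, ← map_mul]
    congr 2
    exact Subtype.ext (Pi.mulSingle_mul (f := fun _ : MinPrime H => Q) p x y)

open Classical in
theorem hasLocalClass_iff {p : MinPrime H} {x : Q} {g : VClassGroup H} :
    HasLocalClass H p x g ↔ localClass hQ hwk p x = g := by
  have hset : ((x • (localization H p : Set Q)) ∩
      ⋂ p' : {p' : MinPrime H // p' ≠ p}, (localization H p'.1 : Set Q)) =
      famIdeal (Pi.mulSingle p x) := by
    ext y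
    rw [Set.mem_inter_iff, Set.mem_iInter, Set.mem_smul_set_iff_inv_smul_mem, smul_eq_mul]
    constructor
    · rintro ⟨h1, h2⟩ p'
      rcases eq_or_ne p' p with rfl | hne
      · rw [Pi.mulSingle_eq_same]; exact h1
      · rw [Pi.mulSingle_eq_of_ne hne, inv_one, one_mul]; exact h2 ⟨p', hne⟩
    · intro h
      refine ⟨?_, fun p' => ?_⟩
      · have := h p
        rwa [Pi.mulSingle_eq_same] at this
      · have := h p'.1
        rwa [Pi.mulSingle_eq_of_ne p'.2, inv_one, one_mul] at this
  unfold HasLocalClass HasClass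
  rw [hset]
  constructor
  · rintro ⟨I, hI, rfl⟩
    change QuotientGroup.mk _ = QuotientGroup.mk _
    congr 1
    exact InvVIdeal.ext hI.symm
  · rintro rfl
    exact ⟨_, rfl, rfl⟩

theorem localClass_of_mem_locUnits {p : MinPrime H} {u : Q} (hu : u ∈ locUnits p) :
    localClass hQ hwk p u = 1 := by
  classical
  change QuotientGroup.mk _ = _
  rw [mk_idealHom_eq_one_iff]
  refine ⟨1, fun p' => ?_⟩
  rw [mul_one]
  apply (locUnits p').inv_mem
  rcases eq_or_ne p' p with rfl | hne
  · simpa using hu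
  · simp [Pi.mulSingle_eq_of_ne hne, (locUnits p').one_mem]

theorem localClass_eq_one_iff {p : MinPrime H} {x : Q} : localClass hQ hwk p x = 1 ↔
    ∃ a : Q, x⁻¹ * a ∈ locUnits p ∧ ∀ p', p' ≠ p → a ∈ locUnits p' := by
  classical
  change QuotientGroup.mk _ = _ ↔ _
  rw [mk_idealHom_eq_one_iff]
  refine exists_congr fun a => ⟨fun h => ⟨?_, fun p' hne => ?_⟩, fun h p' => ?_⟩
  · simpa using h p
  · have := h p'
    simp only [Pi.mulSingle_eq_of_ne hne, inv_one, one_mul] at this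
    exact this
  · rcases eq_or_ne p' p with rfl | hne
    · simpa using h.1
    · simp only [Pi.mulSingle_eq_of_ne hne, inv_one, one_mul]
      exact h.2 p' hne

theorem exists_of_localClass_mul_eq_one {p p' : MinPrime H} (hpp : p ≠ p') {x x' : Q}
    (h : localClass hQ hwk p x * localClass hQ hwk p' x' = 1) :
    ∃ a : Q, x⁻¹ * a ∈ locUnits p ∧ x'⁻¹ * a ∈ locUnits p' ∧
      ∀ p'', p'' ≠ p → p'' ≠ p' → a ∈ locUnits p'' := by
  classical
  change QuotientGroup.mk _ * QuotientGroup.mk _ = _ at h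
  rw [← QuotientGroup.mk_mul, ← map_mul, mk_idealHom_eq_one_iff] at h
  obtain ⟨a, ha⟩ := h
  refine ⟨a, ?_, ?_, fun p'' h1 h2 => ?_⟩
  · have := ha p
    simpa [Pi.mulSingle_eq_of_ne hpp] using this
  · have := ha p'
    simpa [Pi.mulSingle_eq_of_ne hpp.symm] using this
  · have := ha p''
    simpa [Pi.mulSingle_eq_of_ne h1, Pi.mulSingle_eq_of_ne h2] using this

end Localization

end WeaklyKrull


namespace WeaklyKrull

open scoped Pointwise

/-! ## Factorial monoids with finitely many primes -/

section PrimeBasis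

variable {Q : Type*} [CommGroup Q] {F : Submonoid Q} {n : ℕ} {q : Fin n → Q}

open Classical in
/-- The exponents of an element of a factorial monoid with prime basis `q`. -/
noncomputable def ord (F : Submonoid Q) (q : Fin n → Q) (x : Q) : Fin n → ℕ :=
  if h : ∃ k : Fin n → ℕ, ∃ u, IsUnitOf F u ∧ x = u * ∏ i, q i ^ k i then h.choose else 0

namespace IsPrimeBasis

variable (hb : IsPrimeBasis F q)
include hb

theorem ord_spec {x : Q} (hx : x ∈ F) : ∃ u, IsUnitOf F u ∧ x = u * ∏ i, q i ^ ord F q x i := by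
  have h := (hb.2 x hx).exists
  rw [ord, dif_pos h]
  exact h.choose_spec

theorem prod_mem (k : Fin n → ℕ) : ∏ i, q i ^ k i ∈ F :=
  Submonoid.prod_mem _ fun i _ => F.pow_mem (hb.1 i) _

theorem ord_eq {x u : Q} {k : Fin n → ℕ} (hu : IsUnitOf F u) (h : x = u * ∏ i, q i ^ k i) :
    ord F q x = k :=
  (hb.2 x (h ▸ F.mul_mem hu.1 (hb.prod_mem k))).unique
    (hb.ord_spec (h ▸ F.mul_mem hu.1 (hb.prod_mem k))) ⟨u, hu, h⟩

theorem ord_mul {x y : Q} (hx : x ∈ F) (hy : y ∈ F) (i : Fin n) :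
    ord F q (x * y) i = ord F q x i + ord F q y i := by
  obtain ⟨u, hu, hxu⟩ := hb.ord_spec hx
  obtain ⟨v, hv, hyv⟩ := hb.ord_spec hy
  refine congrFun (hb.ord_eq (k := fun i => ord F q x i + ord F q y i)
    ((unitGroup F).mul_mem hu hv) ?_) i
  simp only [pow_add, Finset.prod_mul_distrib]
  conv_lhs => rw [hxu, hyv]
  exact mul_mul_mul_comm _ _ _ _

theorem ord_unit {u : Q} (hu : IsUnitOf F u) (i : Fin n) : ord F q u i = 0 :=
  congrFun (hb.ord_eq (k := 0) hu (by simp)) i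

theorem ord_prod_pow (k : Fin n → ℕ) (i : Fin n) : ord F q (∏ j, q j ^ k j) i = k i :=
  congrFun (hb.ord_eq (unitGroup F).one_mem (by rw [one_mul])) i

theorem prod_mem' : ∏ j, q j ∈ F := Submonoid.prod_mem _ fun i _ => hb.1 i

theorem ord_prod (i : Fin n) : ord F q (∏ j, q j) i = 1 := by
  simpa using hb.ord_prod_pow (fun _ => 1) i

theorem ord_pow {x : Q} (hx : x ∈ F) (m : ℕ) (i : Fin n) :
    ord F q (x ^ m) i = m * ord F q x i := by
  induction m with
  | zero => simpa using hb.ord_unit (unitGroup F).one_mem i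
  | succ m ih => rw [pow_succ, hb.ord_mul (F.pow_mem hx m) hx, ih]; ring

theorem mul_inv_mem {x y : Q} (hx : x ∈ F) (hy : y ∈ F) (h : ∀ i, ord F q y i ≤ ord F q x i) :
    x * y⁻¹ ∈ F := by
  obtain ⟨u, hu, hxu⟩ := hb.ord_spec hx
  obtain ⟨v, hv, hyv⟩ := hb.ord_spec hy
  have hsplit : ∏ i, q i ^ ord F q x i =
      (∏ i, q i ^ ord F q y i) * ∏ i, q i ^ (ord F q x i - ord F q y i) := by
    rw [← Finset.prod_mul_distrib]
    exact Finset.prod_congr rfl fun i _ => by rw [← pow_add, Nat.add_sub_cancel' (h i)]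
  have this : x * y⁻¹ = u * v⁻¹ * ∏ i, q i ^ (ord F q x i - ord F q y i) := by
    rw [mul_inv_eq_iff_eq_mul]
    generalize (∏ i, q i ^ (ord F q x i - ord F q y i)) = r at *
    generalize (∏ i, q i ^ ord F q y i) = t at *
    rw [hxu, hsplit, hyv, show u * v⁻¹ * r * (v * t) = (v⁻¹ * v) * (u * (t * r)) by ac_rfl,
      inv_mul_cancel, one_mul]
  rw [this]
  exact F.mul_mem (F.mul_mem hu.1 hv.2) (hb.prod_mem _)

theorem exists_eq_prod_mul {x : Q} (hx : x ∈ F) (h : ∀ i, 1 ≤ ord F q x i) :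
    ∃ y ∈ F, x = (∏ i, q i) * y :=
  ⟨_, hb.mul_inv_mem hx hb.prod_mem' fun i => by rw [hb.ord_prod]; exact h i, by
    rw [mul_comm x, mul_inv_cancel_left]⟩

end IsPrimeBasis

/-- The element `c` is a common denominator for all powers of elements of `F`. Conversely, a
negative exponent in `x` would grow without bound along its powers. -/
theorem completeIntegralClosure_eq {D : Submonoid Q} (hQ : IsQuotientGroup D)
    (hb : IsPrimeBasis F q) (hD : D ≤ F) {c : Q} (hc : c ∈ D) (hcF : ∀ y ∈ F, c * y ∈ D) :
    completeIntegralClosure D = F := by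
  apply le_antisymm
  · rintro x ⟨d, hd, hx⟩
    obtain ⟨a, ha, b, hb', rfl⟩ := hQ x
    refine hb.mul_inv_mem (hD ha) (hD hb') fun i => ?_
    by_contra! hlt
    -- With `N = ord d + 1`, a deficit of at least 1 in each factor gives a total deficit of `N`,
    -- more than `d` can compensate.
    have h1 := hD (hx (ord F q d i + 1))
    have h2 : d * a ^ (ord F q d i + 1) =
        d * (a * b⁻¹) ^ (ord F q d i + 1) * b ^ (ord F q d i + 1) := by
      rw [mul_assoc, ← mul_pow, inv_mul_cancel_right]
    have h3 := congrArg (fun z => ord F q z i) h2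
    rw [hb.ord_mul h1 (F.pow_mem (hD hb') _), hb.ord_mul (hD hd) (F.pow_mem (hD ha) _),
      hb.ord_pow (hD ha), hb.ord_pow (hD hb')] at h3
    have h4 : (ord F q d i + 1) * (ord F q a i + 1) ≤ (ord F q d i + 1) * ord F q b i :=
      Nat.mul_le_mul_left _ hlt
    rw [Nat.mul_add] at h4
    omega
  · exact fun x hx => ⟨c, hc, fun m => hcF _ (F.pow_mem hx m)⟩

theorem IsFinitelyPrimary.exists_basis {D : Submonoid Q} (hQ : IsQuotientGroup D) {s : ℕ}
    (h : IsFinitelyPrimary D s) :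
    (∃ q : Fin s → Q, IsPrimeBasis (completeIntegralClosure D) q) ∧
      ∃ c ∈ D, ∀ y ∈ completeIntegralClosure D, c * y ∈ D := by
  obtain ⟨-, F, q, hD, hb, -, α, -, hα⟩ := h
  have hc : (∏ i, q i) ^ α ∈ D := by simpa using hα 1 F.one_mem
  rw [completeIntegralClosure_eq hQ hb hD hc hα]
  exact ⟨⟨q, hb⟩, _, hc, hα⟩

/-- `D` is seminormal and finitely primary, contained in the factorial monoid `F` with
primes `q`. -/
structure LocShape (D F : Submonoid Q) (q : Fin n → Q) : Prop where
  pos : 0 < n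
  le : D ≤ F
  basis : IsPrimeBasis F q
  nonunit : ∀ x ∈ D, x ∉ unitGroup D → ∃ y ∈ F, x = (∏ i, q i) * y
  -- Seminormality permits the first power here, where finitely primary gives only some power `α`.
  absorb : ∀ y ∈ F, (∏ i, q i) * y ∈ D

end PrimeBasis

/-! ## The localizations at minimal primes -/

section Shape

variable {Q : Type*} [CommGroup Q] {H : Submonoid Q} (hQ : IsQuotientGroup H)
  (hwk : IsWeaklyKrull H)
include hQ

theorem isQuotientGroup_localization (p : MinPrime H) : IsQuotientGroup (localization H p) :=
  fun x => by
    obtain ⟨a, ha, b, hb, rfl⟩ := hQ x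
    exact ⟨a, le_localization p ha, b, le_localization p hb, rfl⟩

omit hQ in
theorem le_completeIntegralClosure (D : Submonoid Q) : D ≤ completeIntegralClosure D :=
  fun x hx => ⟨1, D.one_mem, fun n => by rw [one_mul]; exact D.pow_mem hx n⟩

theorem exists_pow_mul_mem_of_nonunit (p : MinPrime H) {x : Q} (hx : x ∈ localization H p)
    (hxu : x ∉ locUnits p) (z : Q) : ∃ n : ℕ, x ^ n * z ∈ localization H p := by
  obtain ⟨s, hs, hsp, hsx⟩ := hx
  have hsu := mem_locUnits_of_notMem hs hsp
  have hsxp : s * x ∈ p.1 := by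
    by_contra h
    have := (locUnits p).mul_mem ((locUnits p).inv_mem hsu) (mem_locUnits_of_notMem hsx h)
    rw [inv_mul_cancel_left] at this
    exact hxu this
  obtain ⟨n, hn⟩ := exists_pow_mul_mem hQ p hsxp z
  refine ⟨n, ?_⟩
  have := Submonoid.mul_mem _ ((locUnits p).pow_mem hsu n).2 hn
  rwa [mul_pow, mul_assoc, inv_mul_cancel_left] at this

include hwk

/-- Every local element at `p` is, up to units of `H_p`, integral at all other primes. -/
theorem exists_unit_mul (p : MinPrime H) (x : Q) :
    ∃ y, x⁻¹ * y ∈ locUnits p ∧ ∀ p', p' ≠ p → y ∈ localization H p' := by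
  classical
  obtain ⟨y, hy, hy'⟩ := exists_approx hQ hwk
    (x := Pi.mulSingle p x) (mulSingle_mem_admissible hQ hwk p x) p
  refine ⟨y, by simpa using hy, fun p' hne => ?_⟩
  have := hy' p'
  rwa [Pi.mulSingle_eq_of_ne hne, inv_one, one_mul] at this

/-- After multiplication by a unit of `H_p`, the element is integral at all other primes, so its
large powers lie in `H` itself. -/
theorem isSeminormal_localization (hsemi : IsSeminormal H) (p : MinPrime H) :
    IsSeminormal (localization H p) := by
  rintro x ⟨N, hN⟩
  obtain ⟨y, hy, hy'⟩ := exists_unit_mul hQ hwk p x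
  have hyH : y ∈ H := by
    refine hsemi y ⟨N, fun m hm => ?_⟩
    rw [mem_iff_forall_localization hwk]
    intro p'
    rcases eq_or_ne p' p with rfl | hne
    · have := Submonoid.mul_mem _ (hN m hm) ((locUnits p').pow_mem hy m).1
      rwa [← mul_pow, mul_inv_cancel_left] at this
    · exact Submonoid.pow_mem _ (hy' p' hne) m
  have := Submonoid.mul_mem _ (le_localization p hyH) hy.2
  rwa [mul_inv, inv_inv, mul_comm x, mul_inv_cancel_left] at this

/-- If all powers of `x` have a common denominator locally at `p`, then `x` is locally a unit
multiple of an almost integral element of `H`. -/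
theorem exists_almost_integral (p : MinPrime H) {x c : Q} (hc : c ∈ localization H p)
    (h : ∀ n : ℕ, c * x ^ n ∈ localization H p) :
    ∃ y ∈ completeIntegralClosure H, x⁻¹ * y ∈ locUnits p := by
  obtain ⟨y, hy, hy'⟩ := exists_unit_mul hQ hwk p x
  obtain ⟨s, hs, -, hsc⟩ := hc
  refine ⟨y, ⟨s * c, hsc, fun n => ?_⟩, hy⟩
  rw [mem_iff_forall_localization hwk]
  intro p'
  rcases eq_or_ne p' p with rfl | hne
  · have h1 := Submonoid.mul_mem _ (le_localization p' hs)
      (Submonoid.mul_mem _ (h n) ((locUnits p').pow_mem hy n).1)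
    rwa [mul_assoc, ← mul_pow, mul_inv_cancel_left, ← mul_assoc] at h1
  · exact Submonoid.mul_mem _ (le_localization p' hsc) (Submonoid.pow_mem _ (hy' p' hne) n)

/-- Some `f` in the conductor is outside `p`, hence a unit at `p`, and it multiplies every almost
integral element of `H` into `H`. -/
theorem completeIntegralClosure_localization_eq {p : MinPrime H} (hp : p ∉ conductorPrimes H) :
    completeIntegralClosure (localization H p) = localization H p := by
  refine le_antisymm ?_ (le_completeIntegralClosure _)
  rintro x ⟨c, hc, h⟩
  obtain ⟨y, hy, hxy⟩ := exists_almost_integral hQ hwk p hc h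
  obtain ⟨f, hf, hfp⟩ := Set.not_subset.1 hp
  have hfH : f ∈ H := by simpa using hf 1 (Submonoid.one_mem _)
  have h1 : y ∈ localization H p := ⟨f, hfH, hfp, hf y hy⟩
  have := Submonoid.mul_mem _ h1 hxy.2
  rwa [mul_inv, inv_inv, mul_comm x, mul_inv_cancel_left] at this

/-- The classical argument that a primary, completely integrally closed monoid with the ascending
chain condition is a discrete valuation monoid. A maximal choice among the ideals `J b`, with `a⁻¹ *
b ∉ H_p`, produces `w = a⁻¹ * b` that multiplies all non-units into `H_p`; then `w⁻¹` is the
uniformizer. -/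
theorem exists_generator (hnoeth : IsVNoetherian H) {p : MinPrime H}
    (hp : p ∉ conductorPrimes H) : ∃ w, w ∉ localization H p ∧ w⁻¹ ∈ localization H p ∧
      ∀ x ∈ localization H p, x ∉ locUnits p → x * w ∈ localization H p := by
  obtain ⟨a, ha⟩ := p.2.1.2
  have haH := p.2.1.1.subset ha
  let J : Q → Set Q := fun b => (H : Set Q) ∩ (b⁻¹ * a) • (H : Set Q)
  have hJmem : ∀ b x, x ∈ J b ↔ x ∈ H ∧ a⁻¹ * (x * b) ∈ H := fun b x => by
    change x ∈ H ∧ x ∈ (b⁻¹ * a) • (H : Set Q) ↔ _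
    rw [Set.mem_smul_set_iff_inv_smul_mem, smul_eq_mul, mul_inv, inv_inv, mul_comm b, mul_assoc,
      mul_comm b]
    rfl
  have hJ : ∀ b, J b ⊆ (H : Set Q) ∧ vClosure H (J b) = J b := fun b => by
    refine ⟨Set.inter_subset_left, Set.Subset.antisymm (Set.subset_inter ?_ ?_)
      (subset_vClosure H _)⟩
    · conv_rhs => rw [← vClosure_self H]
      exact vClosure_mono Set.inter_subset_left
    · conv_rhs => rw [← vClosure_smul H]
      exact vClosure_mono Set.inter_subset_right
  have hone : a⁻¹ * 1 ∉ localization H p := fun h =>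
    notMem_of_mem_locUnits (p := p) ⟨le_localization p haH, by rwa [mul_one] at h⟩ ha
  obtain ⟨⟨I, hI⟩, ⟨b, hb, hbp, hIb⟩, hmax⟩ := hnoeth.wf.has_min
    {A | ∃ b ∈ H, a⁻¹ * b ∉ localization H p ∧ A.1 = J b}
    ⟨⟨J 1, hJ 1⟩, 1, H.one_mem, hone, rfl⟩
  change I = J b at hIb
  subst hIb
  have hmax' : ∀ c ∈ H, a⁻¹ * c ∉ localization H p → J b ⊆ J c → J c ⊆ J b := by
    intro c hc hcp hsub
    by_contra hcon
    exact hmax ⟨J c, hJ c⟩ ⟨c, hc, hcp, rfl⟩ ⟨hsub, hcon⟩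
  -- Maximality makes this ideal prime: if `y` is outside it, replacing `b` by `y * b` cannot
  -- enlarge `J b`. It lies in `p`, so it equals `p` by minimality.
  have hprime : IsPrimeSIdeal H {y | y ∈ H ∧ y * (a⁻¹ * b) ∈ localization H p} := by
    refine ⟨fun y hy => hy.1, ?_, ?_, ?_⟩
    · rintro x ⟨hx, hxw⟩ y hy
      refine ⟨H.mul_mem hx hy, ?_⟩
      rw [mul_right_comm]
      exact Submonoid.mul_mem _ hxw (le_localization p hy)
    · rintro ⟨-, h⟩
      rw [one_mul] at h
      exact hbp h
    · rintro x hx y hy ⟨-, hxy⟩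
      by_contra! hcon
      have hyb : a⁻¹ * (y * b) ∉ localization H p := fun h => hcon.2 ⟨hy, by
        rwa [mul_left_comm]⟩
      have hsub : J b ⊆ J (y * b) := fun z hz => by
        rw [hJmem] at hz ⊢
        refine ⟨hz.1, ?_⟩
        have := H.mul_mem hy hz.2
        rwa [show a⁻¹ * (z * (y * b)) = y * (a⁻¹ * (z * b)) by ac_rfl]
      obtain ⟨s, hs, hsp, hsm⟩ := hxy
      have h1 : s * x ∈ J (y * b) := by
        rw [hJmem]
        refine ⟨H.mul_mem hs hx, ?_⟩
        rwa [show a⁻¹ * (s * x * (y * b)) = s * (x * y * (a⁻¹ * b)) by ac_rfl]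
      have h2 := ((hJmem _ _).1 (hmax' _ (H.mul_mem hy hb) hyb hsub h1)).2
      refine hcon.1 ⟨hx, s, hs, hsp, ?_⟩
      rwa [show s * (x * (a⁻¹ * b)) = a⁻¹ * (s * x * b) by ac_rfl]
  have hsub : {y | y ∈ H ∧ y * (a⁻¹ * b) ∈ localization H p} ⊆ p.1 := by
    rintro y ⟨hy, hyw⟩
    by_contra hyp
    apply hbp
    have := Submonoid.mul_mem _ (mem_locUnits_of_notMem hy hyp).2 hyw
    rwa [inv_mul_cancel_left] at this
  have hple := p.2.2 ⟨hprime, ⟨a, haH, by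
    rw [mul_inv_cancel_left]; exact le_localization p hb⟩⟩ hsub
  have hall : ∀ x ∈ localization H p, x ∉ locUnits p → x * (a⁻¹ * b) ∈ localization H p := by
    rintro x ⟨s, hs, hsp, hsx⟩ hxu
    have hsu := mem_locUnits_of_notMem hs hsp
    have hsxp : s * x ∈ p.1 := by
      by_contra h
      have := (locUnits p).mul_mem ((locUnits p).inv_mem hsu) (mem_locUnits_of_notMem hsx h)
      rw [inv_mul_cancel_left] at this
      exact hxu this
    have := Submonoid.mul_mem _ hsu.2 (hple hsxp).2
    rwa [mul_assoc, inv_mul_cancel_left] at this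
  refine ⟨a⁻¹ * b, hbp, ?_, hall⟩
  -- If `w⁻¹` were not in `H_p`, then `w` would map non-units to non-units. All `a * w ^ n` would
  -- lie in `H_p`, making `w` almost integral and hence an element of `H_p`.
  by_contra hinv
  have hau : a ∉ locUnits p := fun h => notMem_of_mem_locUnits h ha
  have hpow : ∀ n : ℕ, a * (a⁻¹ * b) ^ n ∈ localization H p ∧
      a * (a⁻¹ * b) ^ n ∉ locUnits p := by
    intro n
    induction n with
    | zero => simpa using ⟨le_localization p haH, hau⟩
    | succ n ih =>
      have h1 := hall _ ih.1 ih.2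
      rw [mul_assoc, ← pow_succ] at h1
      refine ⟨h1, fun h2 => hinv ?_⟩
      have := Submonoid.mul_mem _ ih.1 h2.2
      rwa [pow_succ, mul_inv, mul_inv, show a * (a⁻¹ * b) ^ n * (a⁻¹ * (((a⁻¹ * b) ^ n)⁻¹ *
        (a⁻¹ * b)⁻¹)) = (a * a⁻¹) * ((a⁻¹ * b) ^ n * ((a⁻¹ * b) ^ n)⁻¹) * (a⁻¹ * b)⁻¹ by
          ac_rfl, mul_inv_cancel, mul_inv_cancel, one_mul, one_mul] at this
  apply hbp
  rw [← completeIntegralClosure_localization_eq hQ hwk hp]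
  exact ⟨a, le_localization p haH, fun n => (hpow n).1⟩

theorem exists_locShape_of_notMem (hnoeth : IsVNoetherian H) {p : MinPrime H}
    (hp : p ∉ conductorPrimes H) : ∃ q : Fin 1 → Q,
      LocShape (localization H p) (completeIntegralClosure (localization H p)) q ∧
      ∀ ε, IsUnitOf (completeIntegralClosure (localization H p)) ε → ε ∈ locUnits p := by
  obtain ⟨w, hw, hw', hall⟩ := exists_generator hQ hwk hnoeth hp
  rw [completeIntegralClosure_localization_eq hQ hwk hp]
  refine ⟨fun _ => w⁻¹, ⟨one_pos, le_rfl, ⟨fun _ => hw', fun x hx => ?_⟩, fun x hx hxu => ?_,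
    fun y hy => ?_⟩, fun ε h => h⟩
  · have hwu : w⁻¹ ∉ locUnits p := fun h => hw (by have := h.2; rwa [inv_inv] at this)
    obtain ⟨m, hm⟩ := exists_pow_mul_mem_of_nonunit hQ p hw' hwu x⁻¹
    -- The order of `x` is found by multiplying by `w` until `H_p` is left; the last element inside
    -- is a unit. The process stops because some power of the non-unit `w⁻¹` is a multiple of `x` in
    -- `H_p`.
    have hex : ∃ m : ℕ, x * w ^ m ∉ localization H p := by
      refine ⟨m + 1, fun h => hw ?_⟩
      have := Submonoid.mul_mem _ h hm
      rwa [pow_succ, show x * (w ^ m * w) * (w⁻¹ ^ m * x⁻¹) = (x * x⁻¹) * (w * w⁻¹) ^ m * w by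
        rw [mul_pow]; ac_rfl, mul_inv_cancel, mul_inv_cancel, one_pow, one_mul, one_mul] at this
    classical
    have hm0 : Nat.find hex ≠ 0 := fun h0 => by
      have := Nat.find_spec hex
      rw [h0, pow_zero, mul_one] at this
      exact this hx
    obtain ⟨k, hk⟩ := Nat.exists_eq_succ_of_ne_zero hm0
    have hspec := Nat.find_spec hex
    have hmin := Nat.find_min hex (m := k) (by omega)
    rw [not_not] at hmin
    rw [hk] at hspec
    have hunit : x * w ^ k ∈ locUnits p := by
      by_contra h
      apply hspec
      have := hall _ hmin h
      rwa [mul_assoc, ← pow_succ] at this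
    refine ⟨fun _ => k, ⟨x * w ^ k, hunit, ?_⟩, ?_⟩
    · simp [mul_assoc]
    · rintro k' ⟨u, hu, hxu⟩
      funext i
      rw [Finset.univ_unique, Finset.prod_singleton] at hxu
      have hi : (default : Fin 1) = i := Subsingleton.elim _ _
      rw [hi] at hxu
      have h1 : x * w ^ k' i ∈ locUnits p := by
        rw [hxu, mul_assoc, ← mul_pow, inv_mul_cancel, one_pow, mul_one]
        exact hu
      have key : ∀ i j : ℕ, x * w ^ i ∈ locUnits p → x * w ^ j ∈ locUnits p → ¬ i < j := by
        intro i j hi hj hij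
        obtain ⟨d, rfl⟩ := Nat.exists_eq_add_of_lt hij
        have h2 := (locUnits p).mul_mem ((locUnits p).inv_mem hi) hj
        rw [add_assoc, pow_add, ← mul_assoc x, inv_mul_cancel_left, pow_succ] at h2
        apply hw
        have := Submonoid.mul_mem _ h2.1 (Submonoid.pow_mem _ hw' d)
        rwa [mul_right_comm, ← mul_pow, mul_inv_cancel, one_pow, one_mul] at this
      have := key _ _ h1 hunit
      have := key _ _ hunit h1
      omega
  · exact ⟨x * w, hall x hx hxu, by simp [mul_comm x]⟩
  · rw [Finset.univ_unique, Finset.prod_singleton]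
    exact Submonoid.mul_mem _ hw' hy

/-- High powers of `q_1 ⋯ q_n * y` are divisible by `c` in `F`, hence lie in `H_p`, and
seminormality brings down the element itself. Non-units have positive exponents because a power of
each is divisible by `q_1 ⋯ q_n`. -/
theorem locShape_of_seminormal (hsemi : IsSeminormal H) (p : MinPrime H) {n : ℕ} (hn : 0 < n)
    {q : Fin n → Q} (hb : IsPrimeBasis (completeIntegralClosure (localization H p)) q) {c : Q}
    (hc : c ∈ localization H p)
    (hcF : ∀ y ∈ completeIntegralClosure (localization H p), c * y ∈ localization H p) :
    LocShape (localization H p) (completeIntegralClosure (localization H p)) q := by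
  set F := completeIntegralClosure (localization H p) with hF
  have hle : localization H p ≤ F := le_completeIntegralClosure _
  have habs : ∀ y ∈ F, (∏ i, q i) * y ∈ localization H p := by
    intro y hy
    refine isSeminormal_localization hQ hwk hsemi p _ ⟨∑ i, ord F q c i, fun m hm => ?_⟩
    have h1 : (∏ i, q i) ^ m * c⁻¹ ∈ F := by
      refine hb.mul_inv_mem (F.pow_mem hb.prod_mem' m) (hle hc) fun i => ?_
      rw [hb.ord_pow hb.prod_mem', hb.ord_prod, mul_one]
      exact (Finset.single_le_sum (fun i _ => Nat.zero_le (ord F q c i))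
        (Finset.mem_univ i)).trans hm
    have := hcF _ (F.mul_mem h1 (F.pow_mem hy m))
    rwa [mul_pow, show (∏ i, q i) ^ m * y ^ m = c * ((∏ i, q i) ^ m * c⁻¹ * y ^ m) by
      rw [show c * ((∏ i, q i) ^ m * c⁻¹ * y ^ m) = (c * c⁻¹) * ((∏ i, q i) ^ m * y ^ m) by
        ac_rfl, mul_inv_cancel, one_mul]]
  refine ⟨hn, hle, hb, fun x hx hxu => hb.exists_eq_prod_mul (hle hx) fun i => ?_, habs⟩
  obtain ⟨m, hm⟩ := exists_pow_mul_mem_of_nonunit hQ p hx hxu (∏ i, q i)⁻¹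
  have h1 : x ^ m = x ^ m * (∏ i, q i)⁻¹ * ∏ i, q i := by rw [inv_mul_cancel_right]
  have h2 := congrArg (fun z => ord F q z i) h1
  rw [hb.ord_pow (hle hx), hb.ord_mul (hle hm) hb.prod_mem', hb.ord_prod] at h2
  by_contra! h0
  rw [Nat.lt_one_iff.1 h0] at h2
  omega

/-- At a prime containing the conductor, the localization is not completely integrally closed. -/
theorem not_completeIntegralClosure_le {p : MinPrime H} (hp : p ∈ conductorPrimes H)
    (hf : (conductor H).Nonempty) :
    ¬ completeIntegralClosure (localization H p) ≤ localization H p := by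
  classical
  intro hle
  obtain ⟨f, hf⟩ := hf
  have hfH : f ∈ H := by simpa using hf 1 (Submonoid.one_mem _)
  -- This `y` is a unit at `p` and divisible by `f` elsewhere. If `H_p` were completely integrally
  -- closed, `y` would lie in the conductor, hence in `p`.
  obtain ⟨y, hy, hy'⟩ := exists_approx hQ hwk (x := Function.update (fun _ => f) p 1)
    ((finite_notMem_locUnits hQ hwk f).subset fun p' hp' => by
      rcases eq_or_ne p' p with rfl | hne
      · exact absurd (by simp [(locUnits p').one_mem]) hp'
      · simpa [Function.update_of_ne hne] using hp') p
  rw [Function.update_self, inv_one, one_mul] at hy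
  refine notMem_of_mem_locUnits hy (hp fun z hz => ?_)
  change y * z ∈ H
  rw [mem_iff_forall_localization hwk]
  intro p'
  rcases eq_or_ne p' p with rfl | hne
  · refine Submonoid.mul_mem _ hy.1 (hle ?_)
    obtain ⟨c, hc, h⟩ := hz
    exact ⟨c, le_localization _ hc, fun m => le_localization _ (h m)⟩
  · have h1 := hy' p'
    rw [Function.update_of_ne hne] at h1
    have := Submonoid.mul_mem _ h1 (le_localization p' (hf z hz))
    rwa [show f⁻¹ * y * (f * z) = f * f⁻¹ * (y * z) by ac_rfl, mul_inv_cancel, one_mul] at this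

-- If every prime missed some element of the conductor, each almost integral element would lie in
-- all localizations, and the conductor would be all of `H`.
omit hQ in
theorem conductorPrimes_nonempty (hf : conductor H ⊂ (H : Set Q)) :
    (conductorPrimes H).Nonempty := by
  by_contra hcon
  rw [Set.not_nonempty_iff_eq_empty] at hcon
  have h1 : (1 : Q) ∈ conductor H := by
    intro z hz
    rw [one_mul]
    change z ∈ H
    rw [mem_iff_forall_localization hwk]
    intro p
    obtain ⟨f, hf', hfp⟩ := Set.not_subset.1 fun h : conductor H ⊆ p.1 => by
      have : p ∈ conductorPrimes H := h
      rw [hcon] at this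
      exact this
    exact ⟨f, hf.1 hf', hfp, hf' z hz⟩
  refine hf.2 fun x hx z hz => ?_
  have := H.mul_mem hx (h1 z hz)
  rwa [one_mul] at this

omit hQ in
theorem conductorPrimes_finite (hf : (conductor H).Nonempty) : (conductorPrimes H).Finite := by
  obtain ⟨f, hf⟩ := hf
  have hfH : f ∈ H := by simpa using hf 1 (Submonoid.one_mem _)
  exact (hwk.2 f hfH).subset fun p hp => hp hf

end Shape

end WeaklyKrull


namespace WeaklyKrull

/-! ## The reduced monoid of a submonoid of a group -/

section Reduced

variable {Q : Type*} [CommGroup Q]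

/-- The reduced monoid `D / D^×`. -/
abbrev Reduced (D : Submonoid Q) : Type _ := ↥(D.map (QuotientGroup.mk' (unitGroup D)))

variable {D : Submonoid Q}

instance : CancelCommMonoid (Reduced D) where
  mul_left_cancel a _ _ h := Subtype.ext (mul_left_cancel (a := a.1) (congrArg Subtype.val h))

/-- The class of an element in the reduced monoid. -/
def reduce (D : Submonoid Q) : D →* Reduced D :=
  ((QuotientGroup.mk' (unitGroup D)).submonoidMap D)

theorem reduce_surjective : Function.Surjective (reduce D) :=
  MonoidHom.submonoidMap_surjective _ _

theorem reduce_eq_iff {x y : D} : reduce D x = reduce D y ↔ (x : Q)⁻¹ * y ∈ unitGroup D := by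
  rw [← QuotientGroup.eq, Subtype.ext_iff]
  rfl

theorem reduce_eq_one_iff {x : D} : reduce D x = 1 ↔ (x : Q) ∈ unitGroup D := by
  rw [← map_one (reduce D), reduce_eq_iff, OneMemClass.coe_one, mul_one, inv_mem_iff]

/-- A representative of an element of the reduced monoid. -/
noncomputable def representative (y : Reduced D) : D := (reduce_surjective y).choose

theorem reduce_representative (y : Reduced D) : reduce D (representative y) = y :=
  (reduce_surjective y).choose_spec

/-- The exponents of an element of the reduced monoid. -/
noncomputable def reducedOrd (F : Submonoid Q) {n : ℕ} (q : Fin n → Q) (y : Reduced D) :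
    Fin n → ℕ := ord F q (representative y : Q)

/-- The class of an element of the reduced monoid. -/
noncomputable def reducedClass (ψ : Q →* Multiplicative (ZMod 2)) (y : Reduced D) : ZMod 2 :=
  (ψ (representative y : Q)).toAdd

theorem reducedClass_reduce {ψ : Q →* Multiplicative (ZMod 2)}
    (hψ : ∀ u ∈ unitGroup D, ψ u = 1) (x : D) : reducedClass ψ (reduce D x) = (ψ x).toAdd := by
  have h := hψ _ (reduce_eq_iff.1 (reduce_representative (reduce D x)))
  rw [map_mul, map_inv, inv_mul_eq_one] at h
  rw [reducedClass, h]

namespace LocShape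

variable {F : Submonoid Q} {n : ℕ} {q : Fin n → Q} (S : LocShape D F q)
include S

theorem isUnitOf {u : Q} (h : u ∈ unitGroup D) : IsUnitOf F u := ⟨S.le h.1, S.le h.2⟩

theorem reducedOrd_reduce (x : D) (j : Fin n) : reducedOrd F q (reduce D x) j = ord F q x j := by
  have h := S.isUnitOf (reduce_eq_iff.1 (reduce_representative (reduce D x)))
  have h1 := S.basis.ord_mul (S.le (representative (reduce D x)).2) h.1 j
  rw [mul_inv_cancel_left, S.basis.ord_unit h, add_zero] at h1
  rw [reducedOrd, h1]

theorem localData {ψ : Q →* Multiplicative (ZMod 2)} (hψ : ∀ u ∈ unitGroup D, ψ u = 1) :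
    LocalData (reducedClass (D := D) ψ) (reducedOrd F q) where
  chi_mul a b := by
    obtain ⟨x, rfl⟩ := reduce_surjective a
    obtain ⟨y, rfl⟩ := reduce_surjective b
    rw [← map_mul, reducedClass_reduce hψ, reducedClass_reduce hψ, reducedClass_reduce hψ,
      Submonoid.coe_mul, map_mul, toAdd_mul]
  k_mul a b j := by
    obtain ⟨x, rfl⟩ := reduce_surjective a
    obtain ⟨y, rfl⟩ := reduce_surjective b
    rw [← map_mul, S.reducedOrd_reduce, S.reducedOrd_reduce, S.reducedOrd_reduce,
      Submonoid.coe_mul, S.basis.ord_mul (S.le x.2) (S.le y.2)]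
  pos a ha j := by
    obtain ⟨x, rfl⟩ := reduce_surjective a
    rw [Ne, reduce_eq_one_iff] at ha
    obtain ⟨y, hy, hxy⟩ := S.nonunit x x.2 ha
    rw [S.reducedOrd_reduce, hxy, S.basis.ord_mul S.basis.prod_mem' hy, S.basis.ord_prod]
    exact Nat.le_add_right _ _
  sub a b h := by
    obtain ⟨x, rfl⟩ := reduce_surjective a
    obtain ⟨y, rfl⟩ := reduce_surjective b
    simp only [S.reducedOrd_reduce] at h
    -- Strictly larger exponents make `y` divisible in `F` by `x * ∏ i, q i`; the extra factor `∏ i,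
    -- q i` brings the quotient back into `D`.
    have h1 := S.basis.mul_inv_mem (S.le y.2)
      (F.mul_mem (S.le x.2) S.basis.prod_mem') fun i => by
        rw [S.basis.ord_mul (S.le x.2) S.basis.prod_mem', S.basis.ord_prod]
        exact h i
    have h2 := S.absorb _ h1
    refine ⟨reduce D ⟨_, h2⟩, ?_⟩
    rw [← map_mul]
    congr 1
    apply Subtype.ext
    rw [Submonoid.coe_mul]
    change (y : Q) = x * ((∏ i, q i) * (y * (x * ∏ i, q i)⁻¹))
    rw [← mul_assoc, mul_comm (y : Q), mul_inv_cancel_left]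
  ex a ha := by
    have h1 : ∏ i, q i ^ a i ∈ D := by
      obtain ⟨y, hy, h⟩ := S.basis.exists_eq_prod_mul (S.basis.prod_mem a) fun i => by
        rw [S.basis.ord_prod_pow]; exact ha i
      rw [h]
      exact S.absorb y hy
    exact ⟨reduce D ⟨_, h1⟩, fun j => by
      rw [S.reducedOrd_reduce]; exact S.basis.ord_prod_pow a j⟩
  nonempty := ⟨⟨0, S.pos⟩⟩

open Classical in
theorem reducedClass_eq_sum {ψ : Q →* Multiplicative (ZMod 2)}
    (hψ : ∀ u, IsUnitOf F u → ψ u = 1) (y : Reduced D) :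
    reducedClass ψ y = ∑ j ∈ Finset.univ.filter (fun j => ψ (q j) ≠ 1),
      (reducedOrd F q y j : ZMod 2) := by
  obtain ⟨x, rfl⟩ := reduce_surjective y
  simp only [S.reducedOrd_reduce]
  rw [reducedClass_reduce fun u hu => hψ u (S.isUnitOf hu)]
  obtain ⟨u, hu, hx⟩ := S.basis.ord_spec (S.le x.2)
  generalize ord F q x = k at hx ⊢
  rw [hx, map_mul, hψ u hu, one_mul, map_prod, toAdd_prod, Finset.sum_filter]
  refine Finset.sum_congr rfl fun j _ => ?_
  rw [map_pow, toAdd_pow]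
  split_ifs with h
  · have : (ψ (q j)).toAdd = 1 := (zmod_two_cases _).resolve_left h
    rw [this, nsmul_one]
  · rw [not_not.1 h, toAdd_one, smul_zero]

/-- Multiplication by the unit `ε` of `F` changes the class without changing the exponents. -/
theorem exists_reducedOrd_eq {ψ : Q →* Multiplicative (ZMod 2)}
    (hψ : ∀ u ∈ unitGroup D, ψ u = 1) {ε : Q} (hε : IsUnitOf F ε) (hε' : ψ ε ≠ 1)
    (a : Fin n → ℕ) (ha : ∀ j, 1 ≤ a j) (g : ZMod 2) :
    ∃ y : Reduced D, (∀ j, reducedOrd F q y j = a j) ∧ reducedClass ψ y = g := by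
  have key : ∀ u, IsUnitOf F u → ∃ y : Reduced D, (∀ j, reducedOrd F q y j = a j) ∧
      reducedClass ψ y = (ψ u).toAdd + (ψ (∏ i, q i ^ a i)).toAdd := by
    intro u hu
    have hF := F.mul_mem hu.1 (S.basis.prod_mem a)
    have ho := S.basis.ord_eq (k := a) hu rfl
    have h1 : u * ∏ i, q i ^ a i ∈ D := by
      obtain ⟨y, hy, h⟩ := S.basis.exists_eq_prod_mul hF fun i => by rw [ho]; exact ha i
      rw [h]
      exact S.absorb y hy
    refine ⟨reduce D ⟨_, h1⟩, fun j => ?_, ?_⟩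
    · rw [S.reducedOrd_reduce]; exact congrFun ho j
    · rw [reducedClass_reduce hψ, map_mul, toAdd_mul]
  have he : (ψ ε).toAdd = 1 := (zmod_two_cases _).resolve_left hε'
  obtain ⟨y, hy, h⟩ := key 1 (unitGroup F).one_mem
  obtain ⟨y', hy', h'⟩ := key ε hε
  rw [map_one, toAdd_one, zero_add] at h
  rw [he] at h'
  by_cases hg : reducedClass ψ y = g
  · exact ⟨y, hy, hg⟩
  · refine ⟨y', hy', ?_⟩
    rw [h', ← h]
    revert hg
    generalize reducedClass ψ y = b
    revert b g
    decide

theorem exists_ne_of_unit {ε : Q} (hε : IsUnitOf F ε) (hε' : ε ∉ unitGroup D) :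
    ∃ y y' : Reduced D, y ≠ y' ∧ (∀ j, reducedOrd F q y j = 1) ∧
      ∀ j, reducedOrd F q y' j = 1 := by
  have h1 : ∏ i, q i ∈ D := by simpa using S.absorb 1 F.one_mem
  refine ⟨reduce D ⟨_, h1⟩, reduce D ⟨_, S.absorb ε hε.1⟩, fun h => ?_, fun j => ?_, fun j => ?_⟩
  · rw [reduce_eq_iff] at h
    simp only [inv_mul_cancel_left] at h
    exact hε' h
  · rw [S.reducedOrd_reduce]; exact S.basis.ord_prod j
  · rw [S.reducedOrd_reduce]
    change ord F q ((∏ i, q i) * ε) j = 1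
    rw [S.basis.ord_mul S.basis.prod_mem' hε.1, S.basis.ord_prod, S.basis.ord_unit hε]

end LocShape

end Reduced

/-! ## The block structure of a weakly Krull monoid -/

section Blocks

variable {Q : Type*} [CommGroup Q] {H : Submonoid Q}

/-- The image of an element in the product of the reduced localizations. -/
def toReduced (H : Submonoid Q) : Associates H →* ∀ p : MinPrime H, Reduced (localization H p) where
  toFun := Quotient.lift
    (fun (a : H) p => reduce (localization H p) ⟨a, le_localization p a.2⟩) (by
      rintro a b ⟨u, rfl⟩
      funext p
      rw [reduce_eq_iff]
      simp only [Submonoid.coe_mul, inv_mul_cancel_left]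
      refine ⟨le_localization p u.1.2, ?_⟩
      have : ((u : H) : Q)⁻¹ = ((↑u⁻¹ : H) : Q) := by
        rw [inv_eq_iff_mul_eq_one, ← Submonoid.coe_mul, Units.mul_inv, OneMemClass.coe_one]
      rw [this]
      exact le_localization p (↑u⁻¹ : H).2)
  map_one' := funext fun p => map_one (reduce (localization H p))
  map_mul' := by
    rintro ⟨a⟩ ⟨b⟩
    exact funext fun p => map_mul (reduce (localization H p))
      ⟨a, le_localization p a.2⟩ ⟨b, le_localization p b.2⟩

theorem toReduced_mk (a : H) (p : MinPrime H) : toReduced H (Associates.mk a) p =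
    reduce (localization H p) ⟨a, le_localization p a.2⟩ := rfl

variable (hQ : IsQuotientGroup H) (hwk : IsWeaklyKrull H)

include hwk in
theorem exists_toReduced_eq {a : Q} {y : ∀ p : MinPrime H, Reduced (localization H p)}
    (h : ∀ p, (representative (y p) : Q)⁻¹ * a ∈ locUnits p) : ∃ r, toReduced H r = y := by
  have ha : a ∈ H := by
    rw [mem_iff_forall_localization hwk]
    intro p
    have := Submonoid.mul_mem _ (representative (y p)).2 (h p).1
    rwa [mul_inv_cancel_left] at this
  refine ⟨Associates.mk ⟨a, ha⟩, funext fun p => ?_⟩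
  rw [toReduced_mk, ← reduce_representative (y p), eq_comm, reduce_eq_iff]
  exact h p

theorem representative_one_mem (p : MinPrime H) :
    (representative (1 : Reduced (localization H p)) : Q) ∈ locUnits p := by
  rw [← reduce_eq_one_iff, reduce_representative]

include hwk in
theorem toReduced_injective : Function.Injective (toReduced H) := by
  rintro ⟨a⟩ ⟨b⟩ h
  have h1 : ∀ p, (a : Q)⁻¹ * b ∈ locUnits p := fun p => reduce_eq_iff.1 (congrFun h p)
  apply Associates.mk_eq_mk_iff_associated.2
  have h2 : (a : Q)⁻¹ * b ∈ H := (mem_iff_forall_localization hwk).2 fun p => (h1 p).1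
  have h3 : ((a : Q)⁻¹ * b)⁻¹ ∈ H := (mem_iff_forall_localization hwk).2 fun p => (h1 p).2
  exact ⟨⟨⟨_, h2⟩, ⟨_, h3⟩, Subtype.ext (mul_inv_cancel _), Subtype.ext (inv_mul_cancel _)⟩,
    Subtype.ext (mul_inv_cancel_left _ _)⟩

include hwk in
theorem exists_eq_mul_of_toReduced {a b : Associates H}
    {δ : ∀ p : MinPrime H, Reduced (localization H p)}
    (h : toReduced H a = toReduced H b * δ) : ∃ c, a = b * c := by
  induction a using Quotient.inductionOn with | _ a => ?_
  induction b using Quotient.inductionOn with | _ b => ?_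
  have h2 : (b : Q)⁻¹ * a ∈ H := by
    rw [mem_iff_forall_localization hwk]
    intro p
    have h1 := congrFun h p
    rw [Pi.mul_apply, ← reduce_representative (δ p)] at h1
    change reduce _ ⟨(a : Q), _⟩ = reduce _ ⟨(b : Q), _⟩ * _ at h1
    rw [← map_mul, eq_comm, reduce_eq_iff] at h1
    have := Submonoid.mul_mem _ (representative (δ p)).2 h1.1
    simp only [Submonoid.coe_mul, mul_inv] at this
    rwa [show ((representative (δ p) : Q)) * ((b : Q)⁻¹ * ((representative (δ p) : Q))⁻¹ * a) =
      ((representative (δ p) : Q)) * ((representative (δ p) : Q))⁻¹ * ((b : Q)⁻¹ * a) by ac_rfl,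
      mul_inv_cancel, one_mul] at this
  refine ⟨Associates.mk ⟨_, h2⟩, ?_⟩
  change Associates.mk a = Associates.mk b * _
  rw [Associates.mk_mul_mk]
  congr 1
  exact Subtype.ext (mul_inv_cancel_left _ _).symm

include hQ hwk in
theorem finite_toReduced_ne_one (a : Associates H) : {p | toReduced H a p ≠ 1}.Finite := by
  induction a using Quotient.inductionOn with | _ a => ?_
  refine (finite_notMem_locUnits hQ hwk (a : Q)).subset fun p hp h => hp ?_
  change reduce _ ⟨(a : Q), _⟩ = 1
  rw [reduce_eq_one_iff]
  exact h

variable {φ : VClassGroup H →* Multiplicative (ZMod 2)} (hφ : Function.Injective φ)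
  {n : MinPrime H → ℕ} {q : ∀ p, Fin (n p) → Q}
  (S : ∀ p, LocShape (localization H p) (completeIntegralClosure (localization H p)) (q p))

theorem comp_localClass_eq_one (φ : VClassGroup H →* Multiplicative (ZMod 2)) (p : MinPrime H) :
    ∀ u ∈ locUnits p, (φ.comp (localClass hQ hwk p)) u = 1 := fun u hu => by
  rw [MonoidHom.comp_apply, localClass_of_mem_locUnits hQ hwk hu, map_one]

open Classical in
/-- The block structure of a weakly Krull monoid whose class group has two elements. -/
noncomputable def blockData : BlockData (Associates H) (MinPrime H)
    (fun p => Reduced (localization H p)) where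
  χ p := reducedClass (φ.comp (localClass hQ hwk p))
  χ_mul p := ((S p).localData (comp_localClass_eq_one hQ hwk φ p)).chi_mul
  red p := ((S p).localData (comp_localClass_eq_one hQ hwk φ p)).red
  Θ := toReduced H
  inj := toReduced_injective hwk
  dvd _ _ _ := exists_eq_mul_of_toReduced hwk
  single p y hy := by
    have h : localClass hQ hwk p (representative y : Q) = 1 := by
      apply hφ
      rw [map_one]
      exact hy
    obtain ⟨a, ha, ha'⟩ := (localClass_eq_one_iff hQ hwk).1 h
    refine exists_toReduced_eq hwk (a := a) fun p' => ?_
    rcases eq_or_ne p' p with rfl | hne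
    · rwa [Pi.mulSingle_eq_same]
    · rw [Pi.mulSingle_eq_of_ne hne]
      exact (locUnits p').mul_mem ((locUnits p').inv_mem (representative_one_mem p')) (ha' p' hne)
  pair p p' y w hne hy hw := by
    have h : localClass hQ hwk p (representative y : Q) *
        localClass hQ hwk p' (representative w : Q) = 1 := by
      apply hφ
      rw [map_one, map_mul]
      apply Multiplicative.toAdd.injective
      rw [toAdd_mul, toAdd_one]
      have e : (1 : ZMod 2) + 1 = 0 := by decide
      rw [← e]
      exact congrArg₂ _ hy hw
    obtain ⟨a, ha, ha', ha''⟩ := exists_of_localClass_mul_eq_one hQ hwk hne h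
    refine exists_toReduced_eq hwk (a := a) fun p'' => ?_
    rw [Pi.mul_apply]
    rcases eq_or_ne p'' p with rfl | h1
    · rwa [Pi.mulSingle_eq_same, Pi.mulSingle_eq_of_ne hne, mul_one]
    rcases eq_or_ne p'' p' with rfl | h2
    · rwa [Pi.mulSingle_eq_same, Pi.mulSingle_eq_of_ne h1, one_mul]
    · rw [Pi.mulSingle_eq_of_ne h1, Pi.mulSingle_eq_of_ne h2, mul_one]
      exact (locUnits p'').mul_mem ((locUnits p'').inv_mem (representative_one_mem p''))
        (ha'' p'' h1 h2)
  conv r p y h := by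
    obtain ⟨a, rfl⟩ := Associates.mk_surjective r
    have h1 : ∀ p', toReduced H (Associates.mk a) p' =
        (Pi.mulSingle p y : ∀ p, Reduced (localization H p)) p' := congrFun h
    have h2 : localClass hQ hwk p (a : Q) = 1 := by
      refine (localClass_eq_one_iff hQ hwk).2 ⟨a, by rw [inv_mul_cancel]; exact one_mem _,
        fun p' hne => ?_⟩
      have := h1 p'
      rwa [Pi.mulSingle_eq_of_ne hne, toReduced_mk, reduce_eq_one_iff] at this
    have h3 := h1 p
    rw [Pi.mulSingle_eq_same, toReduced_mk] at h3
    rw [← h3, reducedClass_reduce (comp_localClass_eq_one hQ hwk φ p)]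
    change (φ (localClass hQ hwk p (a : Q))).toAdd = 0
    rw [h2, map_one, toAdd_one]
  -- One exponent per prime suffices, since at a non-unit component all exponents are positive; only
  -- finitely many terms are non-zero.
  size a := ∑ᶠ p, reducedOrd (completeIntegralClosure (localization H p)) (q p)
    (toReduced H a p) ⟨0, (S p).pos⟩
  size_mul a b := by
    have hfin : ∀ a, (Function.support fun p => reducedOrd
        (completeIntegralClosure (localization H p)) (q p) (toReduced H a p)
        ⟨0, (S p).pos⟩).Finite := fun a =>
      (finite_toReduced_ne_one hQ hwk a).subset fun p hp h1 => hp (by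
        simp only [h1]
        exact ((S p).localData (comp_localClass_eq_one hQ hwk φ p)).k_one _)
    rw [← finsum_add_distrib (hfin a) (hfin b)]
    refine finsum_congr fun p => ?_
    rw [map_mul, Pi.mul_apply]
    exact ((S p).localData (comp_localClass_eq_one hQ hwk φ p)).k_mul _ _ _
  size_pos a ha := by
    have hfin : (Function.support fun p => reducedOrd
        (completeIntegralClosure (localization H p)) (q p) (toReduced H a p)
        ⟨0, (S p).pos⟩).Finite :=
      (finite_toReduced_ne_one hQ hwk a).subset fun p hp h1 => hp (by
        simp only [h1]
        exact ((S p).localData (comp_localClass_eq_one hQ hwk φ p)).k_one _)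
    have h1 : ∃ p, toReduced H a p ≠ 1 := by
      by_contra! hcon
      exact ha (toReduced_injective hwk ((funext hcon).trans (map_one _).symm))
    obtain ⟨p, hp⟩ := h1
    have h2 := ((S p).localData (comp_localClass_eq_one hQ hwk φ p)).pos _ hp ⟨0, (S p).pos⟩
    have h3 := single_le_finsum p hfin fun _ => Nat.zero_le _
    exact h2.trans h3

end Blocks

end WeaklyKrull


namespace WeaklyKrull

/-! ## Summary of the local arithmetic -/

section Bounds

variable {D : Type*} [CancelCommMonoid D] {χ : D → ZMod 2}

/-- The arithmetic of a local monoid with invariant `d`. -/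
structure LocalBounds (χ : D → ZMod 2) (d : ℤ) : Prop where
  lower : -1 ≤ d
  -- For `d = -1` the bound is 0, which in a reduced monoid means that there are no irreducibles of
  -- class `e`.
  locA : LocA χ (1 + d).toNat
  locB : LocB χ (2 + d.natAbs)
  gadget : ∀ r : ℕ, 2 ≤ r → (r : ℤ) ≤ 1 + d → Gadget χ r
  consecutive : d < 0 → ∃ T T' x, BFact χ T x ∧ BFact χ T' x ∧
    Multiset.card T' = Multiset.card T + 1

theorem LocB.mono {n m : ℕ} (h : LocB χ n) (hnm : n ≤ m) : LocB χ m := fun x h1 h2 h3 => by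
  obtain ⟨u, hu, H⟩ := h x h1 h2 h3
  refine ⟨u, hu, fun T hT => ?_⟩
  obtain ⟨T₀, T₁, T₁', e, hT', hm, hc, hc'⟩ := H T hT
  exact ⟨T₀, T₁, T₁', e, hT', hm, hc.trans hnm, hc'.trans hnm⟩

namespace LocalData

variable {n : ℕ} {k : D → Fin n → ℕ} (L : LocalData χ k)
include L

theorem localBounds_of_nontrivial
    (hnt : ∀ a : Fin n → ℕ, (∀ j, 1 ≤ a j) → ∀ g, ∃ y, (∀ j, k y j = a j) ∧ χ y = g) :
    LocalBounds χ 1 where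
  lower := by norm_num
  locA := L.locA_of_nontrivial hnt
  locB := L.locB_of_nontrivial hnt
  gadget r h h' := by
    obtain rfl : r = 2 := by omega
    exact L.gadget_of_nontrivial hnt
  consecutive h := by norm_num at h

theorem localBounds_rank_one {j₀ : Fin n} (hj : ∀ j, j = j₀)
    (hχ : (∀ x, χ x = 0) ∨ ∀ x, χ x = (k x j₀ : ZMod 2)) : LocalBounds χ 0 where
  lower := by norm_num
  locA := L.locA_rank_one hj hχ
  locB := L.locB_rank_one hj hχ
  gadget r h h' := by omega
  consecutive h := by norm_num at h

variable {E : Finset (Fin n)} (hχ : ∀ x, χ x = ∑ j ∈ E, (k x j : ZMod 2))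
include hχ

omit [CancelCommMonoid D] L in
theorem rank_one_cases {j₀ : Fin n} (hj : ∀ j, j = j₀) :
    (∀ x, χ x = 0) ∨ ∀ x, χ x = (k x j₀ : ZMod 2) := by
  rcases E.eq_empty_or_nonempty with rfl | ⟨j, hjE⟩
  · left
    intro x
    rw [hχ, Finset.sum_empty]
  · right
    intro x
    rw [hχ, show E = {j₀} from Finset.eq_singleton_iff_unique_mem.2
      ⟨hj j ▸ hjE, fun i _ => hj i⟩, Finset.sum_singleton]

theorem localBounds_of_card_eq_zero (hn : 2 ≤ n) (hE : E.card = 0) : LocalBounds χ (-1) := by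
  rw [Finset.card_eq_zero] at hE
  subst hE
  have h0 : ∀ x, χ x = 0 := fun x => by rw [hχ, Finset.sum_empty]
  have hab : (⟨0, by omega⟩ : Fin n) ≠ ⟨1, by omega⟩ := by simp
  have hC := fun v hv => L.short_of_trivial hχ hab (ρ := 2) le_rfl (by simp) (v := v) hv
  exact ⟨le_rfl, fun y₁ y₂ h₁ _ => by
      have := h₁.cls
      rw [h0] at this
      exact absurd this (by decide),
    L.locB_of_trivial hχ le_rfl hab hC, fun r h h' => by omega,
    fun _ => L.exists_consecutive hab h0⟩

theorem localBounds_of_rank_two (hn : n = 2) (hE : E.card = 2) : LocalBounds χ 2 := by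
  subst hn
  obtain rfl : E = Finset.univ := Finset.eq_univ_of_card E (by simpa using hE)
  have hJ : ∀ j : Fin 2, j = 0 ∨ j = 1 := by decide
  have hab : (0 : Fin 2) ≠ 1 := by decide
  have hχ' : ∀ x, χ x = ((k x 0 + k x 1 : ℕ) : ZMod 2) := fun x => by
    rw [hχ, Fin.sum_univ_two, Nat.cast_add]
  have hC := fun v hv => L.short_of_trivial hχ hab (ρ := 3) (by norm_num)
    (fun v h2 _ _ _ => L.short_of_rank_two_both hJ hab hχ' h2) (v := v) hv
  refine ⟨by norm_num, L.locA_of_short hC, L.locB_of_trivial hχ (by norm_num) hab hC,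
    fun r h h' => ?_, fun h => by norm_num at h⟩
  obtain rfl | rfl : r = 2 ∨ r = 3 := by omega
  · exact L.gadget_of_trivial hχ (Finset.mem_univ 1) hab
  · exact L.gadget_three hJ hab hχ'

theorem localBounds_of_card_pos (hn : 2 ≤ n) (hE : E.card ≠ 0) (h2 : ¬ (n = 2 ∧ E.card = 2)) :
    LocalBounds χ 1 := by
  have hab : (⟨0, by omega⟩ : Fin n) ≠ ⟨1, by omega⟩ := by simp
  obtain ⟨j, hj⟩ := Finset.card_ne_zero.1 hE
  have hother : ∀ c : Fin n, ∃ o, o ≠ c := fun c => by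
    by_cases h : c = ⟨0, by omega⟩
    · exact ⟨⟨1, by omega⟩, by rw [h]; exact hab.symm⟩
    · exact ⟨_, Ne.symm h⟩
  have hbig : ∀ v, (∀ j, 2 ≤ k v j) → ∀ c ∈ E, 3 ≤ k v c →
      ∃ T, LFact χ T v ∧ Multiset.card T ≤ 2 := by
    intro v hv c hc h3
    -- In rank two exactly one prime has class `e`, by `h2`. In higher rank there are two indices
    -- besides `c`.
    rcases eq_or_ne n 2 with rfl | hn2
    · obtain ⟨o, ho⟩ := hother c
      have hJ : ∀ j, j = c ∨ j = o := fun j => by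
        clear hc h3
        revert c o j
        decide
      have hE1 : E = {c} := by
        have h1 : E.card ≤ 2 := by simpa using Finset.card_le_univ E
        have h3 : E.card = 1 := by
          have : E.card ≠ 2 := fun h => h2 ⟨rfl, h⟩
          omega
        obtain ⟨a, rfl⟩ := Finset.card_eq_one.1 h3
        rw [Finset.mem_singleton.1 hc]
      exact L.short_of_rank_two_left hJ ho.symm
        (fun x => by rw [hχ, hE1, Finset.sum_singleton]) hv h3
    · obtain ⟨a, ha, b, hb, hne⟩ := Finset.one_lt_card.1
        (show 1 < (Finset.univ.erase c).card by
          rw [Finset.card_erase_of_mem (Finset.mem_univ c), Finset.card_fin]; omega)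
      exact L.exists_three hne (Finset.ne_of_mem_erase ha) (Finset.ne_of_mem_erase hb) hχ hc hv h3
  have hC := fun v hv => L.short_of_trivial hχ hab (ρ := 2) le_rfl hbig (v := v) hv
  refine ⟨by norm_num, L.locA_of_short hC, L.locB_of_trivial hχ le_rfl hab hC,
    fun r h h' => ?_, fun h => by norm_num at h⟩
  obtain rfl : r = 2 := by omega
  obtain ⟨o, ho⟩ := hother j
  exact L.gadget_of_trivial hχ hj ho

end LocalData

end Bounds

/-! ## Distances and the catenary degree from the local invariants -/

namespace BlockData

variable {M : Type*} [CommMonoid M] {ι : Type*} [DecidableEq ι] {D : ι → Type*}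
  [∀ i, CancelCommMonoid (D i)] (B : BlockData (Associates M) ι D)
include B

/-- With `m` the greatest element of the set, the costs `2 + d i + d j`, `2 + d i` and `2 + |d i|`
of the chain steps are all at most `m + 2`. Conversely, gadgets realize every distance up to `m`.
Indices outside `P` contribute only zeros, so sums involving them reduce to the terms `|d i|`. -/
theorem setOfDistances_and_catenaryDegree {P : Set ι} (hfin : P.Finite) (hne : P.Nonempty)
    {d : ι → ℤ} (hd : ∀ i, LocalBounds (B.χ i) (d i)) (hd0 : ∀ i ∉ P, d i = 0)
    (hπ : ∃ i ∉ P, Gadget (B.χ i) 1)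
    (htwo : ∀ i ∈ P, d i = 0 → ∃ T T' x, BFact (B.χ i) T x ∧ BFact (B.χ i) T' x ∧ T ≠ T') :
    ∃ m : ℕ, setOfDistances M = Set.Icc 1 m ∧ catenaryDegree M = ((m + 2 : ℕ) : ℕ∞) ∧
      IsGreatest ({z : ℤ | ∃ i ∈ P, ∃ j ∈ P, i ≠ j ∧ z = d i + d j} ∪
        {z : ℤ | ∃ i ∈ P, z = |d i|}) (m : ℤ) := by
  set S := {z : ℤ | ∃ i ∈ P, ∃ j ∈ P, i ≠ j ∧ z = d i + d j} ∪ {z : ℤ | ∃ i ∈ P, z = |d i|}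
    with hS
  have hSfin : S.Finite := by
    refine Set.Finite.union ?_ ?_
    · refine ((hfin.prod hfin).image fun x : ι × ι => d x.1 + d x.2).subset ?_
      rintro _ ⟨i, hi, j, hj, -, rfl⟩
      exact ⟨(i, j), ⟨hi, hj⟩, rfl⟩
    · refine (hfin.image fun i => |d i|).subset ?_
      rintro _ ⟨i, hi, rfl⟩
      exact ⟨i, hi, rfl⟩
  obtain ⟨i₀, hi₀⟩ := hne
  obtain ⟨z, hz⟩ := hSfin.exists_maximal ⟨_, Or.inr ⟨i₀, hi₀, rfl⟩⟩
  have hzle : ∀ w ∈ S, w ≤ z := fun w hw => by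
    by_contra! h
    exact absurd (hz.2 hw h.le) (not_le.2 h)
  have hz0 : 0 ≤ z := (abs_nonneg (d i₀)).trans (hzle _ (Or.inr ⟨i₀, hi₀, rfl⟩))
  lift z to ℕ using hz0 with m
  have habs : ∀ i, |d i| ≤ m := fun i => by
    by_cases hi : i ∈ P
    · exact hzle _ (Or.inr ⟨i, hi, rfl⟩)
    · rw [hd0 i hi]; simp
  have hadd : ∀ i j, i ≠ j → d i + d j ≤ m := fun i j hij => by
    by_cases hi : i ∈ P
    · by_cases hj : j ∈ P
      · exact hzle _ (Or.inl ⟨i, hi, j, hj, hij, rfl⟩)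
      · rw [hd0 j hj, add_zero]; exact (le_abs_self _).trans (habs i)
    · rw [hd0 i hi, zero_add]; exact (le_abs_self _).trans (habs j)
  have hle : catenaryDegree M ≤ ((m + 2 : ℕ) : ℕ∞) := by
    refine catenaryDegree_le fun r => B.conn_of_local (fun i => (hd i).locA) (by omega)
      (fun i => ?_) (fun i j hij => ?_) (fun i => (hd i).locB.mono ?_) r
    · have := (le_abs_self _).trans (habs i)
      omega
    · have := hadd i j hij
      have := (hd i).lower
      have := (hd j).lower
      omega
    · have := habs i
      rw [Int.abs_eq_natAbs, Nat.cast_le] at this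
      omega
  have hupper : ∀ δ ∈ setOfDistances M, δ ≤ m := fun δ hδ => by
    have := (add_two_le_catenaryDegree (fun _ _ _ h => B.mul_left_cancel h) hδ).trans hle
    rw [Nat.cast_le] at this
    omega
  obtain ⟨π, hπP, hπ⟩ := hπ
  -- A gadget of length `δ + 1` at `i` is paired with the gadget of length 1 at `π`, which gives the
  -- lengths `2` and `δ + 2`.
  have hone : ∀ i ∈ P, ∀ δ : ℕ, 1 ≤ δ → (δ : ℤ) ≤ d i → δ ∈ setOfDistances M :=
    fun i hi δ h1 h2 => mem_setOfDistances_of_gadgets B (i := i) (j := π)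
      (fun h => hπP (h ▸ hi)) ((hd i).gadget (δ + 1) (by omega) (by push_cast; omega)) hπ h1
      (by omega)
  have hlower : ∀ δ : ℕ, 1 ≤ δ → δ ≤ m → δ ∈ setOfDistances M := by
    intro δ h1 hm
    rcases hz.1 with ⟨i, hi, j, hj, hij, h⟩ | ⟨i, hi, h⟩
    · by_cases hδi : (δ : ℤ) ≤ d i
      · exact hone i hi δ h1 hδi
      by_cases hδj : (δ : ℤ) ≤ d j
      · exact hone j hj δ h1 hδj
      -- Now `d i` and `d j` are both below `δ` while `δ ≤ d i + d j`, so both are positive, and `δ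
      -- + 2` splits as `1 + d i` plus a length between `2` and `1 + d j`.
      exact mem_setOfDistances_of_gadgets B hij
        ((hd i).gadget (1 + d i).toNat (by omega) (by omega))
        ((hd j).gadget (δ + 2 - (1 + d i).toNat) (by omega) (by omega)) h1 (by omega)
    · rcases le_or_gt 0 (d i) with h0 | h0
      · rw [abs_of_nonneg h0] at h
        exact hone i hi δ h1 (by omega)
      · have := (hd i).lower
        rw [abs_of_neg h0] at h
        obtain rfl : δ = 1 := by omega
        obtain ⟨T, T', x, hT, hT', hc⟩ := (hd i).consecutive h0
        exact one_mem_setOfDistances B hT hT' hc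
  refine ⟨m, Set.Subset.antisymm (fun δ hδ => ⟨(mem_setOfDistances_iff.1 hδ).1, hupper δ hδ⟩)
    fun δ hδ => hlower δ hδ.1 hδ.2, le_antisymm hle ?_, hz.1, hzle⟩
  rcases Nat.eq_zero_or_pos m with rfl | hm
  -- Without distances, the bound `c ≥ 2` requires an element with two different factorizations.
  · have h0 : d i₀ = 0 := abs_nonpos_iff.1 (habs i₀)
    obtain ⟨T, T', x, hT, hT', hne⟩ := htwo i₀ hi₀ h0
    exact two_le_catenaryDegree_of_bFact B hT hT' hne
  · exact add_two_le_catenaryDegree (fun _ _ _ h => B.mul_left_cancel h) (hlower m hm le_rfl)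

end BlockData

end WeaklyKrull


namespace WeaklyKrull

open scoped Pointwise

/-! ## The local monoids of a weakly Krull monoid -/

section Local

variable {Q : Type*} [CommGroup Q] {H : Submonoid Q} (hQ : IsQuotientGroup H)
  (hwk : IsWeaklyKrull H) {φ : VClassGroup H →* Multiplicative (ZMod 2)}
  (hφ : Function.Injective φ) {e : VClassGroup H} (he : e ≠ 1) {p : MinPrime H} {n : ℕ}
  {q : Fin n → Q}
  (S : LocShape (localization H p) (completeIntegralClosure (localization H p)) q)

include hφ he in
theorem map_ne_one_iff (g : VClassGroup H) : φ g ≠ 1 ↔ g = e := by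
  have h1 : ∀ x : VClassGroup H, x ≠ 1 → φ x = Multiplicative.ofAdd 1 := fun x hx =>
    (zmod_two_cases (φ x).toAdd).resolve_left fun h => hx (hφ (by rw [map_one]; exact h))
  constructor
  · intro h
    exact hφ ((h1 g fun hg => h (by rw [hg, map_one])).trans (h1 e he).symm)
  · rintro rfl
    rw [h1 g he]
    decide

theorem trivialUnitClasses_iff : TrivialUnitClasses H p ↔
    ∀ ε, IsUnitOf (completeIntegralClosure (localization H p)) ε → localClass hQ hwk p ε = 1 :=
  forall₂_congr fun _ _ => hasLocalClass_iff hQ hwk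

include hφ he in
open Classical in
theorem numClass_eq : numClass H e p q =
    (Finset.univ.filter fun j => (φ.comp (localClass hQ hwk p)) (q j) ≠ 1).card := by
  rw [numClass, ← Set.ncard_coe_finset]
  congr 1
  ext j
  simp only [Set.mem_ofPred_eq, Finset.coe_filter, Finset.mem_univ, true_and,
    MonoidHom.comp_apply, map_ne_one_iff hφ he]
  exact hasLocalClass_iff hQ hwk

include S hφ he in
theorem localBounds_localInvariant :
    LocalBounds (reducedClass (D := localization H p) (φ.comp (localClass hQ hwk p)))
      (localInvariant H e p q) := by
  classical
  have hψ := comp_localClass_eq_one hQ hwk φ p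
  have L := S.localData hψ
  rw [localInvariant, numClass_eq hQ hwk hφ he]
  by_cases hT : TrivialUnitClasses H p
  · have hT' : ∀ u, IsUnitOf (completeIntegralClosure (localization H p)) u →
        (φ.comp (localClass hQ hwk p)) u = 1 := fun u hu => by
      rw [MonoidHom.comp_apply, (trivialUnitClasses_iff hQ hwk).1 hT u hu, map_one]
    have hχ := S.reducedClass_eq_sum hT'
    simp only [hT, true_and]
    split_ifs with h1 h2 h3
    · exact L.localBounds_of_rank_two hχ h1.1 h1.2
    · subst h2
      exact L.localBounds_rank_one (j₀ := 0) (fun j => Subsingleton.elim _ _)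
        (LocalData.rank_one_cases hχ fun j => Subsingleton.elim _ _)
    · exact L.localBounds_of_card_eq_zero hχ h3.1 h3.2
    · have hn : 2 ≤ n := by have := S.pos; omega
      exact L.localBounds_of_card_pos hχ hn (fun h => h3 ⟨hn, h⟩) h1
  · simp only [hT, false_and, if_false]
    rw [trivialUnitClasses_iff hQ hwk] at hT
    push Not at hT
    obtain ⟨ε, hε, hne⟩ := hT
    exact L.localBounds_of_nontrivial (S.exists_reducedOrd_eq hψ hε fun h =>
      hne (hφ (by rw [map_one]; exact h)))

-- The invariant vanishes only in rank one with trivial unit classes. As `H_p` is not completely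
-- integrally closed, its closure has an element outside `H_p`. That element has exponent 0, since
-- anything else is absorbed, so it is a new unit and factorizations are not unique.
include S in
theorem exists_two_bFact_of_localInvariant_eq_zero (hp : p ∈ conductorPrimes H)
    (hf : (conductor H).Nonempty) (h0 : localInvariant H e p q = 0) :
    ∃ T T' x, BFact (reducedClass (D := localization H p) (φ.comp (localClass hQ hwk p))) T x ∧
      BFact (reducedClass (D := localization H p) (φ.comp (localClass hQ hwk p))) T' x ∧
      T ≠ T' := by
  have hT : TrivialUnitClasses H p ∧ n = 1 := by
    by_contra hcon
    rw [localInvariant, if_neg hcon] at h0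
    split_ifs at h0 <;> norm_num at h0
  obtain ⟨hT, rfl⟩ := hT
  have hT' : ∀ u, IsUnitOf (completeIntegralClosure (localization H p)) u →
      (φ.comp (localClass hQ hwk p)) u = 1 := fun u hu => by
    rw [MonoidHom.comp_apply, (trivialUnitClasses_iff hQ hwk).1 hT u hu, map_one]
  obtain ⟨x, hx, hxp⟩ := SetLike.not_le_iff_exists.1 (not_completeIntegralClosure_le hQ hwk hp hf)
  have hx0 : ord (completeIntegralClosure (localization H p)) q x = 0 := by
    by_contra hne
    have h1 : ∀ i, 1 ≤ ord (completeIntegralClosure (localization H p)) q x i := fun i =>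
      Nat.one_le_iff_ne_zero.2 fun h => hne (funext fun j => by
        rw [Subsingleton.elim j i]; exact h)
    obtain ⟨y, hy, hxy⟩ := S.basis.exists_eq_prod_mul hx h1
    exact hxp (hxy ▸ S.absorb y hy)
  obtain ⟨u, hu, hxu⟩ := S.basis.ord_spec hx
  rw [hx0] at hxu
  obtain rfl : x = u := by simpa using hxu
  obtain ⟨y, y', hne, hy, hy'⟩ := S.exists_ne_of_unit hu fun h => hxp h.1
  have L := S.localData (comp_localClass_eq_one hQ hwk φ p)
  exact L.exists_two_bFact_rank_one (j₀ := 0) (fun j => Subsingleton.elim _ _)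
    (LocalData.rank_one_cases (S.reducedClass_eq_sum hT') fun j => Subsingleton.elim _ _)
    (hy 0) (hy' 0) hne

end Local

/-! ### Primes not containing the conductor -/

section Regular

variable {Q : Type*} [CommGroup Q] {H : Submonoid Q} (hQ : IsQuotientGroup H)
  (hwk : IsWeaklyKrull H) {φ : VClassGroup H →* Multiplicative (ZMod 2)}
  (hφ : Function.Injective φ) {e : VClassGroup H} (he : e ≠ 1) {p : MinPrime H} {q : Fin 1 → Q}
  (S : LocShape (localization H p) (completeIntegralClosure (localization H p)) q)
  (hu : ∀ ε, IsUnitOf (completeIntegralClosure (localization H p)) ε → ε ∈ locUnits p)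
include S hu

theorem localBounds_zero :
    LocalBounds (reducedClass (D := localization H p) (φ.comp (localClass hQ hwk p))) 0 := by
  have L := S.localData (comp_localClass_eq_one hQ hwk φ p)
  exact L.localBounds_rank_one (j₀ := 0) (fun j => Subsingleton.elim _ _)
    (LocalData.rank_one_cases
      (S.reducedClass_eq_sum fun u h => comp_localClass_eq_one hQ hwk φ p u (hu u h))
      fun j => Subsingleton.elim _ _)

-- The ideal `p` is the `v`-ideal that is `q 0 * H_p` at `p` and trivial elsewhere, so its class is
-- that of the prime element. Hence `χ` is the parity of the exponent.
include hφ he in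
theorem gadget_one (hcl : HasClass H p.1 e)
    (hF : completeIntegralClosure (localization H p) = localization H p) :
    Gadget (reducedClass (D := localization H p) (φ.comp (localClass hQ hwk p))) 1 := by
  classical
  have hset : p.1 = (q 0 • (localization H p : Set Q)) ∩
      ⋂ p' : {p' : MinPrime H // p' ≠ p}, (localization H p'.1 : Set Q) := by
    ext x
    rw [Set.mem_inter_iff, Set.mem_smul_set, Set.mem_iInter]
    constructor
    · intro hx
      have hxH := p.2.1.1.subset hx
      obtain ⟨y, hy, hxy⟩ := S.nonunit x (le_localization p hxH)
        fun h => notMem_of_mem_locUnits h hx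
      refine ⟨⟨y, hF ▸ hy, ?_⟩, fun p' => le_localization p'.1 hxH⟩
      rw [hxy, Fin.prod_univ_one]
      rfl
    · rintro ⟨⟨y, hy, rfl⟩, h⟩
      rw [smul_eq_mul] at h ⊢
      have hy' : y ∈ completeIntegralClosure (localization H p) := by
        rw [hF]; exact hy
      have hmem : q 0 * y ∈ H := by
        rw [mem_iff_forall_localization hwk]
        intro p'
        rcases eq_or_ne p' p with rfl | hne
        · have := S.absorb y hy'
          rwa [Fin.prod_univ_one] at this
        · exact h ⟨p', hne⟩
      by_contra hxp
      have h1 := S.basis.ord_unit (S.isUnitOf (mem_locUnits_of_notMem hmem hxp)) 0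
      have h2 := S.basis.ord_prod 0
      rw [Fin.prod_univ_one] at h2
      rw [S.basis.ord_mul (S.basis.1 0) hy', h2] at h1
      omega
  have hq : localClass hQ hwk p (q 0) = e := by
    rw [← hasLocalClass_iff hQ hwk, HasLocalClass, ← hset]
    exact hcl
  have L := S.localData (comp_localClass_eq_one hQ hwk φ p)
  refine L.gadget_rank_one (j₀ := 0) (fun j => Subsingleton.elim _ _) fun x => ?_
  rw [S.reducedClass_eq_sum fun u h => comp_localClass_eq_one hQ hwk φ p u (hu u h),
    Finset.sum_filter, Fin.sum_univ_one, if_pos]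
  rw [MonoidHom.comp_apply, hq, map_ne_one_iff hφ he]

end Regular

/-! ### The theorem for given prime bases, and the conclusion -/

section Main

variable {Q : Type*} [CommGroup Q] {H : Submonoid Q}

theorem setOfDistances_and_catenaryDegree_of_bases (hQ : IsQuotientGroup H)
    (hsemi : IsSeminormal H) (hnoeth : IsVNoetherian H) (hwk : IsWeaklyKrull H)
    (hf_nonempty : (conductor H).Nonempty) (hf_proper : conductor H ⊂ (H : Set Q))
    {s : MinPrime H → ℕ}
    (hfp : ∀ p ∈ conductorPrimes H, IsFinitelyPrimary (localization H p) (s p))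
    (hG : Nat.card (VClassGroup H) = 2)
    (hclasses : ∀ g : VClassGroup H, ∃ p : MinPrime H, p ∉ conductorPrimes H ∧ HasClass H p.1 g)
    {e : VClassGroup H} (he : e ≠ 1) {q : (p : MinPrime H) → Fin (s p) → Q}
    (hq : ∀ p ∈ conductorPrimes H,
      IsPrimeBasis (completeIntegralClosure (localization H p)) (q p)) :
    ∃ m : ℕ, setOfDistances H = Set.Icc 1 m ∧ catenaryDegree H = ((m + 2 : ℕ) : ℕ∞) ∧
      IsGreatest ({z : ℤ | ∃ p ∈ conductorPrimes H, ∃ p' ∈ conductorPrimes H,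
          p ≠ p' ∧ z = localInvariant H e p (q p) + localInvariant H e p' (q p')} ∪
        {z : ℤ | ∃ p ∈ conductorPrimes H, z = |localInvariant H e p (q p)|}) (m : ℤ) := by
  classical
  obtain ⟨φ, hφ⟩ : ∃ φ : VClassGroup H →* Multiplicative (ZMod 2), Function.Injective φ := by
    have : _root_.Fact (Nat.Prime 2) := ⟨Nat.prime_two⟩
    have h2 : IsCyclic (VClassGroup H) := isCyclic_of_prime_card hG
    have f := zmodCyclicMulEquiv h2
    rw [hG] at f
    exact ⟨f.symm.toMonoidHom, f.symm.injective⟩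
  have hshape : ∀ p ∈ conductorPrimes H,
      LocShape (localization H p) (completeIntegralClosure (localization H p)) (q p) := by
    intro p hp
    obtain ⟨-, c, hc, hcF⟩ := (hfp p hp).exists_basis (isQuotientGroup_localization hQ p)
    exact locShape_of_seminormal hQ hwk hsemi p (hfp p hp).1 (hq p hp) hc hcF
  have hall : ∀ p : MinPrime H, ∃ (n : ℕ) (q : Fin n → Q),
      LocShape (localization H p) (completeIntegralClosure (localization H p)) q := fun p => by
    by_cases hp : p ∈ conductorPrimes H
    · exact ⟨_, _, hshape p hp⟩
    · obtain ⟨q, S, -⟩ := exists_locShape_of_notMem hQ hwk hnoeth hp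
      exact ⟨_, _, S⟩
  choose n q' S using hall
  obtain ⟨m, h1, h2, h3⟩ := (blockData hQ hwk hφ S).setOfDistances_and_catenaryDegree
    -- The given bases `q` matter only at the conductor primes; elsewhere the localization is a
    -- discrete valuation monoid with invariant 0.
    (d := fun p => if p ∈ conductorPrimes H then localInvariant H e p (q p) else 0)
    (conductorPrimes_finite hwk hf_nonempty) (conductorPrimes_nonempty hwk hf_proper)
    (fun p => by
      split_ifs with hp
      · exact localBounds_localInvariant hQ hwk hφ he (hshape p hp)
      · obtain ⟨q, S, hu⟩ := exists_locShape_of_notMem hQ hwk hnoeth hp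
        exact localBounds_zero hQ hwk S hu)
    (fun p hp => if_neg hp)
    (by
      obtain ⟨p, hp, hcl⟩ := hclasses e
      obtain ⟨q, S, hu⟩ := exists_locShape_of_notMem hQ hwk hnoeth hp
      exact ⟨p, hp, gadget_one hQ hwk hφ he S hu hcl
        (completeIntegralClosure_localization_eq hQ hwk hp)⟩)
    (fun p hp h0 => by
      rw [if_pos hp] at h0
      exact exists_two_bFact_of_localInvariant_eq_zero hQ hwk (hshape p hp) hp hf_nonempty h0)
  refine ⟨m, h1, h2, ?_⟩
  convert h3 using 2
  · ext z
    constructor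
    · rintro ⟨p, hp, p', hp', hne, rfl⟩
      exact ⟨p, hp, p', hp', hne, by rw [if_pos hp, if_pos hp']⟩
    · rintro ⟨p, hp, p', hp', hne, rfl⟩
      exact ⟨p, hp, p', hp', hne, by rw [if_pos hp, if_pos hp']⟩
  · ext z
    constructor
    · rintro ⟨p, hp, rfl⟩
      exact ⟨p, hp, by rw [if_pos hp]⟩
    · rintro ⟨p, hp, rfl⟩
      exact ⟨p, hp, by rw [if_pos hp]⟩

end Main

end WeaklyKrull

theorem theorem3p3 {Q : Type*} [CommGroup Q] (H : Submonoid Q)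
    (hQ : WeaklyKrull.IsQuotientGroup H)
    (hsemi : WeaklyKrull.IsSeminormal H)
    (hnoeth : WeaklyKrull.IsVNoetherian H)
    (hwk : WeaklyKrull.IsWeaklyKrull H)
    (hf_nonempty : (WeaklyKrull.conductor H).Nonempty)
    (hf_proper : WeaklyKrull.conductor H ⊂ (H : Set Q))
    (s : WeaklyKrull.MinPrime H → ℕ)
    (hfp : ∀ p ∈ WeaklyKrull.conductorPrimes H,
      WeaklyKrull.IsFinitelyPrimary (WeaklyKrull.localization H p) (s p))
    (hG : Nat.card (WeaklyKrull.VClassGroup H) = 2)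
    (hclasses : ∀ g : WeaklyKrull.VClassGroup H, ∃ p : WeaklyKrull.MinPrime H,
      p ∉ WeaklyKrull.conductorPrimes H ∧ WeaklyKrull.HasClass H p.1 g) :
    (∃ a b : ℕ, WeaklyKrull.setOfDistances H = Set.Icc a b) ∧
    2 + ((sSup (WeaklyKrull.setOfDistances H) : ℕ) : ℕ∞) = WeaklyKrull.catenaryDegree H ∧
    (WeaklyKrull.setOfDistances H = ∅ ∨ IsLeast (WeaklyKrull.setOfDistances H) 1) ∧
    ∀ (e : WeaklyKrull.VClassGroup H), e ≠ 1 →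
      ∀ q : (p : WeaklyKrull.MinPrime H) → Fin (s p) → Q,
        (∀ p ∈ WeaklyKrull.conductorPrimes H, WeaklyKrull.IsPrimeBasis
          (WeaklyKrull.completeIntegralClosure (WeaklyKrull.localization H p)) (q p)) →
        IsGreatest
          ({m : ℤ | ∃ p ∈ WeaklyKrull.conductorPrimes H, ∃ p' ∈ WeaklyKrull.conductorPrimes H,
              p ≠ p' ∧ m = WeaklyKrull.localInvariant H e p (q p) +
                WeaklyKrull.localInvariant H e p' (q p')} ∪
            {m : ℤ | ∃ p ∈ WeaklyKrull.conductorPrimes H,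
              m = |WeaklyKrull.localInvariant H e p (q p)|})
          ((sSup (WeaklyKrull.setOfDistances H) : ℕ) : ℤ) := by
  open WeaklyKrull in
  have key := fun (e : VClassGroup H) (he : e ≠ 1) (q : (p : MinPrime H) → Fin (s p) → Q) hq =>
    setOfDistances_and_catenaryDegree_of_bases hQ hsemi hnoeth hwk hf_nonempty hf_proper hfp hG
      hclasses he (q := q) hq
  -- For `m = 0` the interval is empty and its supremum in `ℕ` is 0, matching the convention for the
  -- maximum.
  have hsup : ∀ m : ℕ, sSup (Set.Icc 1 m) = m := fun m => by
    rcases Nat.eq_zero_or_pos m with rfl | hm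
    · simp
    · exact csSup_Icc hm
  -- The first three claims mention no prime basis, so some basis has to be chosen for them.
  have hbases : ∀ p : WeaklyKrull.MinPrime H, ∃ q : Fin (s p) → Q,
      p ∈ WeaklyKrull.conductorPrimes H → WeaklyKrull.IsPrimeBasis
        (WeaklyKrull.completeIntegralClosure (WeaklyKrull.localization H p)) q := fun p => by
    by_cases hp : p ∈ WeaklyKrull.conductorPrimes H
    · obtain ⟨⟨q, hq⟩, -⟩ :=
        (hfp p hp).exists_basis (WeaklyKrull.isQuotientGroup_localization hQ p)
      exact ⟨q, fun _ => hq⟩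
    · exact ⟨1, fun h => absurd h hp⟩
  choose q₀ hq₀ using hbases
  have : Finite (WeaklyKrull.VClassGroup H) := Nat.finite_of_card_ne_zero (by omega)
  have : Nontrivial (WeaklyKrull.VClassGroup H) :=
    Finite.one_lt_card_iff_nontrivial.1 (by omega)
  obtain ⟨e₀, he₀⟩ := exists_ne (1 : WeaklyKrull.VClassGroup H)
  obtain ⟨m, h1, h2, -⟩ := key e₀ he₀ q₀ hq₀
  refine ⟨⟨1, m, h1⟩, ?_, ?_, fun e he q hq => ?_⟩
  · rw [h1, hsup, h2, add_comm]
    push_cast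
    rfl
  · rw [h1]
    rcases Nat.eq_zero_or_pos m with rfl | hm
    · left; simp
    · exact Or.inr (isLeast_Icc hm)
  · obtain ⟨m', h1', -, h3⟩ := key e he q hq
    rw [h1', hsup]
    exact h3
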